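/- Let $k\ge 1$ and let $\Sigma\subset S^{n-1}$ be a closed (compact, without boundary), embedded, minimal $C^2$ submanifold of dimension $k-1$ of the unit sphere of $\mathbb{R}^n$, whose normal bundle in $S^{n-1}$ is globally flat, i.e. has a global frame of sections that are parallel for the normal connection. Let $h:(0,\infty)\to\mathbb{R}$ be of class $C^2$, let $f(x)=e^{h(|x|)}$, and suppose that $\lim_{t\to 0^+}e^{h(t)}t^k$ exists and is finite, and that for some real $b>2-k$ one has $t\,h'(t)\ge b$ for all $t>0$. If the second fundamental form $A_\Sigma$ of $\Sigma$ in $S^{n-1}$ satisfies $|A_\Sigma|^2\le \frac{(k-2+b)^2}{4}+b$ at every point of $\Sigma$, then the cone $C(\Sigma)=\{tx : t\ge 0,\ x\in\Sigma\}$ is $f$-stable. Here $f$-stable means the following. Put $M=C(\Sigma)\setminus\{0\}$, $U=\mathbb{R}^n\setminus\{0\}$, and let $\mathcal{H}_k$ be the $k$-dimensional Hausdorff measure. Then $M$ is a $C^2$ submanifold of dimension $k$, relatively closed in $U$, with the following two properties. (i) $M$ is $f$-stationary in $U$: if $\varphi_t:M\to\mathbb{R}^n$, $-\varepsilon<t<\varepsilon$,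 is jointly of class $C^2$ in $(t,x)$, with $\varphi_0=\mathrm{id}$ and $\varphi_t(x)=x$ for $x\in M\setminus K$, where $K\subset U$ is compact, then $\frac{d}{dt}\big|_{t=0}\int_{\varphi_t(M\cap K)}f\,d\mathcal{H}_k=0$ (in particular, the derivative exists). (ii) For every $C^1$ normal vector field $X$ along $M$ with compact support in $U$, both of the following integrals converge and $$\int_M f\Big[\sum_{i,j=1}^k\langle B(e_i,e_j),X\rangle^2+\langle H,X\rangle^2\Big]d\mathcal{H}_k\le\int_M \Big[f\sum_{i=1}^k|(D_{e_i}X)^\perp|^2+\mathrm{Hess}f(X,X)\Big]d\mathcal{H}_k ,$$ where $e_1,\dots,e_k$ is an orthonormal basis of the tangent space of $M$, $D$ is the derivative of $\mathbb{R}^n$, $\perp$ is the component normal to $M$, $B(v,w)=(D_vw)^\perp$ is the second fundamental form of $M$ in $\mathbb{R}^n$, and $H=\sum_i B(e_i,e_i)$. -/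

import Mathlib

open Set Filter Topology MeasureTheory

noncomputable section

/-- `M` is an embedded `C²` submanifold of `ℝⁿ` of dimension `d` (without boundary): near each of
its points it is the image of a regular `C²` parametrization that is a homeomorphism onto its
image. -/
def IsC2Submanifold {n : ℕ} (d : ℕ) (M : Set (EuclideanSpace ℝ (Fin n))) : Prop :=
  ∀ p ∈ M, ∃ (V : Set (EuclideanSpace ℝ (Fin n))) (W : Set (EuclideanSpace ℝ (Fin d)))
    (F : EuclideanSpace ℝ (Fin d) → EuclideanSpace ℝ (Fin n)),
    IsOpen V ∧ p ∈ V ∧ IsOpen W ∧ ContDiffOn ℝ 2 F W ∧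
    (∀ u ∈ W, Function.Injective (fderiv ℝ F u)) ∧
    IsEmbedding (W.domRestrict F) ∧ F '' W = M ∩ V

/-- The tangent space `T_x M`, spanned by the vectors that are limits of rescaled secants of `M`
at `x`. -/
def tangentSubspace {n : ℕ} (M : Set (EuclideanSpace ℝ (Fin n))) (x : EuclideanSpace ℝ (Fin n)) :
    Submodule ℝ (EuclideanSpace ℝ (Fin n)) :=
  Submodule.span ℝ (tangentConeAt ℝ M x)

/-- The normal space of `M ⊆ ℝⁿ` at `x`. -/
def normalSubspace {n : ℕ} (M : Set (EuclideanSpace ℝ (Fin n))) (x : EuclideanSpace ℝ (Fin n)) :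
    Submodule ℝ (EuclideanSpace ℝ (Fin n)) :=
  (tangentSubspace M x)ᗮ

/-- The normal space at `x` of `S ⊆ S^{n-1}` as a submanifold of the unit sphere: the vectors
orthogonal to `T_x S` and tangent to the sphere, that is, orthogonal to `x`. -/
def sphereNormalSubspace {n : ℕ} (S : Set (EuclideanSpace ℝ (Fin n)))
    (x : EuclideanSpace ℝ (Fin n)) : Submodule ℝ (EuclideanSpace ℝ (Fin n)) :=
  (tangentSubspace S x ⊔ Submodule.span ℝ {x})ᗮ

/-- An orthonormal basis `e₁, …, e_d` of `T_x M`. All the expressions below in which it occurs do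
not depend on its choice. -/
def tangentBasis {n : ℕ} (M : Set (EuclideanSpace ℝ (Fin n))) (x : EuclideanSpace ℝ (Fin n)) :
    OrthonormalBasis (Fin (Module.finrank ℝ (tangentSubspace M x))) ℝ (tangentSubspace M x) :=
  stdOrthonormalBasis ℝ (tangentSubspace M x)

/-- The tangent vector field along `M` that extends `w ∈ T_x M`: at `y` it is the orthogonal
projection of `w` to `T_y M`. -/
def tangentExtension {n : ℕ} (M : Set (EuclideanSpace ℝ (Fin n))) (w : EuclideanSpace ℝ (Fin n)) :
    EuclideanSpace ℝ (Fin n) → EuclideanSpace ℝ (Fin n) :=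
  fun y => (tangentSubspace M y).starProjection w

/-- The directional derivative `D_v Y` at `x` of a vector field `Y` along `M`. It is determined by
the values of `Y` on `M` when `v ∈ T_x M`. -/
def derivAlong {n : ℕ} (M : Set (EuclideanSpace ℝ (Fin n)))
    (Y : EuclideanSpace ℝ (Fin n) → EuclideanSpace ℝ (Fin n))
    (x v : EuclideanSpace ℝ (Fin n)) : EuclideanSpace ℝ (Fin n) :=
  fderivWithin ℝ Y M x v

/-- The second fundamental form `B(v, w) = (D_v w)^⊥` of `M ⊆ ℝⁿ` at `x`, for `v, w ∈ T_x M`. -/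
def secondForm {n : ℕ} (M : Set (EuclideanSpace ℝ (Fin n)))
    (x v w : EuclideanSpace ℝ (Fin n)) : EuclideanSpace ℝ (Fin n) :=
  (normalSubspace M x).starProjection (derivAlong M (tangentExtension M w) x v)

/-- The mean curvature vector `H = ∑ B(e_i, e_i)` of `M ⊆ ℝⁿ`. -/
def meanCurvature {n : ℕ} (M : Set (EuclideanSpace ℝ (Fin n))) (x : EuclideanSpace ℝ (Fin n)) :
    EuclideanSpace ℝ (Fin n) :=
  ∑ i, secondForm M x (tangentBasis M x i) (tangentBasis M x i)

/-- The second fundamental form `A(v, w)` at `x` of `S ⊆ S^{n-1}` as a submanifold of the unit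
sphere: the component of `D_v w` that is normal to `S` and tangent to the sphere. -/
def sphereSecondForm {n : ℕ} (S : Set (EuclideanSpace ℝ (Fin n)))
    (x v w : EuclideanSpace ℝ (Fin n)) : EuclideanSpace ℝ (Fin n) :=
  (sphereNormalSubspace S x).starProjection (derivAlong S (tangentExtension S w) x v)

/-- `|A|²(x) = ∑ |A(e_i, e_j)|²` for `S ⊆ S^{n-1}`. -/
def sphereSecondFormNormSq {n : ℕ} (S : Set (EuclideanSpace ℝ (Fin n)))
    (x : EuclideanSpace ℝ (Fin n)) : ℝ :=
  ∑ i, ∑ j, ‖sphereSecondForm S x (tangentBasis S x i) (tangentBasis S x j)‖ ^ 2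

/-- `S` is minimal in the unit sphere: its mean curvature vector in the sphere vanishes. -/
def IsSphereMinimal {n : ℕ} (S : Set (EuclideanSpace ℝ (Fin n))) : Prop :=
  ∀ x ∈ S, ∑ i, sphereSecondForm S x (tangentBasis S x i) (tangentBasis S x i) = 0

/-- The normal bundle of `S ⊆ S^{n-1}` in the unit sphere is globally flat: it has a global frame
of sections that are parallel for the normal connection. -/
def HasGloballyFlatNormalBundle {n : ℕ} (S : Set (EuclideanSpace ℝ (Fin n))) : Prop :=
  ∃ (m : ℕ) (ν : Fin m → EuclideanSpace ℝ (Fin n) → EuclideanSpace ℝ (Fin n)),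
    (∀ α, ContDiffOn ℝ 1 (ν α) S) ∧
    (∀ x ∈ S, LinearIndependent ℝ (fun α => ν α x) ∧
      Submodule.span ℝ (range fun α => ν α x) = sphereNormalSubspace S x) ∧
    (∀ α, ∀ x ∈ S, ∀ v ∈ tangentSubspace S x,
      (sphereNormalSubspace S x).starProjection (derivAlong S (ν α) x v) = 0)

/-- The cone `{t x | t ≥ 0, x ∈ S}` over `S`. -/
def coneOver {n : ℕ} (S : Set (EuclideanSpace ℝ (Fin n))) : Set (EuclideanSpace ℝ (Fin n)) :=
  {y | ∃ t : ℝ, 0 ≤ t ∧ ∃ x ∈ S, y = t • x}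

/-- The weighted area `E_f(M) = ∫_M f dH_k`, where `H_k` is the `k`-dimensional Hausdorff measure
(normalized so that it is Lebesgue measure on `ℝᵏ`). -/
def weightedArea {n : ℕ} (f : EuclideanSpace ℝ (Fin n) → ℝ) (k : ℕ)
    (M : Set (EuclideanSpace ℝ (Fin n))) : ℝ :=
  ∫ x in M, f x ∂μHE[k]

/-- `φ_t`, `-ε < t < ε`, is a `C²` deformation of `M` in `U` that fixes the points of `M` outside
the compact set `K ⊆ U`. -/
structure IsDeformation {n : ℕ} (M U : Set (EuclideanSpace ℝ (Fin n))) (ε : ℝ)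
    (K : Set (EuclideanSpace ℝ (Fin n)))
    (φ : ℝ → EuclideanSpace ℝ (Fin n) → EuclideanSpace ℝ (Fin n)) : Prop where
  pos : 0 < ε
  isCompact : IsCompact K
  subset : K ⊆ U
  contDiffOn : ContDiffOn ℝ 2 (fun p : ℝ × EuclideanSpace ℝ (Fin n) => φ p.1 p.2)
    (Ioo (-ε) ε ×ˢ M)
  at_zero : ∀ x ∈ M, φ 0 x = x
  fixed : ∀ t ∈ Ioo (-ε) ε, ∀ x ∈ M \ K, φ t x = x

/-- The `k`-dimensional `M` is `f`-stationary in `U`: the first variation of the weighted area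
vanishes for every compactly supported deformation in `U`. As only `M ∩ K` is moved, and the
weighted area of `M` may be infinite, it is the weighted area of the image of `M ∩ K` that is
differentiated. -/
def IsFStationary {n : ℕ} (f : EuclideanSpace ℝ (Fin n) → ℝ) (k : ℕ)
    (M U : Set (EuclideanSpace ℝ (Fin n))) : Prop :=
  ∀ (ε : ℝ) (K : Set (EuclideanSpace ℝ (Fin n)))
    (φ : ℝ → EuclideanSpace ℝ (Fin n) → EuclideanSpace ℝ (Fin n)),
    IsDeformation M U ε K φ →
      HasDerivAt (fun t => weightedArea f k (φ t '' (M ∩ K))) 0 0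

/-- `X` is a `C¹` normal vector field along `M` with compact support in `U`. -/
structure IsNormalVariation {n : ℕ} (M U : Set (EuclideanSpace ℝ (Fin n)))
    (X : EuclideanSpace ℝ (Fin n) → EuclideanSpace ℝ (Fin n)) : Prop where
  contDiffOn : ContDiffOn ℝ 1 X M
  normal : ∀ x ∈ M, X x ∈ normalSubspace M x
  compactSupport : ∃ K, IsCompact K ∧ K ⊆ U ∧ ∀ x ∈ M \ K, X x = 0

/-- The integrand `f [∑ ⟨B(e_i, e_j), X⟩² + ⟨H, X⟩²]`. -/
def curvatureIntegrand {n : ℕ} (f : EuclideanSpace ℝ (Fin n) → ℝ)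
    (M : Set (EuclideanSpace ℝ (Fin n)))
    (X : EuclideanSpace ℝ (Fin n) → EuclideanSpace ℝ (Fin n)) (x : EuclideanSpace ℝ (Fin n)) : ℝ :=
  f x * ((∑ i, ∑ j,
      (inner ℝ (secondForm M x (tangentBasis M x i) (tangentBasis M x j)) (X x)) ^ 2) +
    (inner ℝ (meanCurvature M x) (X x)) ^ 2)

/-- The integrand `f ∑ |(D_{e_i} X)^⊥|² + Hess f (X, X)`. -/
def gradientIntegrand {n : ℕ} (f : EuclideanSpace ℝ (Fin n) → ℝ)
    (M : Set (EuclideanSpace ℝ (Fin n)))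
    (X : EuclideanSpace ℝ (Fin n) → EuclideanSpace ℝ (Fin n)) (x : EuclideanSpace ℝ (Fin n)) : ℝ :=
  f x * (∑ i, ‖(normalSubspace M x).starProjection (derivAlong M X x (tangentBasis M x i))‖ ^ 2) +
    fderiv ℝ (fderiv ℝ f) x (X x) (X x)

/-- The `k`-dimensional `C²` submanifold `M` is `f`-stable in the open set `U`, in which it has no
boundary: it is `f`-stationary in `U`, and the stability inequality holds for every compactly
supported normal variation field in `U`. -/
structure IsFStable {n : ℕ} (f : EuclideanSpace ℝ (Fin n) → ℝ) (k : ℕ)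
    (M U : Set (EuclideanSpace ℝ (Fin n))) : Prop where
  isOpen : IsOpen U
  boundary : U ∩ (closure M \ M) = ∅
  submanifold : IsC2Submanifold k M
  stationary : IsFStationary f k M U
  integrable_curvature : ∀ X, IsNormalVariation M U X →
    IntegrableOn (curvatureIntegrand f M X) M μHE[k]
  integrable_gradient : ∀ X, IsNormalVariation M U X →
    IntegrableOn (gradientIntegrand f M X) M μHE[k]
  inequality : ∀ X, IsNormalVariation M U X →
    ∫ x in M, curvatureIntegrand f M X x ∂μHE[k] ≤ ∫ x in M, gradientIntegrand f M X x ∂μHE[k]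

end

/-!
The cone `M = C(S) \ {0}` is parametrized by `(t, x) ↦ t x`, and everything about it is read off
from a parametrization `F` of the link `S` through `G(t, u) = t F(u)`. The tangent space of `M` at
`t x` is `T_x S ⊕ ℝ x`, so the normal space is the one of `S` in the sphere and does not change along
a ray. The radial direction does not contribute to the second fundamental form of `M`, which is
`t⁻¹` times that of `S` (`IsLocalParam.inner_paramHessian_coneParam`). Hence `M` is minimal when `S`
is (`meanCurvature_coneOver`).

*Stationarity* holds for any submanifold with zero mean curvature and any weight whose gradient is
tangent to it (`IsC2Submanifold.isFStationary`). The area formula for injective immersions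
(`IsImmersionOn.integral_image`) turns the weighted area of the deformed set into integrals over
parameter domains. Under the integral sign their derivative is the integral of
`f div_M X + ⟨∇f, X⟩`. A partition of unity localizes this integral to one parametrization `F`. There
the integrand times the Jacobian `J` is the divergence of `f J (DF)⁻¹ X`, where `(DF)⁻¹` is the left
inverse that vanishes on normal vectors, because the operator field `J (DF)⁻¹` is divergence free:
on tangent vectors by Jacobi's formula for the derivative of a determinant, on normal vectors
because its divergence is then a multiple of the mean curvature
(`IsLocalParam.trace_fderiv_normDet_smul_pinv`).

*Stability* comes from an inequality of Hardy type along each ray. For a normal field `X` put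
`Y(t) = X(t x)`, `w(t) = e^{h(t)} t^m` with `m = dim S`, and `c = (m - 1 + b) / 2`. The normal
derivative of `X` is at least `|Y'|` in norm, the Hessian of `f` in normal directions is
`f h'(t) / t`, and the curvature term is at most `f (c² + b) |Y|² / t²` by the bound on the second
fundamental form. Completing the square in `Y' + c Y / t` and using `t h' ≥ b` bounds the difference
of the two integrands, times `t^m`, from below by the derivative of `-c w |Y|² / t`
(`hardy_pointwise`), a function with compact support in `(0, ∞)`. Integration over the rays in polar
coordinates (`integral_coneOver_nonneg`) gives the stability inequality.
-/

noncomputable section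

set_option linter.unusedSectionVars false

/-! ### Linear algebra: left inverses, traces and the Jacobian -/

section LinearAlgebra

variable {E F : Type*} [NormedAddCommGroup E] [InnerProductSpace ℝ E] [FiniteDimensional ℝ E]
  [NormedAddCommGroup F] [InnerProductSpace ℝ F] [FiniteDimensional ℝ F]

open ContinuousLinearMap in
/-- The adjoint as a real continuous linear map between spaces of operators. -/
def adjointCLM (E F : Type*) [NormedAddCommGroup E] [InnerProductSpace ℝ E] [FiniteDimensional ℝ E]
    [NormedAddCommGroup F] [InnerProductSpace ℝ F] [FiniteDimensional ℝ F] :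
    (E →L[ℝ] F) →L[ℝ] (F →L[ℝ] E) :=
  LinearMap.toContinuousLinearMap
    { toFun := fun L => adjoint L
      map_add' := fun a b => map_add _ a b
      map_smul' := fun c a => by simp }

@[simp]
theorem adjointCLM_apply (L : E →L[ℝ] F) : adjointCLM E F L = ContinuousLinearMap.adjoint L := rfl

/-- The trace as a continuous linear functional on operators. -/
def traceCLM (E : Type*) [NormedAddCommGroup E] [InnerProductSpace ℝ E] [FiniteDimensional ℝ E] :
    (E →L[ℝ] E) →L[ℝ] ℝ :=
  LinearMap.toContinuousLinearMap (LinearMap.trace ℝ E ∘ₗ ContinuousLinearMap.coeLM ℝ)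

theorem traceCLM_apply (A : E →L[ℝ] E) : traceCLM E A = LinearMap.trace ℝ E A.toLinearMap := rfl

theorem traceCLM_eq_sum_inner {ι : Type*} [Fintype ι] (b : OrthonormalBasis ι ℝ E)
    (A : E →L[ℝ] E) : traceCLM E A = ∑ i, inner ℝ (b i) (A (b i)) := by
  rw [traceCLM_apply, LinearMap.trace_eq_sum_inner _ b]
  rfl

theorem traceCLM_comp_comm (A : F →L[ℝ] E) (B : E →L[ℝ] F) :
    traceCLM E (A ∘L B) = traceCLM F (B ∘L A) := by
  rw [traceCLM_apply, traceCLM_apply]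
  exact LinearMap.trace_comp_comm' A.toLinearMap B.toLinearMap |>.symm

theorem traceCLM_adjoint (A : E →L[ℝ] E) :
    traceCLM E (ContinuousLinearMap.adjoint A) = traceCLM E A := by
  rw [traceCLM_eq_sum_inner (stdOrthonormalBasis ℝ E), traceCLM_eq_sum_inner (stdOrthonormalBasis ℝ E)]
  refine Finset.sum_congr rfl fun i _ => ?_
  rw [ContinuousLinearMap.adjoint_inner_right, real_inner_comm]

theorem contDiff_det {n : WithTop ℕ∞} : ContDiff ℝ n fun A : E →L[ℝ] E => A.det := by
  let b := (stdOrthonormalBasis ℝ E).toBasis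
  have h : (fun A : E →L[ℝ] E => A.det) = fun A : E →L[ℝ] E =>
      ∑ σ : Equiv.Perm (Fin (Module.finrank ℝ E)), ((Equiv.Perm.sign σ : ℤ) : ℝ) *
        ∏ i, LinearMap.toMatrix b b A.toLinearMap (σ i) i := by
    ext A
    rw [ContinuousLinearMap.det, ← LinearMap.det_toMatrix b, Matrix.det_apply']
  rw [h]
  refine ContDiff.sum fun σ _ => contDiff_const.mul (contDiff_prod fun i _ => ?_)
  have : (fun A : E →L[ℝ] E => LinearMap.toMatrix b b A.toLinearMap (σ i) i) =
      fun A : E →L[ℝ] E => inner ℝ (stdOrthonormalBasis ℝ E (σ i)) (A (b i)) := by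
    ext A
    rw [LinearMap.toMatrix_apply]
    simp [b, OrthonormalBasis.repr_apply_apply]
  rw [this]
  exact contDiff_const.inner ℝ (contDiff_id.clm_apply contDiff_const)

/-- The linear term of `det (1 + r Z)` in `r` is the trace of `Z`. -/
theorem hasFDerivAt_det_one :
    HasFDerivAt (fun A : E →L[ℝ] E => A.det) (traceCLM E) (1 : E →L[ℝ] E) := by
  have hd : DifferentiableAt ℝ (fun A : E →L[ℝ] E => A.det) 1 :=
    (contDiff_det (n := 1)).differentiable (by simp) 1
  convert hd.hasFDerivAt using 1
  ext Z
  have h1 : HasDerivAt (fun r : ℝ => (1 + r • Z : E →L[ℝ] E)) Z 0 := by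
    simpa using ((hasDerivAt_id (0 : ℝ)).smul_const Z).const_add (1 : E →L[ℝ] E)
  have h2 : HasDerivAt (fun r : ℝ => (1 + r • Z : E →L[ℝ] E).det) (fderiv ℝ (fun A : E →L[ℝ] E => A.det) 1 Z) 0 := by
    have := HasFDerivAt.comp_hasDerivAt (0 : ℝ) (f := fun r : ℝ => (1 + r • Z : E →L[ℝ] E))
      (l := fun A : E →L[ℝ] E => A.det) (by simpa using hd.hasFDerivAt) h1
    exact this
  let b := (stdOrthonormalBasis ℝ E).toBasis
  let M := LinearMap.toMatrix b b Z.toLinearMap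
  have h3 : ∀ r : ℝ, (1 + r • Z : E →L[ℝ] E).det = Matrix.det (1 + r • M) := by
    intro r
    rw [ContinuousLinearMap.det, ← LinearMap.det_toMatrix b]
    congr 1
    have : ((1 + r • Z : E →L[ℝ] E) : E →ₗ[ℝ] E) = LinearMap.id + r • Z.toLinearMap := rfl
    rw [this, map_add, map_smul, LinearMap.toMatrix_id]
  set p := (Matrix.det (1 + (Polynomial.X : Polynomial ℝ) • M.map Polynomial.C)).divX.divX
  have h4 : HasDerivAt (fun r : ℝ => 1 + M.trace * r + p.eval r * r ^ 2) (M.trace) 0 := by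
    have := (((hasDerivAt_id (0 : ℝ)).const_mul M.trace).const_add 1).add
      ((p.hasDerivAt 0).mul ((hasDerivAt_id (0 : ℝ)).pow 2))
    simpa using! this
  have h5 : (fun r : ℝ => (1 + r • Z : E →L[ℝ] E).det) =
      fun r : ℝ => 1 + M.trace * r + p.eval r * r ^ 2 := by
    ext r
    rw [h3, Matrix.det_one_add_smul]
  rw [h5] at h2
  rw [← h4.unique h2, traceCLM_apply, LinearMap.trace_eq_matrix_trace ℝ b]

/-- Jacobi's formula at an invertible operator `A` with inverse `B`. -/
theorem hasFDerivAt_det {A B : E →L[ℝ] E} (hBA : B * A = 1) (hAB : A * B = 1) :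
    HasFDerivAt (fun A : E →L[ℝ] E => A.det)
      (A.det • (traceCLM E ∘L ContinuousLinearMap.compL ℝ E E E B)) A := by
  have h1 : HasFDerivAt (fun C : E →L[ℝ] E => B * C) (ContinuousLinearMap.compL ℝ E E E B) A :=
    (ContinuousLinearMap.compL ℝ E E E B).hasFDerivAt
  have h2 : HasFDerivAt (fun A : E →L[ℝ] E => A.det) (traceCLM E) (B * A) := by
    rw [hBA]; exact hasFDerivAt_det_one
  have h3 := (h2.comp A h1).const_mul A.det
  refine h3.congr_of_eventuallyEq (Eventually.of_forall fun C => ?_)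
  have : C = A * (B * C) := by rw [← mul_assoc, hAB, one_mul]
  change C.det = A.det * (B * C).det
  conv_lhs => rw [this]
  exact LinearMap.det_comp A.toLinearMap _

/-- The Moore–Penrose left inverse `(L† L)⁻¹ L†` of an injective operator `L`. As `Ring.inverse` is
`0` at elements that are not units, it is `0` when `L` is not injective. -/
def pinv (L : E →L[ℝ] F) : F →L[ℝ] E :=
  Ring.inverse (ContinuousLinearMap.adjoint L ∘L L) ∘L ContinuousLinearMap.adjoint L

theorem isUnit_adjoint_comp_self {L : E →L[ℝ] F} (hL : Function.Injective L) :
    IsUnit (ContinuousLinearMap.adjoint L ∘L L) := by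
  rw [ContinuousLinearMap.isUnit_iff_isUnit_toLinearMap, LinearMap.isUnit_iff_ker_eq_bot]
  have := L.ker_adjoint_comp_self
  exact this.trans (LinearMap.ker_eq_bot.2 hL)

theorem pinv_comp_self {L : E →L[ℝ] F} (hL : Function.Injective L) :
    pinv L ∘L L = ContinuousLinearMap.id ℝ E :=
  Ring.inverse_mul_cancel _ (isUnit_adjoint_comp_self hL)

theorem pinv_apply_self {L : E →L[ℝ] F} (hL : Function.Injective L) (v : E) :
    pinv L (L v) = v :=
  congrArg (fun A : E →L[ℝ] E => A v) (pinv_comp_self hL)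

theorem adjoint_comp_self_pinv {L : E →L[ℝ] F} (hL : Function.Injective L) (y : F) :
    ContinuousLinearMap.adjoint L (L (pinv L y)) = ContinuousLinearMap.adjoint L y := by
  have := Ring.mul_inverse_cancel _ (isUnit_adjoint_comp_self hL)
  exact congrArg (fun A : E →L[ℝ] E => A (ContinuousLinearMap.adjoint L y)) this

/-- `L (pinv L)` is the orthogonal projection to the range of `L`. -/
theorem self_pinv_apply {L : E →L[ℝ] F} (hL : Function.Injective L) (y : F) :
    L (pinv L y) = (LinearMap.range L.toLinearMap).starProjection y := by
  refine (Submodule.eq_starProjection_of_mem_of_inner_eq_zero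
    (LinearMap.mem_range_self L.toLinearMap _) ?_).symm
  rintro _ ⟨v, rfl⟩
  change inner ℝ (y - L (pinv L y)) (L v) = 0
  rw [← ContinuousLinearMap.adjoint_inner_left, map_sub, adjoint_comp_self_pinv hL, sub_self,
    inner_zero_left]

/-- The left inverse vanishes on the orthogonal complement of the range. -/
theorem pinv_eq_zero {L : E →L[ℝ] F} {ξ : F} (hξ : ∀ v, inner ℝ (L v) ξ = 0) :
    pinv L ξ = 0 := by
  have : ContinuousLinearMap.adjoint L ξ = 0 := by
    refine ext_inner_left ℝ fun v => ?_
    rw [ContinuousLinearMap.adjoint_inner_right, hξ, inner_zero_right]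
  simp [pinv, this]

theorem contDiffAt_pinv {n : WithTop ℕ∞} {L : E →L[ℝ] F} (hL : Function.Injective L) :
    ContDiffAt ℝ n (pinv : (E →L[ℝ] F) → (F →L[ℝ] E)) L := by
  obtain ⟨u, hu⟩ := isUnit_adjoint_comp_self hL
  have h1 : ContDiffAt ℝ n (fun L : E →L[ℝ] F => adjointCLM E F L) L :=
    (adjointCLM E F).contDiff.contDiffAt
  have h2 : ContDiffAt ℝ n (fun L : E →L[ℝ] F => (adjointCLM E F L) ∘L L) L :=
    h1.clm_comp contDiffAt_id
  have h3 : ContDiffAt ℝ n (Ring.inverse : (E →L[ℝ] E) → _) ((adjointCLM E F L) ∘L L) := by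
    rw [adjointCLM_apply, ← hu]
    exact contDiffAt_ringInverse ℝ u
  exact (ContDiffAt.comp (f := fun L : E →L[ℝ] F => (adjointCLM E F L) ∘L L) L h3 h2).clm_comp h1

theorem normDet_eq_sqrt (L : E →L[ℝ] F) :
    L.normDet = √((ContinuousLinearMap.adjoint L ∘L L).det) := by
  have := L.normDet_sq
  simp only [RCLike.ofReal_real_eq_id, id] at this
  rw [← this, Real.sqrt_sq (LinearMap.normDet_nonneg _)]

theorem normDet_pos {L : E →L[ℝ] F} (hL : Function.Injective L) : 0 < L.normDet := by
  refine lt_of_le_of_ne (LinearMap.normDet_nonneg _) (Ne.symm ?_)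
  exact (LinearMap.normDet_ne_zero_tfae L.toLinearMap).out 4 0 |>.1 hL

theorem continuous_normDet : Continuous fun L : E →L[ℝ] F => L.normDet := by
  simp_rw [normDet_eq_sqrt]
  refine Real.continuous_sqrt.comp (ContinuousLinearMap.continuous_det.comp ?_)
  exact (adjointCLM E F).continuous.clm_comp continuous_id

theorem contDiffAt_normDet {n : WithTop ℕ∞} {L : E →L[ℝ] F} (hL : Function.Injective L) :
    ContDiffAt ℝ n (fun L : E →L[ℝ] F => L.normDet) L := by
  have hpos := normDet_pos hL
  have h1 : ContDiffAt ℝ n (fun L : E →L[ℝ] F => ((adjointCLM E F L) ∘L L).det) L :=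
    contDiff_det.contDiffAt.comp L ((adjointCLM E F).contDiff.contDiffAt.clm_comp contDiffAt_id)
  have h2 := h1.sqrt (by
    intro h0
    rw [normDet_eq_sqrt] at hpos
    rw [adjointCLM_apply] at h0
    rw [h0] at hpos
    simp at hpos)
  exact h2.congr_of_eventuallyEq (Eventually.of_forall fun L => normDet_eq_sqrt L)

/-- Jacobi's formula for the Jacobian `√det (L† L)` of an injective operator. -/
theorem hasFDerivAt_normDet {L : E →L[ℝ] F} (hL : Function.Injective L) :
    HasFDerivAt (fun L : E →L[ℝ] F => L.normDet)
      (L.normDet • (traceCLM E ∘L ContinuousLinearMap.compL ℝ E F E (pinv L))) L := by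
  have hpos := normDet_pos hL
  set A := ContinuousLinearMap.adjoint L ∘L L with hA
  have hdet : A.det = L.normDet ^ 2 := by
    have := L.normDet_sq
    simpa using this.symm
  have hu := isUnit_adjoint_comp_self hL
  set B := Ring.inverse A with hB
  have hBA : B * A = 1 := Ring.inverse_mul_cancel _ hu
  have hAB : A * B = 1 := Ring.mul_inverse_cancel _ hu
  have h1 : HasFDerivAt (fun L : E →L[ℝ] F => (adjointCLM E F L) ∘L L)
      _ L := (adjointCLM E F).hasFDerivAt.clm_comp (hasFDerivAt_id L)
  have h2 := ((hasFDerivAt_det hBA hAB).comp L h1).sqrt (by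
    change A.det ≠ 0
    rw [hdet]; positivity)
  have h3 : (fun L : E →L[ℝ] F => L.normDet) =
      fun L : E →L[ℝ] F => √(((fun A : E →L[ℝ] E => A.det) ∘
        fun L : E →L[ℝ] F => (adjointCLM E F L) ∘L L) L) := by
    ext L
    rw [normDet_eq_sqrt]
    rfl
  rw [h3]
  refine h2.congr_fderiv (ContinuousLinearMap.ext fun Z => Eq.symm ?_)
  have e1 : √(((fun A : E →L[ℝ] E => A.det) ∘ fun L : E →L[ℝ] F => (adjointCLM E F L) ∘L L) L)
      = L.normDet := by
    rw [normDet_eq_sqrt]; rfl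
  have hBadj : ContinuousLinearMap.adjoint B = B := by
    have hAadj : ContinuousLinearMap.adjoint A = A := by
      rw [hA, ContinuousLinearMap.adjoint_comp, ContinuousLinearMap.adjoint_adjoint]
    have h5 : A * ContinuousLinearMap.adjoint B = 1 := by
      have := congrArg ContinuousLinearMap.adjoint hBA
      change ContinuousLinearMap.adjoint (B ∘L A) = ContinuousLinearMap.adjoint
        (ContinuousLinearMap.id ℝ E) at this
      rw [ContinuousLinearMap.adjoint_comp, hAadj, ContinuousLinearMap.adjoint_id] at this
      exact this
    calc ContinuousLinearMap.adjoint B = (B * A) * ContinuousLinearMap.adjoint B := by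
          rw [hBA, one_mul]
      _ = B := by rw [mul_assoc, h5, mul_one]
  have t1 : traceCLM E (B ∘L (ContinuousLinearMap.adjoint L ∘L Z)) =
      traceCLM E (pinv L ∘L Z) := rfl
  have t2 : traceCLM E (B ∘L (ContinuousLinearMap.adjoint Z ∘L L)) =
      traceCLM E (pinv L ∘L Z) := by
    rw [← traceCLM_adjoint, ContinuousLinearMap.adjoint_comp, ContinuousLinearMap.adjoint_comp,
      ContinuousLinearMap.adjoint_adjoint, hBadj, traceCLM_comp_comm]
    rfl
  have key : traceCLM E (B ∘L (ContinuousLinearMap.adjoint L ∘L Z +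
      ContinuousLinearMap.adjoint Z ∘L L)) = 2 * traceCLM E (pinv L ∘L Z) := by
    rw [ContinuousLinearMap.comp_add, map_add, t1, t2]; ring
  have e2 : (A.det • (traceCLM E ∘L ContinuousLinearMap.compL ℝ E E E B))
      (ContinuousLinearMap.adjoint L ∘L Z + ContinuousLinearMap.adjoint Z ∘L L)
      = L.normDet ^ 2 * (2 * traceCLM E (pinv L ∘L Z)) := by
    rw [← key, ← hdet]; rfl
  change L.normDet * traceCLM E (pinv L ∘L Z) = (1 / (2 * √(((fun A : E →L[ℝ] E => A.det) ∘
        fun L : E →L[ℝ] F => (adjointCLM E F L) ∘L L) L))) *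
    ((A.det • (traceCLM E ∘L ContinuousLinearMap.compL ℝ E E E B))
      (ContinuousLinearMap.adjoint L ∘L Z + ContinuousLinearMap.adjoint Z ∘L L))
  rw [e1, e2]
  field_simp

/-- The trace of a bilinear form over a subspace `T` does not depend on the orthonormal basis: it
is the sum over the projections to `T` of an orthonormal basis of the whole space. -/
theorem sum_orthonormalBasis_subspace {Y : Type*} [AddCommGroup Y] [Module ℝ Y]
    (T : Submodule ℝ F) {ι κ : Type*} [Fintype ι] [Fintype κ] (e : OrthonormalBasis ι ℝ T)
    (ε : OrthonormalBasis κ ℝ F) (β : F →ₗ[ℝ] F →ₗ[ℝ] Y) :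
    ∑ i, β (e i) (e i) = ∑ a, β (T.starProjection (ε a)) (T.starProjection (ε a)) := by
  have hP : ∀ y : F, T.starProjection y = ∑ i, inner ℝ (e i : F) y • (e i : F) := by
    intro y
    rw [Submodule.starProjection_apply, ← e.sum_repr (T.orthogonalProjectionOnto y)]
    simp [OrthonormalBasis.repr_apply_apply]
  simp_rw [hP]
  simp only [map_sum, map_smul, LinearMap.sum_apply, LinearMap.smul_apply]
  have h2 : ∀ i j, ∑ a, inner ℝ (e i : F) (ε a) * inner ℝ (e j : F) (ε a) =
      inner ℝ (e i : F) (e j : F) := by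
    intro i j
    rw [← ε.sum_inner_mul_inner (e i : F) (e j : F)]
    exact Finset.sum_congr rfl fun a _ => by rw [real_inner_comm (e j : F)]
  calc ∑ i, β (e i) (e i)
      = ∑ i, ∑ j, (inner ℝ (e i : F) (e j : F)) • β (e i) (e j) := by
        refine Finset.sum_congr rfl fun i _ => ?_
        rw [Finset.sum_eq_single i]
        · rw [← Submodule.coe_inner, e.inner_eq_one, one_smul]
        · intro j _ hj
          rw [← Submodule.coe_inner, e.inner_eq_zero (Ne.symm hj), zero_smul]
        · simp
    _ = ∑ i, ∑ j, ∑ a, (inner ℝ (e i : F) (ε a) * inner ℝ (e j : F) (ε a)) • β (e i) (e j) := by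
        simp_rw [← Finset.sum_smul, h2]
    _ = _ := by
        simp_rw [Finset.smul_sum, smul_smul]
        rw [Finset.sum_congr rfl fun i _ => Finset.sum_comm, Finset.sum_comm]
        refine Finset.sum_congr rfl fun a _ => ?_
        rw [Finset.sum_comm]
        refine Finset.sum_congr rfl fun j _ => Finset.sum_congr rfl fun i _ => ?_
        rw [mul_comm]

theorem sum_norm_sq_orthonormalBasis_subspace {Y : Type*} [NormedAddCommGroup Y]
    [InnerProductSpace ℝ Y] (T : Submodule ℝ F) {ι κ : Type*} [Fintype ι] [Fintype κ]
    (e : OrthonormalBasis ι ℝ T) (ε : OrthonormalBasis κ ℝ F) (ℓ : F →ₗ[ℝ] Y) :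
    ∑ i, ‖ℓ (e i)‖ ^ 2 = ∑ a, ‖ℓ (T.starProjection (ε a))‖ ^ 2 := by
  have := sum_orthonormalBasis_subspace T e ε ((innerₗ Y).compl₁₂ ℓ ℓ)
  simpa [LinearMap.compl₁₂_apply, innerₗ_apply_apply, real_inner_self_eq_norm_sq] using this

theorem sum_sq_orthonormalBasis_subspace (T : Submodule ℝ F) {ι κ : Type*} [Fintype ι] [Fintype κ]
    (e : OrthonormalBasis ι ℝ T) (ε : OrthonormalBasis κ ℝ F) (β : F →ₗ[ℝ] F →ₗ[ℝ] ℝ) :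
    ∑ i, ∑ j, (β (e i) (e j)) ^ 2 =
      ∑ a, ∑ c, (β (T.starProjection (ε a)) (T.starProjection (ε c))) ^ 2 := by
  have h1 : ∀ x, ∑ j, (β x (e j)) ^ 2 = ∑ c, (β x (T.starProjection (ε c))) ^ 2 := by
    intro x
    simpa using sum_norm_sq_orthonormalBasis_subspace T e ε (β x)
  simp_rw [h1]
  rw [Finset.sum_comm]
  have h2 : ∀ y, ∑ i, (β (e i) y) ^ 2 = ∑ a, (β (T.starProjection (ε a)) y) ^ 2 := by
    intro y
    simpa using sum_norm_sq_orthonormalBasis_subspace T e ε (β.flip y)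
  simp_rw [h2]
  rw [Finset.sum_comm]

end LinearAlgebra

/-! ### The area formula for immersions -/

section AreaFormula

open scoped NNReal ENNReal

/-- A comparison of the distances of `f` and `g` on `A` makes `f ∘ g⁻¹` a Lipschitz map from `g '' A`
to `f '' A`. -/
theorem euclideanHausdorffMeasure_image_le {α X Y : Type*} [EMetricSpace X] [MeasurableSpace X]
    [BorelSpace X] [EMetricSpace Y] [MeasurableSpace Y] [BorelSpace Y] (d : ℕ)
    {f : α → X} {g : α → Y} {A : Set α} {K : ℝ≥0}
    (h : ∀ u ∈ A, ∀ v ∈ A, edist (f u) (f v) ≤ K * edist (g u) (g v)) :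
    μHE[d] (f '' A) ≤ (K : ℝ≥0∞) ^ d * μHE[d] (g '' A) := by
  rcases A.eq_empty_or_nonempty with rfl | ⟨u₀, hu₀⟩
  · simp
  have : Nonempty α := ⟨u₀⟩
  let φ : Y → X := f ∘ Function.invFunOn g A
  have hinv : ∀ u ∈ A, Function.invFunOn g A (g u) ∈ A ∧ g (Function.invFunOn g A (g u)) = g u :=
    fun u hu => ⟨Function.invFunOn_mem ⟨u, hu, rfl⟩, Function.invFunOn_eq ⟨u, hu, rfl⟩⟩
  have hφ : LipschitzOnWith K φ (g '' A) := by
    rintro _ ⟨u, hu, rfl⟩ _ ⟨v, hv, rfl⟩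
    have := h _ (hinv u hu).1 _ (hinv v hv).1
    rwa [(hinv u hu).2, (hinv v hv).2] at this
  have himg : φ '' (g '' A) = f '' A := by
    rw [image_image]
    refine image_congr fun u hu => ?_
    have := h _ (hinv u hu).1 _ hu
    rw [(hinv u hu).2, edist_self, mul_zero, nonpos_iff_eq_zero, edist_eq_zero] at this
    exact this
  have := hφ.hausdorffMeasure_image_le (d := d) (Nat.cast_nonneg d)
  rw [himg, ENNReal.rpow_natCast] at this
  simp only [Measure.euclideanHausdorffMeasure_def, Measure.smul_apply]
  rw [ENNReal.smul_def, ENNReal.smul_def, smul_eq_mul, smul_eq_mul, mul_left_comm]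
  gcongr

variable {E F : Type*} [NormedAddCommGroup E] [InnerProductSpace ℝ E] [FiniteDimensional ℝ E]
  [NormedAddCommGroup F] [InnerProductSpace ℝ F] [FiniteDimensional ℝ F]

/-- Near a point, an immersion distorts the lengths measured by its derivative by a factor close
to one. -/
theorem HasStrictFDerivAt.eventually_edist_comparable {G : E → F} {L : E →L[ℝ] F} {u₀ : E}
    (hG : HasStrictFDerivAt G L u₀) (hL : Function.Injective L) {c : ℝ≥0} (hc : 1 < c) :
    ∀ᶠ p : E × E in 𝓝 (u₀, u₀), edist (G p.1) (G p.2) ≤ c * edist (L p.1) (L p.2) ∧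
      edist (L p.1) (L p.2) ≤ c * edist (G p.1) (G p.2) := by
  obtain ⟨K, hK, hLK⟩ := (LinearMap.injective_iff_antilipschitz L.toLinearMap).1 hL
  have hc' : (1 : ℝ) < c := by exact_mod_cast hc
  have hK' : (0 : ℝ) < K := hK
  set η : ℝ := (c - 1) / c with hη
  have hηpos : 0 < η := div_pos (by linarith) (by linarith)
  have hbd := hG.isLittleO.def (c := η / K) (by positivity)
  filter_upwards [hbd] with p hp
  have h1 : ‖p.1 - p.2‖ ≤ K * ‖L (p.1 - p.2)‖ := by
    have := hLK.le_mul_dist p.1 p.2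
    rw [dist_eq_norm, dist_eq_norm] at this
    rw [map_sub]; exact this
  have h2 : ‖G p.1 - G p.2 - L (p.1 - p.2)‖ ≤ η * ‖L (p.1 - p.2)‖ := by
    refine hp.trans ?_
    calc η / K * ‖p.1 - p.2‖ ≤ η / K * (K * ‖L (p.1 - p.2)‖) := by gcongr
      _ = η * ‖L (p.1 - p.2)‖ := by field_simp
  have hη1 : 1 + η ≤ c := by
    have : η ≤ c - 1 := by
      rw [hη, div_le_iff₀ (by linarith)]; nlinarith
    linarith
  have hη2 : c * (1 - η) = 1 := by rw [hη]; field_simp; ring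
  have h3 : ‖G p.1 - G p.2‖ ≤ c * ‖L p.1 - L p.2‖ := by
    rw [← map_sub]
    have := norm_le_norm_add_norm_sub' (G p.1 - G p.2) (L (p.1 - p.2))
    nlinarith [norm_nonneg (L (p.1 - p.2))]
  have h4 : ‖L p.1 - L p.2‖ ≤ c * ‖G p.1 - G p.2‖ := by
    rw [← map_sub]
    have := norm_le_norm_add_norm_sub' (L (p.1 - p.2)) (G p.1 - G p.2)
    rw [norm_sub_rev (L (p.1 - p.2))] at this
    have h5 : (1 - η) * ‖L (p.1 - p.2)‖ ≤ ‖G p.1 - G p.2‖ := by nlinarith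
    calc ‖L (p.1 - p.2)‖ = c * ((1 - η) * ‖L (p.1 - p.2)‖) := by rw [← mul_assoc, hη2, one_mul]
      _ ≤ _ := by gcongr
  rw [edist_eq_enorm_sub, edist_eq_enorm_sub]
  constructor
  · rw [← enorm_norm, ← enorm_norm (L p.1 - L p.2), Real.enorm_of_nonneg (norm_nonneg _),
      Real.enorm_of_nonneg (norm_nonneg _), ← ENNReal.ofReal_coe_nnreal,
      ← ENNReal.ofReal_mul (by positivity)]
    exact ENNReal.ofReal_le_ofReal h3
  · rw [← enorm_norm, ← enorm_norm (G p.1 - G p.2), Real.enorm_of_nonneg (norm_nonneg _),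
      Real.enorm_of_nonneg (norm_nonneg _), ← ENNReal.ofReal_coe_nnreal,
      ← ENNReal.ofReal_mul (by positivity)]
    exact ENNReal.ofReal_le_ofReal h4

variable [MeasurableSpace E] [BorelSpace E] [MeasurableSpace F] [BorelSpace F]

/-- A `C¹` injective immersion of an open set. -/
structure IsImmersionOn (G : E → F) (W : Set E) : Prop where
  isOpen : IsOpen W
  contDiffOn : ContDiffOn ℝ 1 G W
  injOn : InjOn G W
  injective : ∀ u ∈ W, Function.Injective (fderiv ℝ G u)

variable {G : E → F} {W : Set E}

theorem IsImmersionOn.continuousOn_fderiv (hG : IsImmersionOn G W) :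
    ContinuousOn (fderiv ℝ G) W :=
  hG.contDiffOn.continuousOn_fderiv_of_isOpen hG.isOpen le_rfl

theorem IsImmersionOn.continuousOn_normDet (hG : IsImmersionOn G W) :
    ContinuousOn (fun u => (fderiv ℝ G u).normDet) W :=
  continuous_normDet.comp_continuousOn hG.continuousOn_fderiv

theorem IsImmersionOn.measurableSet_image (hG : IsImmersionOn G W) {A : Set E}
    (hA : MeasurableSet A) (hAW : A ⊆ W) : MeasurableSet (G '' A) :=
  hA.image_of_continuousOn_injOn (hG.contDiffOn.continuousOn.mono hAW) (hG.injOn.mono hAW)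

/-- Near a point the area formula holds up to a factor close to one: `G` is compared with its
derivative `L` at the point, for which the area formula is the linear one. -/
theorem IsImmersionOn.eventually_measure_comparable (hG : IsImmersionOn G W) {u₀ : E} (hu₀ : u₀ ∈ W)
    {c : ℝ≥0} (hc : 1 < c) :
    ∃ N ∈ 𝓝 u₀, IsOpen N ∧ ∀ A ⊆ N, MeasurableSet A →
      μHE[Module.finrank ℝ E] (G '' A) ≤ (c : ℝ≥0∞) ^ (Module.finrank ℝ E + 1) *
          ∫⁻ u in A, ENNReal.ofReal (fderiv ℝ G u).normDet ∧
      ∫⁻ u in A, ENNReal.ofReal (fderiv ℝ G u).normDet ≤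
        (c : ℝ≥0∞) ^ (Module.finrank ℝ E + 1) * μHE[Module.finrank ℝ E] (G '' A) := by
  set d := Module.finrank ℝ E
  set L := fderiv ℝ G u₀ with hL
  have hstrict : HasStrictFDerivAt G L u₀ :=
    (hG.contDiffOn.contDiffAt (hG.isOpen.mem_nhds hu₀)).hasStrictFDerivAt (by simp)
  have hLinj := hG.injective u₀ hu₀
  have h1 := hstrict.eventually_edist_comparable hLinj hc
  rw [nhds_prod_eq] at h1
  obtain ⟨N₁, hN₁, hN₁'⟩ := eventually_prod_self_iff
    (r := fun x y => edist (G x) (G y) ≤ c * edist (L x) (L y) ∧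
      edist (L x) (L y) ≤ c * edist (G x) (G y)) |>.1 h1
  have hJ : ContinuousAt (fun u => (fderiv ℝ G u).normDet) u₀ :=
    hG.continuousOn_normDet.continuousAt (hG.isOpen.mem_nhds hu₀)
  have hpos := normDet_pos hLinj
  have hc' : (1 : ℝ) < c := by exact_mod_cast hc
  have h2 : ∀ᶠ u in 𝓝 u₀, (fderiv ℝ G u).normDet < c * L.normDet :=
    hJ.eventually_lt continuousAt_const (by rw [← hL]; nlinarith)
  have h3 : ∀ᶠ u in 𝓝 u₀, L.normDet < c * (fderiv ℝ G u).normDet :=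
    continuousAt_const.eventually_lt (hJ.const_mul _) (by rw [← hL]; nlinarith)
  obtain ⟨N, hNsub, hNo, hN⟩ := mem_nhds_iff.1 (inter_mem hN₁ (h2.and h3))
  refine ⟨N, hNo.mem_nhds hN, hNo, fun A hAN hA => ?_⟩
  have hLA : μHE[d] (L '' A) = ENNReal.ofReal L.normDet * volume A :=
    L.toLinearMap.euclideanHausdorffMeasure_image_eq_normDet_mul_volume A
  have hconst : ∫⁻ u in A, ENNReal.ofReal L.normDet = ENNReal.ofReal L.normDet * volume A := by
    simp
  have hcpow : ∀ x : ℝ≥0∞, (c : ℝ≥0∞) ^ (d + 1) * x = (c : ℝ≥0∞) ^ d * (c * x) := by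
    intro x; ring
  have i1 : ∫⁻ u in A, ENNReal.ofReal L.normDet ≤
      c * ∫⁻ u in A, ENNReal.ofReal (fderiv ℝ G u).normDet := by
    rw [← lintegral_const_mul' _ _ ENNReal.coe_ne_top]
    refine setLIntegral_mono' hA fun u hu => ?_
    rw [← ENNReal.ofReal_coe_nnreal, ← ENNReal.ofReal_mul (by positivity)]
    exact ENNReal.ofReal_le_ofReal (hNsub (hAN hu)).2.2.le
  have i2 : ∫⁻ u in A, ENNReal.ofReal (fderiv ℝ G u).normDet ≤
      c * ∫⁻ u in A, ENNReal.ofReal L.normDet := by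
    rw [← lintegral_const_mul' _ _ ENNReal.coe_ne_top]
    refine setLIntegral_mono' hA fun u hu => ?_
    rw [← ENNReal.ofReal_coe_nnreal, ← ENNReal.ofReal_mul (by positivity)]
    exact ENNReal.ofReal_le_ofReal (hNsub (hAN hu)).2.1.le
  rw [hconst, ← hLA] at i1 i2
  have m1 : μHE[d] (G '' A) ≤ (c : ℝ≥0∞) ^ d * μHE[d] (L '' A) :=
    euclideanHausdorffMeasure_image_le d fun u hu v hv =>
      (hN₁' u (hNsub (hAN hu)).1 v (hNsub (hAN hv)).1).1
  have m2 : μHE[d] (L '' A) ≤ (c : ℝ≥0∞) ^ d * μHE[d] (G '' A) :=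
    euclideanHausdorffMeasure_image_le d fun u hu v hv =>
      (hN₁' u (hNsub (hAN hu)).1 v (hNsub (hAN hv)).1).2
  constructor
  · rw [hcpow]
    exact m1.trans (by gcongr)
  · rw [hcpow, mul_left_comm]
    exact i2.trans (by gcongr)

/-- The area formula for the measure of an image: a countable cover by sets on which it holds up to
a factor `c ^ (d + 1)` is made disjoint, and `c` tends to `1`. -/
theorem IsImmersionOn.measure_image (hG : IsImmersionOn G W) {A : Set E} (hA : MeasurableSet A)
    (hAW : A ⊆ W) :
    μHE[Module.finrank ℝ E] (G '' A) = ∫⁻ u in A, ENNReal.ofReal (fderiv ℝ G u).normDet := by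
  set d := Module.finrank ℝ E
  rcases A.eq_empty_or_nonempty with rfl | hne
  · simp
  have key : ∀ c : ℝ≥0, 1 < c →
      μHE[d] (G '' A) ≤ (c : ℝ≥0∞) ^ (d + 1) *
          ∫⁻ u in A, ENNReal.ofReal (fderiv ℝ G u).normDet ∧
      ∫⁻ u in A, ENNReal.ofReal (fderiv ℝ G u).normDet ≤
        (c : ℝ≥0∞) ^ (d + 1) * μHE[d] (G '' A) := by
    intro c hc
    choose! N hN hNo hNc using fun u (hu : u ∈ A) =>
      hG.eventually_measure_comparable (hAW hu) hc
    obtain ⟨t, htA, htc, ht⟩ := TopologicalSpace.countable_cover_nhdsWithin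
      (s := A) (f := N) fun u hu => mem_nhdsWithin_of_mem_nhds (hN u hu)
    have htne : t.Nonempty := by
      obtain ⟨u, hu⟩ := hne
      obtain ⟨v, hv, -⟩ := mem_iUnion₂.1 (ht hu)
      exact ⟨v, hv⟩
    obtain ⟨s, rfl⟩ := htc.exists_eq_range htne
    let B : ℕ → Set E := fun i => A ∩ disjointed (fun i => N (s i)) i
    have hsA : ∀ i, s i ∈ A := fun i => htA (mem_range_self i)
    have hBm : ∀ i, MeasurableSet (B i) := fun i =>
      hA.inter (MeasurableSet.disjointed (fun i => (hNo _ (hsA i)).measurableSet) i)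
    have hBd : Pairwise (Function.onFun Disjoint B) := fun i j hij =>
      (disjoint_disjointed _ hij).mono inter_subset_right inter_subset_right
    have hBU : ⋃ i, B i = A := by
      rw [← inter_iUnion, iUnion_disjointed, inter_eq_left]
      refine ht.trans ?_
      rw [biUnion_range]
    have hBA : ∀ i, B i ⊆ A := fun i => inter_subset_left
    have hBN : ∀ i, B i ⊆ N (s i) := fun i => inter_subset_right.trans (disjointed_subset _ i)
    have e1 : μHE[d] (G '' A) = ∑' i, μHE[d] (G '' B i) := by
      rw [← hBU, image_iUnion, measure_iUnion]
      · intro i j hij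
        rw [Function.onFun, disjoint_iff_inter_eq_empty,
          ← (hG.injOn.mono hAW).image_inter (hBA i) (hBA j), (hBd hij).inter_eq, image_empty]
      · exact fun i => hG.measurableSet_image (hBm i) ((hBA i).trans hAW)
    have e2 : ∫⁻ u in A, ENNReal.ofReal (fderiv ℝ G u).normDet =
        ∑' i, ∫⁻ u in B i, ENNReal.ofReal (fderiv ℝ G u).normDet := by
      rw [← lintegral_iUnion hBm hBd, hBU]
    rw [e1, e2, ← ENNReal.tsum_mul_left, ← ENNReal.tsum_mul_left]
    exact ⟨ENNReal.tsum_le_tsum fun i => (hNc _ (hsA i) _ (hBN i) (hBm i)).1,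
      ENNReal.tsum_le_tsum fun i => (hNc _ (hsA i) _ (hBN i) (hBm i)).2⟩
  have lim : ∀ I : ℝ≥0∞, Tendsto (fun c : ℝ≥0 => (c : ℝ≥0∞) ^ (d + 1) * I) (𝓝[>] 1) (𝓝 I) := by
    intro I
    have h1 : Tendsto (fun c : ℝ≥0 => (c : ℝ≥0∞) ^ (d + 1)) (𝓝[>] 1) (𝓝 1) := by
      have : Tendsto (fun c : ℝ≥0 => (c : ℝ≥0∞) ^ (d + 1)) (𝓝 1) (𝓝 (((1 : ℝ≥0) : ℝ≥0∞) ^ (d + 1))) :=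
        ((ENNReal.continuous_pow (d + 1)).comp ENNReal.continuous_coe).tendsto 1
      simpa using this.mono_left nhdsWithin_le_nhds
    simpa using ENNReal.Tendsto.mul_const h1 (Or.inl one_ne_zero)
  have hev : ∀ᶠ c : ℝ≥0 in 𝓝[>] 1, 1 < c := self_mem_nhdsWithin
  exact le_antisymm (ge_of_tendsto (lim _) (hev.mono fun c hc => (key c hc).1))
    (ge_of_tendsto (lim _) (hev.mono fun c hc => (key c hc).2))

theorem IsImmersionOn.measurableEmbedding (hG : IsImmersionOn G W) {A : Set E}
    (hA : MeasurableSet A) (hAW : A ⊆ W) : MeasurableEmbedding (A.domRestrict G) :=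
  (hG.contDiffOn.continuousOn.mono hAW).measurableEmbedding hA (hG.injOn.mono hAW)

theorem IsImmersionOn.map_restrict_withDensity (hG : IsImmersionOn G W) {A : Set E}
    (hA : MeasurableSet A) (hAW : A ⊆ W) :
    Measure.map (A.domRestrict G) (Measure.comap (Subtype.val : A → E)
      (volume.withDensity fun u => ENNReal.ofReal (fderiv ℝ G u).normDet)) =
      μHE[Module.finrank ℝ E].restrict (G '' A) := by
  have hemb := hG.measurableEmbedding hA hAW
  ext T hT
  have himg : (Subtype.val '' ((A.domRestrict G) ⁻¹' T) : Set E) = A ∩ G ⁻¹' T := by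
    ext u; simp [and_comm]
  have hmeas : MeasurableSet (A ∩ G ⁻¹' T) := by
    rw [← himg]
    exact (MeasurableEmbedding.subtype_coe hA).measurableSet_image.2 (hemb.measurable hT)
  rw [hemb.map_apply, comap_subtype_coe_apply hA, himg, withDensity_apply _ hmeas,
    Measure.restrict_apply hT, ← hG.measure_image hmeas (inter_subset_left.trans hAW),
    inter_comm A, image_preimage_inter]

theorem IsImmersionOn.aemeasurable_toNNReal_normDet (hG : IsImmersionOn G W) {A : Set E}
    (hA : MeasurableSet A) (hAW : A ⊆ W) :
    AEMeasurable (fun u => (fderiv ℝ G u).normDet.toNNReal) (volume.restrict A) :=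
  ((hG.continuousOn_normDet.mono hAW).aemeasurable hA).real_toNNReal

theorem IsImmersionOn.integrableOn_image_iff (hG : IsImmersionOn G W) {A : Set E}
    (hA : MeasurableSet A) (hAW : A ⊆ W) (g : F → ℝ) :
    IntegrableOn g (G '' A) μHE[Module.finrank ℝ E] ↔
      IntegrableOn (fun u => (fderiv ℝ G u).normDet * g (G u)) A := by
  rw [IntegrableOn, ← hG.map_restrict_withDensity hA hAW,
    (hG.measurableEmbedding hA hAW).integrable_map_iff]
  simp only [Set.domRestrict_eq, ← Function.comp_assoc, ENNReal.ofReal]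
  rw [← (MeasurableEmbedding.subtype_coe hA).integrable_map_iff, map_comap_subtype_coe hA,
    restrict_withDensity hA, integrable_withDensity_iff_integrable_coe_smul₀]
  · simp_rw [IntegrableOn, Real.coe_toNNReal _ (LinearMap.normDet_nonneg _), Function.comp_apply,
      smul_eq_mul]
  · exact hG.aemeasurable_toNNReal_normDet hA hAW

/-- The area formula for an injective immersion. -/
theorem IsImmersionOn.integral_image (hG : IsImmersionOn G W) {A : Set E}
    (hA : MeasurableSet A) (hAW : A ⊆ W) (g : F → ℝ) :
    ∫ x in G '' A, g x ∂μHE[Module.finrank ℝ E] =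
      ∫ u in A, (fderiv ℝ G u).normDet * g (G u) := by
  rw [← hG.map_restrict_withDensity hA hAW, (hG.measurableEmbedding hA hAW).integral_map]
  simp only [Set.domRestrict_apply, ← Function.comp_apply (f := g), ENNReal.ofReal]
  rw [← (MeasurableEmbedding.subtype_coe hA).integral_map, map_comap_subtype_coe hA,
    setIntegral_withDensity_eq_setIntegral_smul₀ (hG.aemeasurable_toNNReal_normDet hA hAW) _ hA]
  congr with x
  rw [NNReal.smul_def, Real.coe_toNNReal _ (LinearMap.normDet_nonneg _), smul_eq_mul,
    Function.comp_apply]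

end AreaFormula

/-! ### Local parametrizations of a submanifold -/

section Charts

variable {n d : ℕ}

/-- `F : W → M ∩ V` is a regular `C²` parametrization of an open piece of `M`, as in the
definition of a `C²` submanifold. -/
structure IsLocalParam (M V : Set (EuclideanSpace ℝ (Fin n))) (W : Set (EuclideanSpace ℝ (Fin d)))
    (F : EuclideanSpace ℝ (Fin d) → EuclideanSpace ℝ (Fin n)) : Prop where
  isOpen_target : IsOpen V
  isOpen_source : IsOpen W
  contDiffOn : ContDiffOn ℝ 2 F W
  injective : ∀ u ∈ W, Function.Injective (fderiv ℝ F u)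
  isEmbedding : IsEmbedding (W.domRestrict F)
  image_eq : F '' W = M ∩ V

theorem IsC2Submanifold.exists_isLocalParam {M : Set (EuclideanSpace ℝ (Fin n))}
    (hM : IsC2Submanifold d M) {p : EuclideanSpace ℝ (Fin n)} (hp : p ∈ M) :
    ∃ (V : Set (EuclideanSpace ℝ (Fin n))) (W : Set (EuclideanSpace ℝ (Fin d)))
      (F : EuclideanSpace ℝ (Fin d) → EuclideanSpace ℝ (Fin n)),
      p ∈ V ∧ IsLocalParam M V W F := by
  obtain ⟨V, W, F, h1, h2, h3, h4, h5, h6, h7⟩ := hM p hp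
  exact ⟨V, W, F, h2, h1, h3, h4, h5, h6, h7⟩

namespace IsLocalParam

variable {M V : Set (EuclideanSpace ℝ (Fin n))} {W : Set (EuclideanSpace ℝ (Fin d))}
  {F : EuclideanSpace ℝ (Fin d) → EuclideanSpace ℝ (Fin n)} {u : EuclideanSpace ℝ (Fin d)}

theorem mem (hF : IsLocalParam M V W F) (hu : u ∈ W) : F u ∈ M :=
  (hF.image_eq.subset (mem_image_of_mem F hu)).1

theorem mem_target (hF : IsLocalParam M V W F) (hu : u ∈ W) : F u ∈ V :=
  (hF.image_eq.subset (mem_image_of_mem F hu)).2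

theorem mapsTo (hF : IsLocalParam M V W F) : MapsTo F W M := fun _ => hF.mem

theorem exists_eq (hF : IsLocalParam M V W F) {x : EuclideanSpace ℝ (Fin n)} (hx : x ∈ M)
    (hxV : x ∈ V) : ∃ u ∈ W, F u = x :=
  hF.image_eq.superset ⟨hx, hxV⟩

theorem injOn (hF : IsLocalParam M V W F) : InjOn F W :=
  injOn_iff_injective.2 hF.isEmbedding.injective

theorem isImmersionOn (hF : IsLocalParam M V W F) : IsImmersionOn F W where
  isOpen := hF.isOpen_source
  contDiffOn := hF.contDiffOn.of_le (by norm_num)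
  injOn := hF.injOn
  injective := hF.injective

theorem contDiffAt (hF : IsLocalParam M V W F) (hu : u ∈ W) : ContDiffAt ℝ 2 F u :=
  hF.contDiffOn.contDiffAt (hF.isOpen_source.mem_nhds hu)

theorem hasFDerivAt (hF : IsLocalParam M V W F) (hu : u ∈ W) :
    HasFDerivAt F (fderiv ℝ F u) u :=
  ((hF.contDiffAt hu).differentiableAt (by simp)).hasFDerivAt

theorem contDiffOn_fderiv (hF : IsLocalParam M V W F) : ContDiffOn ℝ 1 (fderiv ℝ F) W :=
  hF.contDiffOn.fderiv_of_isOpen hF.isOpen_source (by norm_num)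

theorem contDiffAt_fderiv (hF : IsLocalParam M V W F) (hu : u ∈ W) :
    ContDiffAt ℝ 1 (fderiv ℝ F) u :=
  hF.contDiffOn_fderiv.contDiffAt (hF.isOpen_source.mem_nhds hu)

theorem contDiffOn_pinv (hF : IsLocalParam M V W F) :
    ContDiffOn ℝ 1 (fun u => pinv (fderiv ℝ F u)) W := fun _ hu =>
  ((contDiffAt_pinv (hF.injective _ hu)).comp _ (hF.contDiffAt_fderiv hu)).contDiffWithinAt

theorem contDiffAt_pinv_fderiv (hF : IsLocalParam M V W F) (hu : u ∈ W) :
    ContDiffAt ℝ 1 (fun u => pinv (fderiv ℝ F u)) u :=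
  hF.contDiffOn_pinv.contDiffAt (hF.isOpen_source.mem_nhds hu)

/-- As `F` is a homeomorphism to the relatively open piece `M ∩ V`, it takes neighbourhoods in the
parameter domain to neighbourhoods in `M`. -/
theorem map_nhds (hF : IsLocalParam M V W F) (hu : u ∈ W) :
    map F (𝓝 u) = 𝓝[M] (F u) := by
  have h1 : 𝓝[M] (F u) = 𝓝[M ∩ V] (F u) :=
    (nhdsWithin_inter_of_mem' (mem_nhdsWithin_of_mem_nhds
      (hF.isOpen_target.mem_nhds (hF.mem_target hu)))).symm
  rw [h1, ← hF.image_eq, ← range_domRestrict]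
  have := hF.isEmbedding.isInducing.map_nhds_eq ⟨u, hu⟩
  rw [domRestrict_apply] at this
  rw [← this]
  have h2 : W.domRestrict F = F ∘ Subtype.val := rfl
  rw [h2, ← Filter.map_map, map_nhds_subtype_coe_eq_nhds hu (hF.isOpen_source.mem_nhds hu)]

theorem fderiv_fderiv_comm (hF : IsLocalParam M V W F) (hu : u ∈ W) (a b : EuclideanSpace ℝ (Fin d)) :
    fderiv ℝ (fderiv ℝ F) u a b = fderiv ℝ (fderiv ℝ F) u b a :=
  (hF.contDiffAt hu).isSymmSndFDerivAt (by simp) a b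

/-- A parametrization has locally a `C²` left inverse that is defined on an open set of the ambient
space: the local inverse of `pinv (DF u) ∘ F`, composed with `pinv (DF u)`. -/
theorem exists_leftInverse (hF : IsLocalParam M V W F) (hu : u ∈ W) :
    ∃ π : EuclideanSpace ℝ (Fin n) → EuclideanSpace ℝ (Fin d),
      ContDiffAt ℝ 2 π (F u) ∧ (∀ᶠ v in 𝓝 u, π (F v) = v) ∧ ∀ᶠ y in 𝓝[M] (F u), F (π y) = y := by
  set L := fderiv ℝ F u with hL
  have hLinj := hF.injective u hu
  let H : EuclideanSpace ℝ (Fin d) → EuclideanSpace ℝ (Fin d) := fun v => pinv L (F v)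
  have hH : ContDiffAt ℝ 2 H u := (pinv L).contDiff.contDiffAt.comp u (hF.contDiffAt hu)
  have hH' : HasFDerivAt H
      ((ContinuousLinearEquiv.refl ℝ (EuclideanSpace ℝ (Fin d)) :
        EuclideanSpace ℝ (Fin d) →L[ℝ] EuclideanSpace ℝ (Fin d))) u := by
    have := (pinv L).hasFDerivAt.comp u (hF.hasFDerivAt hu)
    rw [← hL, pinv_comp_self hLinj] at this
    exact this
  have hs := hH.hasStrictFDerivAt' hH' (by simp)
  have hinv : ∀ᶠ v in 𝓝 u, hH.localInverse hH' (by simp) (H v) = v := hs.eventually_left_inverse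
  have hsm := hH.to_localInverse hH' (by simp)
  refine ⟨fun y => hH.localInverse hH' (by simp) (pinv L y), ?_, hinv, ?_⟩
  · exact hsm.comp (F u) (pinv L).contDiff.contDiffAt
  · rw [← hF.map_nhds hu, eventually_map]
    exact hinv.mono fun v hv => congrArg F hv

/-- Regularity along `M` can be checked in a parametrization. -/
theorem contDiffWithinAt_of_comp (hF : IsLocalParam M V W F) (hu : u ∈ W) {Z : Type*}
    [NormedAddCommGroup Z] [NormedSpace ℝ Z] {Y : EuclideanSpace ℝ (Fin n) → Z} {k : WithTop ℕ∞}
    (hk : k ≤ 2) (hY : ContDiffAt ℝ k (fun v => Y (F v)) u) : ContDiffWithinAt ℝ k Y M (F u) := by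
  obtain ⟨π, hπ, h1, h2⟩ := hF.exists_leftInverse hu
  have h3 : ContDiffAt ℝ k (fun y => Y (F (π y))) (F u) := by
    refine ContDiffAt.comp (F u) (g := fun v => Y (F v)) ?_ (hπ.of_le hk)
    rwa [h1.self_of_nhds]
  refine h3.contDiffWithinAt.congr_of_eventuallyEq (h2.mono fun y hy => (congrArg Y hy).symm) ?_
  rw [h1.self_of_nhds]

theorem contDiffOn_comp (hF : IsLocalParam M V W F) {Z : Type*}
    [NormedAddCommGroup Z] [NormedSpace ℝ Z] {Y : EuclideanSpace ℝ (Fin n) → Z} {k : WithTop ℕ∞}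
    (hk : k ≤ 2) (hY : ContDiffOn ℝ k Y M) : ContDiffOn ℝ k (fun v => Y (F v)) W :=
  hY.comp (hF.contDiffOn.of_le hk) hF.mapsTo

theorem continuousWithinAt_of_comp (hF : IsLocalParam M V W F) (hu : u ∈ W) {Z : Type*}
    [TopologicalSpace Z] {Y : EuclideanSpace ℝ (Fin n) → Z}
    (hY : ContinuousAt (fun v => Y (F v)) u) : ContinuousWithinAt Y M (F u) := by
  rw [ContinuousWithinAt, ← hF.map_nhds hu, tendsto_map'_iff]
  exact hY

/-- The directional derivative along `M`, computed in a parametrization. -/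
theorem derivAlong_eq (hF : IsLocalParam M V W F) (hu : u ∈ W)
    {Y : EuclideanSpace ℝ (Fin n) → EuclideanSpace ℝ (Fin n)}
    (hY : ContDiffAt ℝ 1 (fun v => Y (F v)) u) (a : EuclideanSpace ℝ (Fin d)) :
    derivAlong M Y (F u) (fderiv ℝ F u a) = fderiv ℝ (fun v => Y (F v)) u a := by
  have h1 : DifferentiableWithinAt ℝ Y M (F u) :=
    (hF.contDiffWithinAt_of_comp hu (by norm_num) hY).differentiableWithinAt (by simp)
  have h2 : HasFDerivWithinAt (fun v => Y (F v)) (fderivWithin ℝ Y M (F u) ∘L fderiv ℝ F u) W u :=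
    h1.hasFDerivWithinAt.comp u (hF.hasFDerivAt hu).hasFDerivWithinAt hF.mapsTo
  have h3 := h2.hasFDerivAt (hF.isOpen_source.mem_nhds hu)
  rw [h3.fderiv]
  rfl

theorem tangentSubspace_eq (hF : IsLocalParam M V W F) (hu : u ∈ W) :
    tangentSubspace M (F u) = LinearMap.range (fderiv ℝ F u).toLinearMap := by
  apply le_antisymm
  · refine Submodule.span_le.2 fun v hv => ?_
    obtain ⟨π, hπ, h1, h2⟩ := hF.exists_leftInverse hu
    have hFπ : HasFDerivAt (fun y => F (π y)) (fderiv ℝ F u ∘L fderiv ℝ π (F u)) (F u) := by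
      refine HasFDerivAt.comp (F u) (g := F) ?_ (hπ.differentiableAt (by simp)).hasFDerivAt
      rw [h1.self_of_nhds]
      exact hF.hasFDerivAt hu
    have h3 : HasFDerivWithinAt (fun y => y) (fderiv ℝ F u ∘L fderiv ℝ π (F u)) M (F u) :=
      hFπ.hasFDerivWithinAt.congr_of_eventuallyEq (h2.mono fun y hy => hy.symm)
        (by rw [h1.self_of_nhds])
    have h4 := h3.unique_on (hasFDerivWithinAt_id (F u) M) hv
    exact ⟨fderiv ℝ π (F u) v, h4⟩
  · rintro _ ⟨a, rfl⟩
    refine Submodule.subset_span ?_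
    have := (hF.hasFDerivAt hu).hasFDerivWithinAt (s := W) |>.mapsTo_tangent_cone
    have h2 := this (x := a) (by
      rw [tangentConeAt_of_mem_nhds (hF.isOpen_source.mem_nhds hu)]; trivial)
    exact tangentConeAt_mono (image_subset_iff.2 hF.mapsTo) h2

theorem mem_tangentSubspace (hF : IsLocalParam M V W F) (hu : u ∈ W)
    (a : EuclideanSpace ℝ (Fin d)) : fderiv ℝ F u a ∈ tangentSubspace M (F u) := by
  rw [hF.tangentSubspace_eq hu]; exact ⟨a, rfl⟩

theorem inner_eq_zero (hF : IsLocalParam M V W F) (hu : u ∈ W) {ξ : EuclideanSpace ℝ (Fin n)}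
    (hξ : ξ ∈ normalSubspace M (F u)) (a : EuclideanSpace ℝ (Fin d)) :
    inner ℝ (fderiv ℝ F u a) ξ = 0 :=
  (Submodule.mem_orthogonal _ _).1 hξ _ (hF.mem_tangentSubspace hu a)

theorem starProjection_tangentSubspace (hF : IsLocalParam M V W F) (hu : u ∈ W)
    (y : EuclideanSpace ℝ (Fin n)) :
    (tangentSubspace M (F u)).starProjection y = fderiv ℝ F u (pinv (fderiv ℝ F u) y) := by
  rw [self_pinv_apply (hF.injective u hu)]
  congr 2
  exact hF.tangentSubspace_eq hu

theorem starProjection_normalSubspace (hF : IsLocalParam M V W F) (hu : u ∈ W)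
    (y : EuclideanSpace ℝ (Fin n)) :
    (normalSubspace M (F u)).starProjection y =
      y - fderiv ℝ F u (pinv (fderiv ℝ F u) y) := by
  rw [← hF.starProjection_tangentSubspace hu, normalSubspace,
    Submodule.starProjection_orthogonal_val]

theorem pinv_starProjection (hF : IsLocalParam M V W F) (hu : u ∈ W)
    (y : EuclideanSpace ℝ (Fin n)) :
    pinv (fderiv ℝ F u) ((tangentSubspace M (F u)).starProjection y) = pinv (fderiv ℝ F u) y := by
  rw [hF.starProjection_tangentSubspace hu, pinv_apply_self (hF.injective u hu)]

theorem fderiv_pinv_of_mem (hF : IsLocalParam M V W F) (hu : u ∈ W)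
    {v : EuclideanSpace ℝ (Fin n)} (hv : v ∈ tangentSubspace M (F u)) :
    fderiv ℝ F u (pinv (fderiv ℝ F u) v) = v := by
  rw [← hF.starProjection_tangentSubspace hu, Submodule.starProjection_eq_self_iff.2 hv]

theorem contDiffAt_projection (hF : IsLocalParam M V W F) (hu : u ∈ W) :
    ContDiffAt ℝ 1 (fun v => fderiv ℝ F v ∘L pinv (fderiv ℝ F v)) u :=
  (hF.contDiffAt_fderiv hu).clm_comp (hF.contDiffAt_pinv_fderiv hu)

theorem contDiffAt_tangentExtension (hF : IsLocalParam M V W F) (hu : u ∈ W)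
    (w : EuclideanSpace ℝ (Fin n)) : ContDiffAt ℝ 1 (fun v => tangentExtension M w (F v)) u := by
  refine ((hF.contDiffAt_projection hu).clm_apply contDiffAt_const).congr_of_eventuallyEq
    (f₁ := fun v => tangentExtension M w (F v)) (f := fun v => (fderiv ℝ F v ∘L pinv (fderiv ℝ F v)) w) ?_
  filter_upwards [hF.isOpen_source.mem_nhds hu] with v hv
  exact hF.starProjection_tangentSubspace hv w

/-- The second fundamental form pulled back to a parametrization: the second derivative of `F`,
as a bilinear form on `ℝⁿ` through the left inverse of `DF`. Its normal part is the second
fundamental form. -/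
def _root_.paramHessian (F : EuclideanSpace ℝ (Fin d) → EuclideanSpace ℝ (Fin n))
    (u : EuclideanSpace ℝ (Fin d)) :
    EuclideanSpace ℝ (Fin n) →L[ℝ] EuclideanSpace ℝ (Fin n) →L[ℝ] EuclideanSpace ℝ (Fin n) :=
  (fderiv ℝ (fderiv ℝ F) u).bilinearComp (pinv (fderiv ℝ F u)) (pinv (fderiv ℝ F u))

theorem _root_.paramHessian_apply (F : EuclideanSpace ℝ (Fin d) → EuclideanSpace ℝ (Fin n))
    (u : EuclideanSpace ℝ (Fin d)) (v w : EuclideanSpace ℝ (Fin n)) :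
    paramHessian F u v w =
      fderiv ℝ (fderiv ℝ F) u (pinv (fderiv ℝ F u) v) (pinv (fderiv ℝ F u) w) := rfl

/-- Differentiating `P DF = DF`, where `P` is the projection to the tangent space, identifies the
normal part of the derivative of a tangent field with that of the second derivative of the
parametrization. -/
theorem inner_derivAlong_tangentExtension (hF : IsLocalParam M V W F) (hu : u ∈ W)
    {v w ξ : EuclideanSpace ℝ (Fin n)} (hv : v ∈ tangentSubspace M (F u))
    (hw : w ∈ tangentSubspace M (F u)) (hξ : ξ ∈ normalSubspace M (F u)) :
    inner ℝ ξ (derivAlong M (tangentExtension M w) (F u) v) =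
      inner ℝ ξ (paramHessian F u v w) := by
  set L := fderiv ℝ F u with hL
  set a := pinv L v with ha
  set b := pinv L w with hb
  have hva : L a = v := hF.fderiv_pinv_of_mem hu hv
  have hwb : L b = w := hF.fderiv_pinv_of_mem hu hw
  let Θ := fun v => fderiv ℝ F v ∘L pinv (fderiv ℝ F v)
  have hΘ : DifferentiableAt ℝ Θ u := (hF.contDiffAt_projection hu).differentiableAt (by simp)
  have hDF : DifferentiableAt ℝ (fderiv ℝ F) u := (hF.contDiffAt_fderiv hu).differentiableAt (by simp)
  have e1 : derivAlong M (tangentExtension M w) (F u) v = fderiv ℝ Θ u a w := by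
    conv_lhs => rw [← hva]
    rw [hF.derivAlong_eq hu (hF.contDiffAt_tangentExtension hu w)]
    have h1 : (fun v => tangentExtension M w (F v)) =ᶠ[𝓝 u] fun v => Θ v w := by
      filter_upwards [hF.isOpen_source.mem_nhds hu] with v hv
      exact hF.starProjection_tangentSubspace hv w
    rw [h1.fderiv_eq, fderiv_clm_apply hΘ (differentiableAt_const w)]
    simp
  have h2 : (fun v => Θ v (fderiv ℝ F v b)) =ᶠ[𝓝 u] fun v => fderiv ℝ F v b := by
    filter_upwards [hF.isOpen_source.mem_nhds hu] with v hv
    exact congrArg (fderiv ℝ F v) (pinv_apply_self (hF.injective v hv) b)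
  have h3 : HasFDerivAt (fun v => fderiv ℝ F v b) ((fderiv ℝ (fderiv ℝ F) u).flip b) u := by
    have := hDF.hasFDerivAt.clm_apply (hasFDerivAt_const b u)
    simpa using this
  have h4 := hΘ.hasFDerivAt.clm_apply h3
  have h5 := congrArg (fun A => A a) (h4.unique (h3.congr_of_eventuallyEq h2))
  simp only [add_apply, ContinuousLinearMap.comp_apply,
    ContinuousLinearMap.flip_apply] at h5
  rw [← hL, hwb] at h5
  rw [e1, paramHessian_apply, ← hL, ← ha, ← hb, ← h5, inner_add_right]
  have h6 : inner ℝ ξ (Θ u (fderiv ℝ (fderiv ℝ F) u a b)) = 0 := by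
    rw [real_inner_comm]
    exact hF.inner_eq_zero hu hξ _
  rw [h6, zero_add]

theorem starProjection_derivAlong_tangentExtension (hF : IsLocalParam M V W F) (hu : u ∈ W)
    {K : Submodule ℝ (EuclideanSpace ℝ (Fin n))} (hK : K ≤ normalSubspace M (F u))
    {v w : EuclideanSpace ℝ (Fin n)} (hv : v ∈ tangentSubspace M (F u))
    (hw : w ∈ tangentSubspace M (F u)) :
    K.starProjection (derivAlong M (tangentExtension M w) (F u) v) =
      K.starProjection (paramHessian F u v w) := by
  rw [← sub_eq_zero, ← map_sub, Submodule.starProjection_apply_eq_zero_iff]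
  rw [Submodule.mem_orthogonal]
  intro ξ hξ
  rw [inner_sub_right, hF.inner_derivAlong_tangentExtension hu hv hw (hK hξ), sub_self]

theorem secondForm_eq (hF : IsLocalParam M V W F) (hu : u ∈ W)
    {v w : EuclideanSpace ℝ (Fin n)} (hv : v ∈ tangentSubspace M (F u))
    (hw : w ∈ tangentSubspace M (F u)) :
    secondForm M (F u) v w = (normalSubspace M (F u)).starProjection (paramHessian F u v w) :=
  hF.starProjection_derivAlong_tangentExtension hu le_rfl hv hw

theorem _root_.sphereNormalSubspace_le (S : Set (EuclideanSpace ℝ (Fin n)))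
    (x : EuclideanSpace ℝ (Fin n)) : sphereNormalSubspace S x ≤ normalSubspace S x :=
  Submodule.orthogonal_le le_sup_left

theorem sphereSecondForm_eq (hF : IsLocalParam M V W F) (hu : u ∈ W)
    {v w : EuclideanSpace ℝ (Fin n)} (hv : v ∈ tangentSubspace M (F u))
    (hw : w ∈ tangentSubspace M (F u)) :
    sphereSecondForm M (F u) v w =
      (sphereNormalSubspace M (F u)).starProjection (paramHessian F u v w) :=
  hF.starProjection_derivAlong_tangentExtension hu (sphereNormalSubspace_le M (F u)) hv hw

theorem inner_secondForm (hF : IsLocalParam M V W F) (hu : u ∈ W)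
    {v w ξ : EuclideanSpace ℝ (Fin n)} (hv : v ∈ tangentSubspace M (F u))
    (hw : w ∈ tangentSubspace M (F u)) (hξ : ξ ∈ normalSubspace M (F u)) :
    inner ℝ (secondForm M (F u) v w) ξ = inner ℝ (paramHessian F u v w) ξ := by
  rw [hF.secondForm_eq hu hv hw, Submodule.inner_starProjection_left_eq_right,
    Submodule.starProjection_eq_self_iff.2 hξ]

theorem inner_sphereSecondForm (hF : IsLocalParam M V W F) (hu : u ∈ W)
    {v w ξ : EuclideanSpace ℝ (Fin n)} (hv : v ∈ tangentSubspace M (F u))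
    (hw : w ∈ tangentSubspace M (F u)) (hξ : ξ ∈ sphereNormalSubspace M (F u)) :
    inner ℝ (sphereSecondForm M (F u) v w) ξ = inner ℝ (paramHessian F u v w) ξ := by
  rw [hF.sphereSecondForm_eq hu hv hw, Submodule.inner_starProjection_left_eq_right,
    Submodule.starProjection_eq_self_iff.2 hξ]

end IsLocalParam

end Charts

/-! ### The divergence theorem in a parametrization -/

section Divergence

variable {E F : Type*} [NormedAddCommGroup E] [InnerProductSpace ℝ E] [FiniteDimensional ℝ E]
  [NormedAddCommGroup F] [InnerProductSpace ℝ F] [FiniteDimensional ℝ F]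

theorem adjoint_self_pinv_adjoint {L : E →L[ℝ] F} (hL : Function.Injective L) (a : E) :
    ContinuousLinearMap.adjoint L (L (pinv L (ContinuousLinearMap.adjoint (pinv L) a))) = a := by
  refine ext_inner_right ℝ fun c => ?_
  rw [ContinuousLinearMap.adjoint_inner_left, self_pinv_apply hL,
    Submodule.inner_starProjection_left_eq_right, ← self_pinv_apply hL, pinv_apply_self hL,
    ContinuousLinearMap.adjoint_inner_left, pinv_apply_self hL]

theorem traceCLM_smulRight (A : E →L[ℝ] ℝ) (c : E) : traceCLM E (A.smulRight c) = A c := by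
  rw [traceCLM_eq_sum_inner (stdOrthonormalBasis ℝ E)]
  simp only [ContinuousLinearMap.smulRight_apply, inner_smul_right]
  conv_rhs => rw [← (stdOrthonormalBasis ℝ E).sum_repr c, map_sum]
  refine Finset.sum_congr rfl fun i _ => ?_
  rw [map_smul, smul_eq_mul, OrthonormalBasis.repr_apply_apply, mul_comm]

/-- A trace of `β` over `F`, pulled back through `Q : F → E`, is a trace over `E` weighted by `Q Q†`. -/
theorem sum_bilin_comp_eq {Y : Type*} [AddCommGroup Y] [Module ℝ Y] {ι κ : Type*} [Fintype ι]
    [Fintype κ] (b : OrthonormalBasis ι ℝ E) (c : OrthonormalBasis κ ℝ F) (Q : F →L[ℝ] E)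
    (β : E →ₗ[ℝ] E →ₗ[ℝ] Y) :
    ∑ a, β (Q (c a)) (Q (c a)) = ∑ i, β (b i) (Q (ContinuousLinearMap.adjoint Q (b i))) := by
  have h1 : ∀ a, Q (c a) = ∑ i, inner ℝ (c a) (ContinuousLinearMap.adjoint Q (b i)) • b i := by
    intro a
    conv_lhs => rw [← b.sum_repr (Q (c a))]
    refine Finset.sum_congr rfl fun i _ => ?_
    rw [ContinuousLinearMap.adjoint_inner_right, b.repr_apply_apply, real_inner_comm]
  have h2 : ∀ i, Q (ContinuousLinearMap.adjoint Q (b i)) =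
      ∑ a, inner ℝ (c a) (ContinuousLinearMap.adjoint Q (b i)) • Q (c a) := by
    intro i
    conv_lhs => rw [← c.sum_repr (ContinuousLinearMap.adjoint Q (b i)), map_sum]
    refine Finset.sum_congr rfl fun a _ => ?_
    rw [map_smul, c.repr_apply_apply]
  simp_rw [h2, map_sum, map_smul]
  rw [Finset.sum_comm]
  refine Finset.sum_congr rfl fun a _ => ?_
  refine (congrArg (fun z => β z (Q (c a))) (h1 a)).trans ?_
  simp only [map_sum, LinearMap.sum_apply, map_smul, LinearMap.smul_apply]

variable [MeasurableSpace E] [BorelSpace E]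

/-- The divergence theorem for a compactly supported `C¹` vector field. -/
theorem integral_trace_fderiv_eq_zero {Z : E → E} (hZ : ContDiff ℝ 1 Z)
    (hc : HasCompactSupport Z) : ∫ u, traceCLM E (fderiv ℝ Z u) = 0 := by
  let b := stdOrthonormalBasis ℝ E
  simp_rw [traceCLM_eq_sum_inner b]
  have hfc : Continuous (fderiv ℝ Z) := hZ.continuous_fderiv (by simp)
  have hcont : ∀ i, Continuous fun u => inner ℝ (b i) (fderiv ℝ Z u (b i)) := fun i =>
    continuous_const.inner (hfc.clm_apply continuous_const)
  have hint : ∀ i, Integrable fun u => inner ℝ (b i) (fderiv ℝ Z u (b i)) := fun i =>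
    (hcont i).integrable_of_hasCompactSupport ((hc.fderiv ℝ).mono fun u hu => by
      contrapose! hu
      simp only [Function.mem_support, not_not] at hu
      simp [hu])
  rw [integral_finsetSum _ fun i _ => hint i]
  refine Finset.sum_eq_zero fun i _ => ?_
  have hg : ∀ u, HasFDerivAt (fun u => inner ℝ (b i) (Z u)) ((innerSL ℝ (b i)) ∘L fderiv ℝ Z u) u :=
    fun u => (innerSL ℝ (b i)).hasFDerivAt.comp u
      ((hZ.differentiable (by simp)) u).hasFDerivAt
  have hZi : Integrable fun u => inner ℝ (b i) (Z u) :=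
    (continuous_const.inner hZ.continuous).integrable_of_hasCompactSupport (hc.mono fun u hu => by
      contrapose! hu
      simp only [Function.mem_support, not_not] at hu
      simp [hu])
  have := integral_bilinear_hasFDerivAt_right_eq_neg_left_of_integrable (μ := volume) (v := b i)
    (B := ContinuousLinearMap.mul ℝ ℝ) (f := fun _ : E => (1 : ℝ)) (f' := fun _ => 0)
    (g := fun u => inner ℝ (b i) (Z u)) (g' := fun u => (innerSL ℝ (b i)) ∘L fderiv ℝ Z u)
    (by simp) (by simpa using hint i) (by simpa using hZi)
    (fun u _ => hasFDerivAt_const _ _) (fun u _ => hg u)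
  simpa using this

/-- The divergence theorem on an open set, for a field with compact support in it. -/
theorem setIntegral_trace_fderiv_eq_zero {Z : E → E} {W C : Set E} (hW : IsOpen W)
    (hZ : ContDiffOn ℝ 1 Z W) (hC : IsCompact C) (hCW : C ⊆ W) (h0 : ∀ u ∈ W \ C, Z u = 0) :
    ∫ u in W, traceCLM E (fderiv ℝ Z u) = 0 := by
  set Z' := W.indicator Z with hZ'
  have e1 : ∀ u ∈ W, Z' =ᶠ[𝓝 u] Z := fun u hu => by
    filter_upwards [hW.mem_nhds hu] with v hv
    exact indicator_of_mem hv Z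
  have e2 : ∀ u ∉ C, Z' =ᶠ[𝓝 u] 0 := fun u hu => by
    filter_upwards [hC.isClosed.isOpen_compl.mem_nhds hu] with v hv
    by_cases hvW : v ∈ W
    · rw [hZ', indicator_of_mem hvW, h0 v ⟨hvW, hv⟩]; rfl
    · rw [hZ', indicator_of_notMem hvW]; rfl
  have hsm : ContDiff ℝ 1 Z' := contDiff_iff_contDiffAt.2 fun u => by
    by_cases hu : u ∈ W
    · exact (hZ.contDiffAt (hW.mem_nhds hu)).congr_of_eventuallyEq (e1 u hu)
    · exact contDiffAt_const.congr_of_eventuallyEq (e2 u fun h => hu (hCW h))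
  have hcs : HasCompactSupport Z' := HasCompactSupport.intro hC fun u hu => (e2 u hu).eq_of_nhds
  rw [← integral_trace_fderiv_eq_zero hsm hcs]
  rw [setIntegral_congr_fun (g := fun u => traceCLM E (fderiv ℝ Z' u)) hW.measurableSet
    fun u hu => by simp only [(e1 u hu).fderiv_eq]]
  refine setIntegral_eq_integral_of_forall_compl_eq_zero fun u hu => ?_
  rw [(e2 u fun h => hu (hCW h)).fderiv_eq]
  simp

end Divergence

/-! ### Divergences weighted by the Jacobian of a parametrization -/

section ChartDivergence

variable {n d : ℕ} {M V : Set (EuclideanSpace ℝ (Fin n))} {W : Set (EuclideanSpace ℝ (Fin d))}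
  {F : EuclideanSpace ℝ (Fin d) → EuclideanSpace ℝ (Fin n)} {u : EuclideanSpace ℝ (Fin d)}

namespace IsLocalParam

theorem hasFDerivAt_normDet (hF : IsLocalParam M V W F) (hu : u ∈ W) :
    HasFDerivAt (fun v => (fderiv ℝ F v).normDet)
      (((fderiv ℝ F u).normDet • (traceCLM _ ∘L
        ContinuousLinearMap.compL ℝ _ _ _ (pinv (fderiv ℝ F u)))) ∘L fderiv ℝ (fderiv ℝ F) u) u :=
  (_root_.hasFDerivAt_normDet (hF.injective u hu)).comp u
    ((hF.contDiffAt_fderiv hu).differentiableAt (by simp)).hasFDerivAt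

/-- The mean curvature, paired with a normal vector, as a trace in a parametrization. -/
theorem inner_meanCurvature (hF : IsLocalParam M V W F) (hu : u ∈ W)
    {ξ : EuclideanSpace ℝ (Fin n)} (hξ : ξ ∈ normalSubspace M (F u)) {ι : Type*} [Fintype ι]
    (b : OrthonormalBasis ι ℝ (EuclideanSpace ℝ (Fin d))) :
    inner ℝ (meanCurvature M (F u)) ξ = ∑ i, inner ℝ (fderiv ℝ (fderiv ℝ F) u (b i)
      (pinv (fderiv ℝ F u) (ContinuousLinearMap.adjoint (pinv (fderiv ℝ F u)) (b i)))) ξ := by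
  rw [meanCurvature, sum_inner]
  rw [Finset.sum_congr rfl fun i _ => hF.inner_secondForm hu (tangentBasis M (F u) i).2
    (tangentBasis M (F u) i).2 hξ]
  rw [← sum_inner, ← sum_inner]
  congr 1
  let β : EuclideanSpace ℝ (Fin n) →ₗ[ℝ] EuclideanSpace ℝ (Fin n) →ₗ[ℝ] EuclideanSpace ℝ (Fin n) :=
    (paramHessian F u).toLinearMap₁₂
  have h1 := sum_orthonormalBasis_subspace _ (tangentBasis M (F u))
    (stdOrthonormalBasis ℝ (EuclideanSpace ℝ (Fin n))) β
  have h2 := sum_bilin_comp_eq b (stdOrthonormalBasis ℝ (EuclideanSpace ℝ (Fin n)))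
    (pinv (fderiv ℝ F u)) (fderiv ℝ (fderiv ℝ F) u).toLinearMap₁₂
  refine h1.trans (Eq.trans ?_ h2)
  refine Finset.sum_congr rfl fun a _ => ?_
  change paramHessian F u _ _ = _
  rw [paramHessian_apply, hF.pinv_starProjection hu]
  rfl

theorem trace_fderiv_normDet_smul_pinv_tangent (hF : IsLocalParam M V W F) (hu : u ∈ W)
    (c : EuclideanSpace ℝ (Fin d)) :
    traceCLM _ ((fderiv ℝ (fun v => (fderiv ℝ F v).normDet • pinv (fderiv ℝ F v)) u).flip
      (fderiv ℝ F u c)) = 0 := by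
  set L := fderiv ℝ F u with hL
  set Q := pinv L with hQ
  set J := L.normDet with hJ
  set D := fderiv ℝ (fderiv ℝ F) u with hD
  set R := fun v => (fderiv ℝ F v).normDet • pinv (fderiv ℝ F v) with hR
  have hJd := hF.hasFDerivAt_normDet hu
  set J' := ((fderiv ℝ F u).normDet • (traceCLM _ ∘L
        ContinuousLinearMap.compL ℝ _ _ _ (pinv (fderiv ℝ F u)))) ∘L fderiv ℝ (fderiv ℝ F) u with hJ'
  have hQd : HasFDerivAt (fun v => pinv (fderiv ℝ F v)) (fderiv ℝ (fun v => pinv (fderiv ℝ F v)) u) u :=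
    ((hF.contDiffAt_pinv_fderiv hu).differentiableAt (by simp)).hasFDerivAt
  have hDd : HasFDerivAt (fderiv ℝ F) D u :=
    ((hF.contDiffAt_fderiv hu).differentiableAt (by simp)).hasFDerivAt
  have hRd : HasFDerivAt R (fderiv ℝ R u) u :=
    (hJd.smul hQd).differentiableAt.hasFDerivAt
  let b := stdOrthonormalBasis ℝ (EuclideanSpace ℝ (Fin d))
  have h2 : (fun v => R v (fderiv ℝ F v c)) =ᶠ[𝓝 u] fun v => (fderiv ℝ F v).normDet • c := by
    filter_upwards [hF.isOpen_source.mem_nhds hu] with v hv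
    simp only [hR, smul_apply]
    rw [pinv_apply_self (hF.injective v hv)]
  have h3 : HasFDerivAt (fun v => fderiv ℝ F v c) (D.flip c) u := by
    simpa using hDd.clm_apply (hasFDerivAt_const c u)
  have h4 := hRd.clm_apply h3
  have h5 := h4.unique ((hJd.smul_const c).congr_of_eventuallyEq h2)
  have h6 : (fderiv ℝ R u).flip (L c) = J'.smulRight c - (J • Q) ∘L D.flip c := by
    rw [← h5]; simp [hR, ← hL, ← hQ, ← hJ]
  have h7 : D.flip c = D c := by
    ext1 a; exact hF.fderiv_fderiv_comm hu a c
  rw [h6, map_sub, traceCLM_smulRight, h7, sub_eq_zero]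
  rw [ContinuousLinearMap.smul_comp, map_smul]
  rfl

theorem trace_fderiv_normDet_smul_pinv_normal (hF : IsLocalParam M V W F) (hu : u ∈ W)
    {ξ : EuclideanSpace ℝ (Fin n)} (hξ : ξ ∈ normalSubspace M (F u)) :
    traceCLM _ ((fderiv ℝ (fun v => (fderiv ℝ F v).normDet • pinv (fderiv ℝ F v)) u).flip ξ) =
      (fderiv ℝ F u).normDet * inner ℝ (meanCurvature M (F u)) ξ := by
  set L := fderiv ℝ F u with hL
  set Q := pinv L with hQ
  set J := L.normDet with hJ
  set D := fderiv ℝ (fderiv ℝ F) u with hD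
  have hLinj := hF.injective u hu
  have hJd := hF.hasFDerivAt_normDet hu
  have hQd : HasFDerivAt (fun v => pinv (fderiv ℝ F v)) (fderiv ℝ (fun v => pinv (fderiv ℝ F v)) u) u :=
    ((hF.contDiffAt_pinv_fderiv hu).differentiableAt (by simp)).hasFDerivAt
  have hDd : HasFDerivAt (fderiv ℝ F) D u :=
    ((hF.contDiffAt_fderiv hu).differentiableAt (by simp)).hasFDerivAt
  let b := stdOrthonormalBasis ℝ (EuclideanSpace ℝ (Fin d))
  have hQξ : Q ξ = 0 := pinv_eq_zero fun v => hF.inner_eq_zero hu hξ v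
  set Q' := fderiv ℝ (fun v => pinv (fderiv ℝ F v)) u
  have hRd := hJd.smul hQd
  have h1 : ∀ a, fderiv ℝ (fun v => (fderiv ℝ F v).normDet • pinv (fderiv ℝ F v)) u a ξ =
      J • Q' a ξ := by
    intro a
    have e : fderiv ℝ (fun v => (fderiv ℝ F v).normDet • pinv (fderiv ℝ F v)) u = _ := hRd.fderiv
    rw [e]
    simp only [add_apply, smul_apply, ContinuousLinearMap.smulRight_apply]
    rw [← hL, ← hQ, hQξ, smul_zero, add_zero]
  have hadj : HasFDerivAt (fun v => adjointCLM _ _ (fderiv ℝ F v)) ((adjointCLM _ _) ∘L D) u :=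
    HasFDerivAt.comp u (adjointCLM (EuclideanSpace ℝ (Fin d))
      (EuclideanSpace ℝ (Fin n))).hasFDerivAt hDd
  have hΓ := hadj.clm_comp hDd
  have hq : HasFDerivAt (fun v => pinv (fderiv ℝ F v) ξ) (Q'.flip ξ) u := by
    simpa using hQd.clm_apply (hasFDerivAt_const ξ u)
  -- the derivative of `L† L Q = L†` applied to `ξ`
  have h2 : (fun v => ((adjointCLM _ _ (fderiv ℝ F v)) ∘L fderiv ℝ F v) (pinv (fderiv ℝ F v) ξ))
      =ᶠ[𝓝 u] fun v => adjointCLM _ _ (fderiv ℝ F v) ξ := by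
    filter_upwards [hF.isOpen_source.mem_nhds hu] with v hv
    exact adjoint_comp_self_pinv (hF.injective v hv) ξ
  have h3 : HasFDerivAt (fun v => adjointCLM _ _ (fderiv ℝ F v) ξ)
      (((adjointCLM _ _) ∘L D).flip ξ) u := by
    simpa using hadj.clm_apply (hasFDerivAt_const ξ u)
  have h4 := (hΓ.clm_apply hq).unique (h3.congr_of_eventuallyEq h2)
  have h5 : ∀ a, ContinuousLinearMap.adjoint L (L (Q' a ξ)) =
      ContinuousLinearMap.adjoint (D a) ξ := by
    intro a
    have := congrArg (fun A => A a) h4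
    simp only [add_apply, ContinuousLinearMap.comp_apply, ContinuousLinearMap.flip_apply] at this
    rw [← hL, ← hQ, hQξ, map_zero, zero_add, map_zero, add_zero] at this
    exact this
  have h6 : ∀ a, inner ℝ a (Q' a ξ) =
      inner ℝ (D a (Q (ContinuousLinearMap.adjoint Q a))) ξ := by
    intro a
    calc inner ℝ a (Q' a ξ)
        = inner ℝ (ContinuousLinearMap.adjoint L (L (Q (ContinuousLinearMap.adjoint Q a))))
            (Q' a ξ) := by rw [hQ, adjoint_self_pinv_adjoint hLinj a]
      _ = inner ℝ (Q (ContinuousLinearMap.adjoint Q a))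
            (ContinuousLinearMap.adjoint L (L (Q' a ξ))) := by
          rw [ContinuousLinearMap.adjoint_inner_left, ContinuousLinearMap.adjoint_inner_right]
      _ = _ := by rw [h5, ContinuousLinearMap.adjoint_inner_right]
  rw [traceCLM_eq_sum_inner b]
  simp only [ContinuousLinearMap.flip_apply, h1, inner_smul_right, h6]
  rw [← Finset.mul_sum, ← hF.inner_meanCurvature hu hξ b]

/-- The field of operators `√g · (DF)⁻¹` is divergence free when the mean curvature vanishes: on
tangent vectors by Jacobi's formula and the symmetry of `D²F`, on normal vectors because the
divergence is then the mean curvature. -/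
theorem trace_fderiv_normDet_smul_pinv (hF : IsLocalParam M V W F) (hu : u ∈ W)
    (hH : meanCurvature M (F u) = 0) (y : EuclideanSpace ℝ (Fin n)) :
    traceCLM _ ((fderiv ℝ (fun v => (fderiv ℝ F v).normDet • pinv (fderiv ℝ F v)) u).flip y) = 0 := by
  have hdec : y = fderiv ℝ F u (pinv (fderiv ℝ F u) y) +
      (normalSubspace M (F u)).starProjection y := by
    rw [hF.starProjection_normalSubspace hu]; simp
  rw [hdec, map_add, map_add, hF.trace_fderiv_normDet_smul_pinv_tangent hu,
    hF.trace_fderiv_normDet_smul_pinv_normal hu (Submodule.starProjection_apply_mem _ _), hH,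
    inner_zero_left, mul_zero, add_zero]

theorem contDiffOn_normDet (hF : IsLocalParam M V W F) :
    ContDiffOn ℝ 1 (fun v => (fderiv ℝ F v).normDet) W := fun _ hu =>
  ((contDiffAt_normDet (hF.injective _ hu)).comp _ (hF.contDiffAt_fderiv hu)).contDiffWithinAt

/-- For a minimal submanifold and a weight whose gradient is tangent to it, the first variation
of the weighted area along `y` is the divergence of `f √g (DF)⁻¹ y`. -/
theorem trace_fderiv_weighted (hF : IsLocalParam M V W F) (hu : u ∈ W)
    (hH : meanCurvature M (F u) = 0) {f : EuclideanSpace ℝ (Fin n) → ℝ}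
    (hf : DifferentiableAt ℝ f (F u))
    (hfn : ∀ ξ ∈ normalSubspace M (F u), fderiv ℝ f (F u) ξ = 0)
    {y : EuclideanSpace ℝ (Fin d) → EuclideanSpace ℝ (Fin n)} (hy : DifferentiableAt ℝ y u) :
    traceCLM _ (fderiv ℝ (fun v => f (F v) • ((fderiv ℝ F v).normDet • pinv (fderiv ℝ F v)) (y v)) u)
      = (fderiv ℝ F u).normDet * (f (F u) * traceCLM _ (pinv (fderiv ℝ F u) ∘L fderiv ℝ y u) +
        fderiv ℝ f (F u) (y u)) := by
  set L := fderiv ℝ F u with hL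
  set R := fun v => (fderiv ℝ F v).normDet • pinv (fderiv ℝ F v) with hR
  have hRd : HasFDerivAt R (fderiv ℝ R u) u :=
    (((hF.contDiffOn_normDet.contDiffAt (hF.isOpen_source.mem_nhds hu)).smul
      (hF.contDiffAt_pinv_fderiv hu)).differentiableAt (by simp)).hasFDerivAt
  have hfF : HasFDerivAt (fun v => f (F v)) (fderiv ℝ f (F u) ∘L L) u :=
    hf.hasFDerivAt.comp u (hF.hasFDerivAt hu)
  have h1 := hfF.smul (hRd.clm_apply hy.hasFDerivAt)
  have e : fderiv ℝ (fun v => f (F v) • R v (y v)) u = _ := h1.fderiv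
  rw [e]
  have h5 : traceCLM _ ((fderiv ℝ R u).flip (y u)) = 0 :=
    hF.trace_fderiv_normDet_smul_pinv hu hH (y u)
  simp only [map_add, map_smul, h5]
  have hRu : R u = L.normDet • pinv L := rfl
  have h2 : traceCLM _ ((fderiv ℝ f (F u) ∘L L).smulRight (R u (y u))) =
      L.normDet * fderiv ℝ f (F u) (y u) := by
    have hdec : y u = L (pinv L (y u)) + (normalSubspace M (F u)).starProjection (y u) := by
      rw [hF.starProjection_normalSubspace hu]; simp [hL]
    have h3 : fderiv ℝ f (F u) (y u) = fderiv ℝ f (F u) (L (pinv L (y u))) := by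
      conv_lhs => rw [hdec]
      rw [map_add, hfn _ (Submodule.starProjection_apply_mem _ _), add_zero]
    rw [traceCLM_smulRight, h3, hRu, smul_apply, map_smul, smul_eq_mul]
    rfl
  rw [h2, hRu, ContinuousLinearMap.smul_comp, map_smul]
  simp only [smul_eq_mul]
  ring

end IsLocalParam

end ChartDivergence

/-! ### The first variation of the weighted area -/

section FirstVariation

variable {n d : ℕ} {M V : Set (EuclideanSpace ℝ (Fin n))} {W : Set (EuclideanSpace ℝ (Fin d))}
  {F : EuclideanSpace ℝ (Fin d) → EuclideanSpace ℝ (Fin n)} {u : EuclideanSpace ℝ (Fin d)}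

namespace IsC2Submanifold

theorem continuousOn_of_isLocalParam (hM : IsC2Submanifold d M) {Z : Type*} [TopologicalSpace Z]
    {q : EuclideanSpace ℝ (Fin n) → Z}
    (hq : ∀ (V : Set (EuclideanSpace ℝ (Fin n))) (W : Set (EuclideanSpace ℝ (Fin d)))
      (F : EuclideanSpace ℝ (Fin d) → EuclideanSpace ℝ (Fin n)), IsLocalParam M V W F →
      ContinuousOn (fun u => q (F u)) W) : ContinuousOn q M := by
  intro x hx
  obtain ⟨V, W, F, hxV, hF⟩ := hM.exists_isLocalParam hx
  obtain ⟨u, hu, rfl⟩ := hF.exists_eq hx hxV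
  exact hF.continuousWithinAt_of_comp hu ((hq V W F hF).continuousAt (hF.isOpen_source.mem_nhds hu))

theorem contDiffOn_of_isLocalParam (hM : IsC2Submanifold d M) {Z : Type*} [NormedAddCommGroup Z]
    [NormedSpace ℝ Z] {q : EuclideanSpace ℝ (Fin n) → Z}
    (hq : ∀ (V : Set (EuclideanSpace ℝ (Fin n))) (W : Set (EuclideanSpace ℝ (Fin d)))
      (F : EuclideanSpace ℝ (Fin d) → EuclideanSpace ℝ (Fin n)), IsLocalParam M V W F →
      ContDiffOn ℝ 1 (fun u => q (F u)) W) : ContDiffOn ℝ 1 q M := by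
  intro x hx
  obtain ⟨V, W, F, hxV, hF⟩ := hM.exists_isLocalParam hx
  obtain ⟨u, hu, rfl⟩ := hF.exists_eq hx hxV
  exact hF.contDiffWithinAt_of_comp hu (by norm_num)
    ((hq V W F hF).contDiffAt (hF.isOpen_source.mem_nhds hu))

/-- A compact part of a submanifold has finite area. -/
theorem measure_lt_top (hM : IsC2Submanifold d M) {T : Set (EuclideanSpace ℝ (Fin n))}
    (hT : IsCompact T) (hTM : T ⊆ M) : μHE[d] T < ⊤ := by
  refine hT.measure_lt_top_of_nhdsWithin fun x hx => ?_
  obtain ⟨V, W, F, hxV, hF⟩ := hM.exists_isLocalParam (hTM hx)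
  obtain ⟨u, hu, rfl⟩ := hF.exists_eq (hTM hx) hxV
  obtain ⟨r, hr, hrW⟩ := Metric.nhds_basis_closedBall.mem_iff.1 (hF.isOpen_source.mem_nhds hu)
  refine ⟨F '' Metric.closedBall u r, nhdsWithin_mono _ hTM ?_, ?_⟩
  · rw [← hF.map_nhds hu]
    exact image_mem_map (Metric.closedBall_mem_nhds u hr)
  · have h1 := hF.isImmersionOn.measure_image (Metric.isClosed_closedBall (x := u) (ε := r)).measurableSet hrW
    rw [finrank_euclideanSpace_fin] at h1
    rw [h1]
    have h2 : IntegrableOn (fun v => (fderiv ℝ F v).normDet) (Metric.closedBall u r) :=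
      (hF.isImmersionOn.continuousOn_normDet.mono hrW).integrableOn_compact
        (isCompact_closedBall u r)
    exact h2.lintegral_lt_top

theorem integrableOn_compact (hM : IsC2Submanifold d M) {T : Set (EuclideanSpace ℝ (Fin n))}
    (hT : IsCompact T) (hTM : T ⊆ M) {q : EuclideanSpace ℝ (Fin n) → ℝ} (hq : ContinuousOn q T) :
    IntegrableOn q T μHE[d] := by
  obtain ⟨C, hC⟩ := hT.exists_bound_of_continuousOn hq
  have : IsFiniteMeasure ((μHE[d] : Measure (EuclideanSpace ℝ (Fin n))).restrict T) :=
    ⟨by rw [Measure.restrict_apply_univ]; exact hM.measure_lt_top hT hTM⟩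
  exact Integrable.of_bound (hq.aestronglyMeasurable hT.measurableSet) C
    ((ae_restrict_iff' hT.measurableSet).2 (Eventually.of_forall hC))

end IsC2Submanifold

/-- The integrand `f div_M X + ⟨∇f, X⟩` of the first variation of the weighted area; the
divergence is the trace over the tangent space of the derivative of `X`. -/
def firstVariationIntegrand (f : EuclideanSpace ℝ (Fin n) → ℝ) (M : Set (EuclideanSpace ℝ (Fin n)))
    (X : EuclideanSpace ℝ (Fin n) → EuclideanSpace ℝ (Fin n)) (x : EuclideanSpace ℝ (Fin n)) : ℝ :=
  f x * traceCLM _ (fderivWithin ℝ X M x ∘L (tangentSubspace M x).starProjection) +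
    fderiv ℝ f x (X x)

/-- The integrand vanishes off a closed set that supports the field. -/
theorem firstVariationIntegrand_eq_zero (f : EuclideanSpace ℝ (Fin n) → ℝ)
    {X : EuclideanSpace ℝ (Fin n) → EuclideanSpace ℝ (Fin n)}
    {T : Set (EuclideanSpace ℝ (Fin n))} (hT : IsClosed T) (h0 : ∀ x ∈ M \ T, X x = 0)
    {x : EuclideanSpace ℝ (Fin n)} (hx : x ∈ M \ T) : firstVariationIntegrand f M X x = 0 := by
  have h1 : X =ᶠ[𝓝[M] x] fun _ => 0 := by
    filter_upwards [self_mem_nhdsWithin, mem_nhdsWithin_of_mem_nhds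
      (hT.isOpen_compl.mem_nhds hx.2)] with y hy hyT
    exact h0 y ⟨hy, hyT⟩
  rw [firstVariationIntegrand, h1.fderivWithin_eq (h0 x hx), h0 x hx]
  simp

namespace IsLocalParam

theorem firstVariationIntegrand_eq (hF : IsLocalParam M V W F) (hu : u ∈ W)
    (f : EuclideanSpace ℝ (Fin n) → ℝ) {X : EuclideanSpace ℝ (Fin n) → EuclideanSpace ℝ (Fin n)}
    (hX : ContDiffAt ℝ 1 (fun v => X (F v)) u) :
    firstVariationIntegrand f M X (F u) =
      f (F u) * traceCLM _ (pinv (fderiv ℝ F u) ∘L fderiv ℝ (fun v => X (F v)) u) +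
        fderiv ℝ f (F u) (X (F u)) := by
  rw [firstVariationIntegrand, traceCLM_comp_comm (pinv (fderiv ℝ F u))]
  congr 3
  ext1 y
  simp only [ContinuousLinearMap.comp_apply]
  rw [hF.starProjection_tangentSubspace hu]
  exact hF.derivAlong_eq hu hX _

theorem continuousOn_firstVariationIntegrand (hF : IsLocalParam M V W F)
    {f : EuclideanSpace ℝ (Fin n) → ℝ} {U : Set (EuclideanSpace ℝ (Fin n))} (hU : IsOpen U)
    (hMU : M ⊆ U) (hf : ContDiffOn ℝ 1 f U)
    {X : EuclideanSpace ℝ (Fin n) → EuclideanSpace ℝ (Fin n)} (hX : ContDiffOn ℝ 1 X M) :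
    ContinuousOn (fun u => firstVariationIntegrand f M X (F u)) W := by
  have hy := hF.contDiffOn_comp (by norm_num) hX
  have hFU : MapsTo F W U := fun u hu => hMU (hF.mem hu)
  have hFc : ContinuousOn F W := hF.contDiffOn.continuousOn
  have h1 : ContinuousOn (fun u => f (F u)) W := hf.continuousOn.comp hFc hFU
  have h2 : ContinuousOn (fun u => fderiv ℝ f (F u) (X (F u))) W :=
    ((hf.continuousOn_fderiv_of_isOpen hU le_rfl).comp hFc hFU).clm_apply hy.continuousOn
  have h3 : ContinuousOn (fun u => traceCLM _ (pinv (fderiv ℝ F u) ∘L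
      fderiv ℝ (fun v => X (F v)) u)) W :=
    (traceCLM _).continuous.comp_continuousOn (hF.contDiffOn_pinv.continuousOn.clm_comp
      (hy.continuousOn_fderiv_of_isOpen hF.isOpen_source le_rfl))
  refine ((h1.mul h3).add h2).congr fun u hu => ?_
  exact hF.firstVariationIntegrand_eq hu f (hy.contDiffAt (hF.isOpen_source.mem_nhds hu))

/-- For a field supported in one parametrized piece, the integrand times the Jacobian is a
divergence in the parameter domain. -/
theorem setIntegral_firstVariationIntegrand_eq_zero (hF : IsLocalParam M V W F)
    (hH : ∀ x ∈ M, meanCurvature M x = 0) {f : EuclideanSpace ℝ (Fin n) → ℝ}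
    {U : Set (EuclideanSpace ℝ (Fin n))} (hU : IsOpen U)
    (hMU : M ⊆ U) (hf : ContDiffOn ℝ 1 f U)
    (hfn : ∀ x ∈ M, ∀ ξ ∈ normalSubspace M x, fderiv ℝ f x ξ = 0)
    {X : EuclideanSpace ℝ (Fin n) → EuclideanSpace ℝ (Fin n)} (hX : ContDiffOn ℝ 1 X M)
    {T : Set (EuclideanSpace ℝ (Fin n))} (hT : IsCompact T) (hTM : T ⊆ M) (hTV : T ⊆ V)
    (h0 : ∀ x ∈ M \ T, X x = 0) :
    ∫ x in F '' W, firstVariationIntegrand f M X x ∂μHE[d] = 0 := by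
  have hy := hF.contDiffOn_comp (by norm_num) hX
  have h1 := hF.isImmersionOn.integral_image hF.isOpen_source.measurableSet subset_rfl
    (firstVariationIntegrand f M X)
  rw [finrank_euclideanSpace_fin] at h1
  rw [h1]
  set C := W ∩ F ⁻¹' T with hCdef
  have hC : IsCompact C := by
    have hTF : T ⊆ range (W.domRestrict F) := by
      rw [range_domRestrict, hF.image_eq]
      exact subset_inter hTM hTV
    have h2 := (hF.isEmbedding.isInducing.isCompact_preimage_iff hTF).2 hT
    have h3 := h2.image continuous_subtype_val
    convert h3 using 1
    ext u; simp [hCdef, and_comm]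
  set Z := fun v => f (F v) • ((fderiv ℝ F v).normDet • pinv (fderiv ℝ F v)) (X (F v)) with hZ
  have hZc : ContDiffOn ℝ 1 Z W :=
    (hf.comp (hF.contDiffOn.of_le (by norm_num)) fun u hu => hMU (hF.mem hu)).smul
      ((hF.contDiffOn_normDet.smul hF.contDiffOn_pinv).clm_apply hy)
  rw [← setIntegral_trace_fderiv_eq_zero hF.isOpen_source hZc hC inter_subset_left]
  · refine setIntegral_congr_fun hF.isOpen_source.measurableSet fun u hu => ?_
    have hyu := hy.contDiffAt (hF.isOpen_source.mem_nhds hu)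
    refine (congrArg _ (hF.firstVariationIntegrand_eq hu f hyu)).trans ?_
    exact (hF.trace_fderiv_weighted hu (hH _ (hF.mem hu))
      ((hf.contDiffAt (hU.mem_nhds (hMU (hF.mem hu)))).differentiableAt (by simp))
      (hfn _ (hF.mem hu)) (hyu.differentiableAt (by simp))).symm
  · intro u hu
    have : X (F u) = 0 := h0 _ ⟨hF.mem hu.1, fun h => hu.2 ⟨hu.1, h⟩⟩
    simp [hZ, this]

end IsLocalParam

/-- The first variation of the weighted area of a minimal submanifold vanishes when the gradient
of the weight is tangent to it. -/
theorem IsC2Submanifold.setIntegral_firstVariationIntegrand_eq_zero (hM : IsC2Submanifold d M)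
    (hH : ∀ x ∈ M, meanCurvature M x = 0) {f : EuclideanSpace ℝ (Fin n) → ℝ}
    {U : Set (EuclideanSpace ℝ (Fin n))} (hU : IsOpen U)
    (hMU : M ⊆ U) (hf : ContDiffOn ℝ 1 f U)
    (hfn : ∀ x ∈ M, ∀ ξ ∈ normalSubspace M x, fderiv ℝ f x ξ = 0)
    {X : EuclideanSpace ℝ (Fin n) → EuclideanSpace ℝ (Fin n)} (hX : ContDiffOn ℝ 1 X M)
    {T : Set (EuclideanSpace ℝ (Fin n))} (hT : IsCompact T) (hTM : T ⊆ M)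
    (h0 : ∀ x ∈ M \ T, X x = 0) :
    ∫ x in T, firstVariationIntegrand f M X x ∂μHE[d] = 0 := by
  choose! V W F hxV hF using fun x (hx : x ∈ T) => hM.exists_isLocalParam (hTM hx)
  obtain ⟨t, hcover⟩ := hT.elim_nhds_subcover' (fun x _ => V x)
    fun x hx => (hF x hx).isOpen_target.mem_nhds (hxV x hx)
  obtain ⟨ρ, hρ⟩ := SmoothPartitionOfUnity.exists_isSubordinate
    (modelWithCornersSelf ℝ (EuclideanSpace ℝ (Fin n)))
    hT.isClosed (fun x : t => V (x : T)) (fun x => (hF _ (x : T).2).isOpen_target) (by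
      intro x hx
      obtain ⟨y, hy, hxy⟩ := mem_iUnion₂.1 (hcover hx)
      exact mem_iUnion.2 ⟨⟨y, hy⟩, hxy⟩)
  let Y : t → EuclideanSpace ℝ (Fin n) → EuclideanSpace ℝ (Fin n) := fun i x => ρ i x • X x
  have hYc : ∀ i, ContDiffOn ℝ 1 (Y i) M := fun i =>
    ((ρ i).contMDiff.contDiff.of_le (by exact_mod_cast le_top)).contDiffOn.smul hX
  have hsum : ∀ x ∈ M, X x = ∑ i, Y i x := by
    intro x hx
    by_cases hxT : x ∈ T
    · have := ρ.sum_eq_one hxT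
      rw [finsum_eq_sum_of_fintype] at this
      rw [← Finset.sum_smul, this, one_smul]
    · simp [Y, h0 x ⟨hx, hxT⟩]
  have hq : ∀ x ∈ T, firstVariationIntegrand f M X x =
      ∑ i, firstVariationIntegrand f M (Y i) x := by
    intro x hx
    have hxT := hx
    obtain ⟨u, hu, hux⟩ := (hF x hx).exists_eq (hTM hx) (hxV x hx)
    have hFx := hF _ hx
    have hopen := hFx.isOpen_source.mem_nhds hu
    have hYu : ∀ i, ContDiffAt ℝ 1 (fun v => Y i (F x v)) u := fun i =>
      (hFx.contDiffOn_comp (by norm_num) (hYc i)).contDiffAt hopen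
    rw [← hux]
    rw [hFx.firstVariationIntegrand_eq hu f
      ((hFx.contDiffOn_comp (by norm_num) hX).contDiffAt hopen)]
    rw [Finset.sum_congr rfl fun i _ => hFx.firstVariationIntegrand_eq hu f (hYu i)]
    have e1 : fderiv ℝ (fun v => X (F x v)) u = ∑ i, fderiv ℝ (fun v => Y i (F x v)) u := by
      rw [← fderiv_fun_sum fun i _ => (hYu i).differentiableAt (by simp)]
      refine Filter.EventuallyEq.fderiv_eq ?_
      filter_upwards [hopen] with v hv
      exact hsum _ (hFx.mem hv)
    rw [e1, hsum _ (hFx.mem hu), map_sum, Finset.sum_add_distrib, ← Finset.mul_sum]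
    congr 2
    rw [← map_sum]
    congr 1
    ext1 a
    simp
  have hqc : ∀ i, IntegrableOn (firstVariationIntegrand f M (Y i)) T μHE[d] := fun i =>
    hM.integrableOn_compact hT hTM ((hM.continuousOn_of_isLocalParam fun V W F hF =>
      hF.continuousOn_firstVariationIntegrand hU hMU hf (hYc i)).mono hTM)
  rw [setIntegral_congr_fun hT.measurableSet hq, integral_finsetSum _ fun i _ => hqc i]
  refine Finset.sum_eq_zero fun i _ => ?_
  set T' := T ∩ tsupport (ρ i) with hT'
  have hT'c : IsCompact T' := hT.inter_right (isClosed_tsupport _)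
  have hT'M : T' ⊆ M := inter_subset_left.trans hTM
  have hT'V : T' ⊆ V (i : T) := inter_subset_right.trans (hρ i)
  have hFi := hF _ (i : T).2
  have hY0 : ∀ x ∈ M \ T', Y i x = 0 := by
    rintro x ⟨hxM, hxT'⟩
    by_cases hxT : x ∈ T
    · have : ρ i x = 0 := image_eq_zero_of_notMem_tsupport fun h => hxT' ⟨hxT, h⟩
      simp [Y, this]
    · simp [Y, h0 x ⟨hxM, hxT⟩]
  have hz : ∀ x ∈ M \ T', firstVariationIntegrand f M (Y i) x = 0 := fun x hx =>
    firstVariationIntegrand_eq_zero f hT'c.isClosed hY0 hx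
  have e2 : ∫ x in T, firstVariationIntegrand f M (Y i) x ∂μHE[d] =
      ∫ x in T', firstVariationIntegrand f M (Y i) x ∂μHE[d] :=
    setIntegral_eq_of_subset_of_forall_sdiff_eq_zero hT.measurableSet inter_subset_left
      fun x hx => hz x ⟨hTM hx.1, hx.2⟩
  have e3 : ∫ x in F (i : T) '' W (i : T), firstVariationIntegrand f M (Y i) x ∂μHE[d] =
      ∫ x in T', firstVariationIntegrand f M (Y i) x ∂μHE[d] := by
    refine setIntegral_eq_of_subset_of_forall_sdiff_eq_zero
      (hFi.isImmersionOn.measurableSet_image hFi.isOpen_source.measurableSet subset_rfl) ?_ ?_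
    · rw [hFi.image_eq]; exact subset_inter hT'M hT'V
    · rintro x ⟨⟨v, hv, rfl⟩, hx⟩
      exact hz _ ⟨hFi.mem hv, hx⟩
  rw [e2, ← e3]
  exact hFi.setIntegral_firstVariationIntegrand_eq_zero hH hU hMU hf hfn (hYc i) hT'c hT'M hT'V hY0

end FirstVariation

/-! ### Derivative of the weighted area of a family of immersions -/

section LocalFirstVariation

theorem HasStrictFDerivAt.exists_injOn_nhds {E F : Type*} [NormedAddCommGroup E] [NormedSpace ℝ E]
    [FiniteDimensional ℝ E] [NormedAddCommGroup F] [NormedSpace ℝ F] {G : E → F} {L : E →L[ℝ] F}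
    {u₀ : E} (hG : HasStrictFDerivAt G L u₀) (hL : Function.Injective L) :
    ∃ N ∈ 𝓝 u₀, InjOn G N := by
  obtain ⟨K, hK, hLK⟩ := (LinearMap.injective_iff_antilipschitz L.toLinearMap).1 hL
  have hK' : (0 : ℝ) < K := hK
  have hbd := hG.isLittleO.def (c := 1 / (2 * K)) (by positivity)
  rw [nhds_prod_eq] at hbd
  obtain ⟨N, hN, hN'⟩ := eventually_prod_self_iff
    (r := fun x y => ‖G x - G y - L (x - y)‖ ≤ 1 / (2 * K) * ‖x - y‖) |>.1 hbd
  refine ⟨N, hN, fun x hx y hy hxy => ?_⟩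
  have h1 := hN' x hx y hy
  rw [hxy, sub_self, zero_sub, norm_neg] at h1
  have h2 : ‖x - y‖ ≤ K * ‖L (x - y)‖ := by
    have := hLK.le_mul_dist x y
    rw [dist_eq_norm, dist_eq_norm] at this
    rw [map_sub]; exact this
  have h3 : K * ‖L (x - y)‖ ≤ 1 / 2 * ‖x - y‖ := by
    calc K * ‖L (x - y)‖ ≤ K * (1 / (2 * K) * ‖x - y‖) := by gcongr
      _ = _ := by field_simp
  have h4 : ‖x - y‖ ≤ 0 := by linarith
  exact sub_eq_zero.1 (norm_le_zero_iff.1 h4)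

variable {E F : Type*} [NormedAddCommGroup E] [InnerProductSpace ℝ E] [FiniteDimensional ℝ E]
  [NormedAddCommGroup F] [InnerProductSpace ℝ F] [FiniteDimensional ℝ F]
  [MeasurableSpace E] [BorelSpace E] [MeasurableSpace F] [BorelSpace F]

/-- Differentiation under the integral sign for a `C¹` integrand over a relatively compact set. -/
theorem hasDerivAt_setIntegral_of_contDiffOn {g : ℝ × E → ℝ} {N : Set (ℝ × E)} (hN : IsOpen N)
    (hg : ContDiffOn ℝ 1 g N) {C B : Set E} (hC : IsCompact C) {δ : ℝ} (hδ : 0 < δ)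
    (hCN : Metric.closedBall (0 : ℝ) δ ×ˢ C ⊆ N) (hB : MeasurableSet B) (hBC : B ⊆ C) :
    HasDerivAt (fun t => ∫ u in B, g (t, u)) (∫ u in B, fderiv ℝ g (0, u) (1, 0)) 0 := by
  have hslice : ∀ t ∈ Metric.closedBall (0 : ℝ) δ, MapsTo (fun u : E => (t, u)) C N :=
    fun t ht u hu => hCN ⟨ht, hu⟩
  have hcs : ∀ t : ℝ, Continuous fun u : E => (t, u) := fun t => by fun_prop
  have hc' : ContinuousOn (fun p : ℝ × E => fderiv ℝ g p (1, 0)) N :=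
    (hg.continuousOn_fderiv_of_isOpen hN le_rfl).clm_apply continuousOn_const
  obtain ⟨c, hc⟩ := ((isCompact_closedBall (0 : ℝ) δ).prod hC).exists_bound_of_continuousOn
    (hc'.mono hCN)
  have hint : ∀ t ∈ Metric.closedBall (0 : ℝ) δ, IntegrableOn (fun u => g (t, u)) B := fun t ht =>
    ((hg.continuousOn.comp (hcs t).continuousOn (hslice t ht)).integrableOn_compact hC).mono_set hBC
  have h0 : (0 : ℝ) ∈ Metric.closedBall (0 : ℝ) δ := Metric.mem_closedBall_self hδ.le
  refine (hasDerivAt_integral_of_dominated_loc_of_deriv_le (μ := volume.restrict B)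
    (F := fun t u => g (t, u)) (F' := fun t u => fderiv ℝ g (t, u) (1, 0)) (bound := fun _ => c)
    (Metric.closedBall_mem_nhds (0 : ℝ) hδ) ?_ (hint 0 h0) ?_ ?_ ?_ ?_).2
  · filter_upwards [Metric.closedBall_mem_nhds (0 : ℝ) hδ] with t ht
    exact (hint t ht).aestronglyMeasurable
  · exact ((hc'.comp (hcs 0).continuousOn (hslice 0 h0)).mono hBC).aestronglyMeasurable hB
  · exact (ae_restrict_iff' hB).2 (Eventually.of_forall fun u hu t ht => hc _ ⟨ht, hBC hu⟩)
  · exact (continuousOn_const.integrableOn_compact hC).mono_set hBC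
  · refine (ae_restrict_iff' hB).2 (Eventually.of_forall fun u hu t ht => ?_)
    have h1 : HasFDerivAt g (fderiv ℝ g (t, u)) (t, u) :=
      ((hg.contDiffAt (hN.mem_nhds (hCN ⟨ht, hBC hu⟩))).differentiableAt (by simp)).hasFDerivAt
    exact h1.comp_hasDerivAt t ((hasDerivAt_id t).prodMk (hasDerivAt_const t u))

/-- The first variation formula for a family `Φ (t, ·)` of immersions of a small ball. -/
theorem exists_hasDerivAt_setIntegral_image {Φ : ℝ × E → F} {O : Set (ℝ × E)} (hO : IsOpen O)
    (hΦ : ContDiffOn ℝ 2 Φ O) {u₀ : E} (hu₀ : ((0 : ℝ), u₀) ∈ O)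
    (hinj : Function.Injective (fderiv ℝ (fun v => Φ (0, v)) u₀))
    {f : F → ℝ} {U : Set F} (hU : IsOpen U) (hf : ContDiffOn ℝ 1 f U) (hΦU : Φ (0, u₀) ∈ U) :
    ∃ N ∈ 𝓝 u₀, (∀ᶠ t in 𝓝 (0 : ℝ), InjOn (fun v => Φ (t, v)) N) ∧ ∀ B ⊆ N, MeasurableSet B →
      (∀ᶠ t in 𝓝 (0 : ℝ), MeasurableSet ((fun v => Φ (t, v)) '' B) ∧
        IntegrableOn f ((fun v => Φ (t, v)) '' B) μHE[Module.finrank ℝ E]) ∧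
      HasDerivAt (fun t => ∫ x in (fun v => Φ (t, v)) '' B, f x ∂μHE[Module.finrank ℝ E])
        (∫ u in B, (fderiv ℝ (fun v => Φ (0, v)) u).normDet * (f (Φ (0, u)) *
          traceCLM E (pinv (fderiv ℝ (fun v => Φ (0, v)) u) ∘L
            fderiv ℝ (fun v => fderiv ℝ Φ (0, v) (1, 0)) u) +
          fderiv ℝ f (Φ (0, u)) (fderiv ℝ Φ (0, u) (1, 0)))) 0 := by
  set L : ℝ × E → E →L[ℝ] F := fun p => fderiv ℝ Φ p ∘L ContinuousLinearMap.inr ℝ ℝ E with hL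
  have hΦd : ∀ p ∈ O, HasFDerivAt Φ (fderiv ℝ Φ p) p := fun p hp =>
    ((hΦ.contDiffAt (hO.mem_nhds hp)).differentiableAt (by simp)).hasFDerivAt
  have hinr : ∀ (t : ℝ) (u : E), HasFDerivAt (fun v : E => (t, v)) (ContinuousLinearMap.inr ℝ ℝ E) u :=
    fun t u => hasFDerivAt_prodMk_right t u
  have hslice : ∀ p ∈ O, HasFDerivAt (fun v => Φ (p.1, v)) (L p) p.2 := fun p hp =>
    HasFDerivAt.comp p.2 (g := Φ) (f := fun v : E => (p.1, v)) (hΦd p hp) (hinr p.1 p.2)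
  have hDc : ContDiffOn ℝ 1 (fderiv ℝ Φ) O := hΦ.fderiv_of_isOpen hO (by norm_num)
  have hLc : ContDiffOn ℝ 1 L O := hDc.clm_comp contDiffOn_const
  have hL0 : Function.Injective (L (0, u₀)) := by
    rw [(hslice _ hu₀).fderiv] at hinj; exact hinj
  -- local injectivity, uniformly in the parameter
  have hstrict : HasStrictFDerivAt (fun p : ℝ × E => (p.1, Φ p))
      ((ContinuousLinearMap.fst ℝ ℝ E).prod (fderiv ℝ Φ (0, u₀))) (0, u₀) :=
    hasStrictFDerivAt_fst.prodMk ((hΦ.contDiffAt (hO.mem_nhds hu₀)).hasStrictFDerivAt (by simp))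
  obtain ⟨N₁, hN₁, hN₁i⟩ := hstrict.exists_injOn_nhds (by
    rintro ⟨s, a⟩ ⟨s', a'⟩ h
    simp only [ContinuousLinearMap.prod_apply, ContinuousLinearMap.coe_fst', Prod.mk.injEq] at h
    obtain ⟨rfl, h⟩ := h
    have h1 : fderiv ℝ Φ (0, u₀) ((s, a) - (s, a')) = 0 := by rw [map_sub, h, sub_self]
    have h2 : ((s, a) - (s, a') : ℝ × E) = ContinuousLinearMap.inr ℝ ℝ E (a - a') := by simp
    rw [h2] at h1
    have h3 : L (0, u₀) (a - a') = L (0, u₀) 0 := by rw [map_zero]; exact h1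
    rw [sub_eq_zero.1 (hL0 h3)])
  have hN₂ : ∀ᶠ p in 𝓝 ((0 : ℝ), u₀), Function.Injective (L p) :=
    (hLc.continuousOn.continuousAt (hO.mem_nhds hu₀)).eventually
      (ContinuousLinearMap.isOpen_injective.mem_nhds hL0)
  have hN₃ : ∀ᶠ p in 𝓝 ((0 : ℝ), u₀), Φ p ∈ U :=
    (hΦ.continuousOn.continuousAt (hO.mem_nhds hu₀)).eventually (hU.mem_nhds hΦU)
  obtain ⟨R, hR, hRsub⟩ := Metric.nhds_basis_ball.mem_iff.1
    (inter_mem (inter_mem hN₁ (hO.mem_nhds hu₀)) (hN₂.and hN₃))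
  have hball : ∀ t u, t ∈ Metric.ball (0 : ℝ) R → u ∈ Metric.ball u₀ R →
      (t, u) ∈ Metric.ball ((0 : ℝ), u₀) R := fun t u ht hu => by
    rw [← ball_prod_same]; exact ⟨ht, hu⟩
  have himm : ∀ t ∈ Metric.ball (0 : ℝ) R,
      IsImmersionOn (fun v => Φ (t, v)) (Metric.ball u₀ R) := by
    intro t ht
    refine ⟨Metric.isOpen_ball, ?_, ?_, ?_⟩
    · exact (hΦ.of_le (by norm_num)).comp (contDiff_prodMk_right t).contDiffOn
        fun u hu => (hRsub (hball t u ht hu)).1.2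
    · intro u hu v hv huv
      have := hN₁i (hRsub (hball t u ht hu)).1.1 (hRsub (hball t v ht hv)).1.1
        (Prod.ext rfl huv)
      exact (Prod.ext_iff.1 this).2
    · intro u hu
      rw [(hslice _ (hRsub (hball t u ht hu)).1.2).fderiv]
      exact (hRsub (hball t u ht hu)).2.1
  set g : ℝ × E → ℝ := fun p => (L p).normDet * f (Φ p) with hg
  have hgc : ContDiffOn ℝ 1 g (Metric.ball ((0 : ℝ), u₀) R) := by
    intro p hp
    have hp' := hRsub hp
    have hpO := hO.mem_nhds hp'.1.2
    exact (((contDiffAt_normDet hp'.2.1).comp p (hLc.contDiffAt hpO)).mul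
      ((hf.contDiffAt (hU.mem_nhds hp'.2.2)).comp p
        ((hΦ.contDiffAt hpO).of_le (by norm_num)))).contDiffWithinAt
  have hR2 : R / 2 < R := by linarith
  have hcb : Metric.closedBall u₀ (R / 2) ⊆ Metric.ball u₀ R := Metric.closedBall_subset_ball hR2
  refine ⟨Metric.closedBall u₀ (R / 2), Metric.closedBall_mem_nhds _ (by linarith), ?_, ?_⟩
  · filter_upwards [Metric.ball_mem_nhds (0 : ℝ) hR] with t ht
    exact (himm t ht).injOn.mono hcb
  intro B hBN hB
  have hBR : B ⊆ Metric.ball u₀ R := hBN.trans hcb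
  have hgcont : ∀ t ∈ Metric.ball (0 : ℝ) R, ContinuousOn (fun u => g (t, u)) (Metric.ball u₀ R) :=
    fun t ht => hgc.continuousOn.comp (by fun_prop) fun u hu => hball t u ht hu
  have hJ : ∀ t ∈ Metric.ball (0 : ℝ) R, EqOn (fun u => g (t, u))
      (fun u => (fderiv ℝ (fun v => Φ (t, v)) u).normDet * f (Φ (t, u))) B := by
    intro t ht u hu
    have h1 := (hslice _ (hRsub (hball t u ht (hBR hu))).1.2).fderiv
    simp only at h1
    simp only [hg, h1]
  constructor
  · filter_upwards [Metric.ball_mem_nhds (0 : ℝ) hR] with t ht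
    refine ⟨(himm t ht).measurableSet_image hB hBR, ?_⟩
    rw [(himm t ht).integrableOn_image_iff hB hBR]
    refine IntegrableOn.congr_fun ?_ (hJ t ht) hB
    exact (((hgcont t ht).mono hcb).integrableOn_compact (isCompact_closedBall _ _)).mono_set hBN
  · have hder := hasDerivAt_setIntegral_of_contDiffOn Metric.isOpen_ball hgc
      (isCompact_closedBall u₀ (R / 2)) (δ := R / 2) (by linarith) (by
        rw [← ball_prod_same]
        exact prod_mono (Metric.closedBall_subset_ball hR2) hcb) hB hBN
    have hval : ∫ u in B, fderiv ℝ g (0, u) (1, 0) =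
        (∫ u in B, (fderiv ℝ (fun v => Φ (0, v)) u).normDet * (f (Φ (0, u)) *
          traceCLM E (pinv (fderiv ℝ (fun v => Φ (0, v)) u) ∘L
            fderiv ℝ (fun v => fderiv ℝ Φ (0, v) (1, 0)) u) +
          fderiv ℝ f (Φ (0, u)) (fderiv ℝ Φ (0, u) (1, 0)))) := by
      refine setIntegral_congr_fun hB fun u hu => ?_
      have hp := hball 0 u (Metric.mem_ball_self hR) (hBR hu)
      have hp' := hRsub hp
      have hpO := hO.mem_nhds hp'.1.2
      have e1 : fderiv ℝ (fun v => Φ (0, v)) u = L (0, u) := (hslice (0, u) hp'.1.2).fderiv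
      have hD2 : HasFDerivAt (fderiv ℝ Φ) (fderiv ℝ (fderiv ℝ Φ) (0, u)) (0, u) :=
        ((hDc.contDiffAt hpO).differentiableAt (by simp)).hasFDerivAt
      have hline : HasDerivAt (fun t : ℝ => (t, u)) ((1 : ℝ), (0 : E)) 0 :=
        (hasDerivAt_id (0 : ℝ)).prodMk (hasDerivAt_const (0 : ℝ) u)
      set Λ : E →L[ℝ] F := fderiv ℝ (fderiv ℝ Φ) (0, u) (1, 0) ∘L ContinuousLinearMap.inr ℝ ℝ E
      -- the derivative of the initial velocity is the velocity of the derivative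
      have hsymm : fderiv ℝ (fun v => fderiv ℝ Φ (0, v) (1, 0)) u = Λ := by
        have h1 : HasFDerivAt (fun v => fderiv ℝ Φ (0, v))
            (fderiv ℝ (fderiv ℝ Φ) (0, u) ∘L ContinuousLinearMap.inr ℝ ℝ E) u :=
          HasFDerivAt.comp u (g := fderiv ℝ Φ) (f := fun v : E => ((0 : ℝ), v)) hD2 (hinr 0 u)
        have h2 := h1.clm_apply (hasFDerivAt_const ((1 : ℝ), (0 : E)) u)
        rw [h2.fderiv]
        ext1 a
        have h3 := (hΦ.contDiffAt hpO).isSymmSndFDerivAt (by simp) (0, a) (1, 0)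
        simpa [Λ] using h3
      have hLt : HasDerivAt (fun t : ℝ => L (t, u)) Λ 0 := by
        have h1 : HasDerivAt (fun t : ℝ => fderiv ℝ Φ (t, u))
            (fderiv ℝ (fderiv ℝ Φ) (0, u) (1, 0)) 0 :=
          HasFDerivAt.comp_hasDerivAt (0 : ℝ) (l := fderiv ℝ Φ) (f := fun t : ℝ => (t, u)) hD2 hline
        have h2 := h1.clm_comp (hasDerivAt_const (0 : ℝ) (ContinuousLinearMap.inr ℝ ℝ E))
        simpa [Λ] using h2
      have hJt := (hasFDerivAt_normDet hp'.2.1).comp_hasDerivAt (0 : ℝ) hLt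
      have hft : HasDerivAt (fun t : ℝ => f (Φ (t, u)))
          (fderiv ℝ f (Φ (0, u)) (fderiv ℝ Φ (0, u) (1, 0))) 0 :=
        HasFDerivAt.comp_hasDerivAt (0 : ℝ) (l := f) (f := fun t : ℝ => Φ (t, u))
          ((hf.contDiffAt (hU.mem_nhds hp'.2.2)).differentiableAt (by simp)).hasFDerivAt
          ((hΦd _ hp'.1.2).comp_hasDerivAt (0 : ℝ) hline)
      have hgt : HasDerivAt (fun t : ℝ => g (t, u)) (fderiv ℝ g (0, u) (1, 0)) 0 :=
        HasFDerivAt.comp_hasDerivAt (0 : ℝ) (l := g) (f := fun t : ℝ => (t, u))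
          ((hgc.contDiffAt (Metric.isOpen_ball.mem_nhds hp)).differentiableAt (by simp)).hasFDerivAt
          hline
      rw [hgt.unique (hJt.mul hft), e1, hsymm]
      simp only [smul_apply, ContinuousLinearMap.comp_apply, smul_eq_mul, Function.comp_apply,
        ContinuousLinearMap.compL_apply]
      ring
    rw [← hval]
    refine hder.congr_of_eventuallyEq ?_
    filter_upwards [Metric.ball_mem_nhds (0 : ℝ) hR] with t ht
    rw [(himm t ht).integral_image hB hBR]
    exact (setIntegral_congr_fun hB (hJ t ht)).symm

end LocalFirstVariation

/-! ### Stationarity of minimal submanifolds -/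

section Stationarity

variable {n d : ℕ} {M U K V : Set (EuclideanSpace ℝ (Fin n))} {W : Set (EuclideanSpace ℝ (Fin d))}
  {F : EuclideanSpace ℝ (Fin d) → EuclideanSpace ℝ (Fin n)} {ε : ℝ}
  {φ : ℝ → EuclideanSpace ℝ (Fin n) → EuclideanSpace ℝ (Fin n)}

namespace IsDeformation

theorem contDiffOn_comp (hφ : IsDeformation M U ε K φ) (hF : IsLocalParam M V W F) :
    ContDiffOn ℝ 2 (fun p : ℝ × EuclideanSpace ℝ (Fin d) => φ p.1 (F p.2)) (Ioo (-ε) ε ×ˢ W) :=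
  hφ.contDiffOn.comp (contDiffOn_fst.prodMk (hF.contDiffOn.comp contDiffOn_snd fun _ hp => hp.2))
    fun _ hp => ⟨hp.1, hF.mem hp.2⟩

theorem zero_mem (hφ : IsDeformation M U ε K φ) : (0 : ℝ) ∈ Ioo (-ε) ε :=
  ⟨by linarith [hφ.pos], hφ.pos⟩

theorem deriv_eq (hφ : IsDeformation M U ε K φ) (hF : IsLocalParam M V W F)
    {u : EuclideanSpace ℝ (Fin d)} (hu : u ∈ W) :
    deriv (fun t => φ t (F u)) 0 =
      fderiv ℝ (fun p : ℝ × EuclideanSpace ℝ (Fin d) => φ p.1 (F p.2)) (0, u) (1, 0) := by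
  have hopen : Ioo (-ε) ε ×ˢ W ∈ 𝓝 ((0 : ℝ), u) :=
    (isOpen_Ioo.prod hF.isOpen_source).mem_nhds ⟨hφ.zero_mem, hu⟩
  have h1 := (((hφ.contDiffOn_comp hF).contDiffAt hopen).differentiableAt (by simp)).hasFDerivAt
  have hline : HasDerivAt (fun t : ℝ => (t, u)) ((1 : ℝ), (0 : EuclideanSpace ℝ (Fin d))) 0 :=
    (hasDerivAt_id (0 : ℝ)).prodMk (hasDerivAt_const (0 : ℝ) u)
  exact (HasFDerivAt.comp_hasDerivAt (0 : ℝ)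
    (l := fun p : ℝ × EuclideanSpace ℝ (Fin d) => φ p.1 (F p.2)) (f := fun t : ℝ => (t, u))
    h1 hline).deriv

/-- The initial velocity of a deformation is a `C¹` vector field along the submanifold. -/
theorem contDiffOn_velocity (hφ : IsDeformation M U ε K φ) (hM : IsC2Submanifold d M) :
    ContDiffOn ℝ 1 (fun x => deriv (fun t => φ t x) 0) M := by
  refine hM.contDiffOn_of_isLocalParam fun V W F hF => ?_
  have hopen := isOpen_Ioo.prod (s := Ioo (-ε) ε) hF.isOpen_source
  have h1 := (hφ.contDiffOn_comp hF).fderiv_of_isOpen hopen (m := 1) (by norm_num)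
  have h2 : ContDiffOn ℝ 1 (fun u => fderiv ℝ
      (fun p : ℝ × EuclideanSpace ℝ (Fin d) => φ p.1 (F p.2)) (0, u) (1, 0)) W :=
    (h1.comp (contDiff_prodMk_right (0 : ℝ)).contDiffOn
      fun u hu => ⟨hφ.zero_mem, hu⟩).clm_apply contDiffOn_const
  exact h2.congr fun u hu => hφ.deriv_eq hF hu

theorem velocity_eq_zero (hφ : IsDeformation M U ε K φ) {x : EuclideanSpace ℝ (Fin n)}
    (hx : x ∈ M \ K) : deriv (fun t => φ t x) 0 = 0 := by
  have h1 : (fun t => φ t x) =ᶠ[𝓝 0] fun _ => x := by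
    filter_upwards [isOpen_Ioo.mem_nhds hφ.zero_mem] with t ht
    exact hφ.fixed t ht x hx
  rw [h1.deriv_eq, deriv_const]

/-- The local first variation formula, in a parametrization. -/
theorem exists_hasDerivAt_nhds (hφ : IsDeformation M U ε K φ) (hF : IsLocalParam M V W F)
    (hM : IsC2Submanifold d M) (hU : IsOpen U) (hMU : M ⊆ U)
    {f : EuclideanSpace ℝ (Fin n) → ℝ} (hf : ContDiffOn ℝ 1 f U)
    {u : EuclideanSpace ℝ (Fin d)} (hu : u ∈ W) :
    ∃ s ∈ 𝓝[M] (F u), MeasurableSet s ∧ (∀ᶠ t in 𝓝 (0 : ℝ), InjOn (φ t) s) ∧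
      ∀ A ⊆ s, MeasurableSet A →
        (∀ᶠ t in 𝓝 (0 : ℝ), MeasurableSet (φ t '' A) ∧ IntegrableOn f (φ t '' A) μHE[d]) ∧
        IntegrableOn (firstVariationIntegrand f M (fun x => deriv (fun t => φ t x) 0)) A μHE[d] ∧
        HasDerivAt (fun t => ∫ x in φ t '' A, f x ∂μHE[d])
          (∫ x in A, firstVariationIntegrand f M (fun x => deriv (fun t => φ t x) 0) x ∂μHE[d])
          0 := by
  set Φ := fun p : ℝ × EuclideanSpace ℝ (Fin d) => φ p.1 (F p.2) with hΦ
  set X := fun x => deriv (fun t => φ t x) 0 with hX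
  have hXc := hφ.contDiffOn_velocity hM
  have hΦ0 : EqOn (fun v => Φ (0, v)) F W := fun v hv => hφ.at_zero _ (hF.mem hv)
  have hΦ0' : ∀ v ∈ W, fderiv ℝ (fun v => Φ (0, v)) v = fderiv ℝ F v := fun v hv =>
    (hΦ0.eventuallyEq_of_mem (hF.isOpen_source.mem_nhds hv)).fderiv_eq
  obtain ⟨N, hN, hNi, hNd⟩ := exists_hasDerivAt_setIntegral_image
    (isOpen_Ioo.prod hF.isOpen_source) (hφ.contDiffOn_comp hF) (u₀ := u) ⟨hφ.zero_mem, hu⟩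
    (by
      have := hF.injective u hu
      rw [← hΦ0' u hu] at this
      exact this) hU hf
    (by
      have : φ 0 (F u) = F u := hφ.at_zero _ (hF.mem hu)
      simp only [this]
      exact hMU (hF.mem hu))
  obtain ⟨r, hr, hrs⟩ := Metric.nhds_basis_closedBall.mem_iff.1
    (inter_mem hN (hF.isOpen_source.mem_nhds hu))
  set C := Metric.closedBall u r
  have hCW : C ⊆ W := hrs.trans inter_subset_right
  have hCm : MeasurableSet C := Metric.isClosed_closedBall.measurableSet
  refine ⟨F '' C, ?_, hF.isImmersionOn.measurableSet_image hCm hCW, ?_, ?_⟩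
  · rw [← hF.map_nhds hu]
    exact image_mem_map (Metric.closedBall_mem_nhds u hr)
  · filter_upwards [hNi] with t ht
    rintro _ ⟨v, hv, rfl⟩ _ ⟨w, hw, rfl⟩ h
    rw [ht (hrs hv).1 (hrs hw).1 h]
  · intro A hA hAm
    set B := C ∩ F ⁻¹' A with hB
    have hBm : MeasurableSet B := by
      have h1 := (hF.isImmersionOn.measurableEmbedding hCm hCW).measurable hAm
      have h2 := (MeasurableEmbedding.subtype_coe hCm).measurableSet_image.2 h1
      convert h2 using 1
      ext v; simp [hB, and_comm]
    have hBC : B ⊆ C := inter_subset_left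
    have hAB : F '' B = A := by rw [hB, image_inter_preimage, inter_eq_right.2 hA]
    have himg : ∀ t, φ t '' A = (fun v => Φ (t, v)) '' B := fun t => by
      rw [← hAB, image_image]
    obtain ⟨h1, h2⟩ := hNd B (fun v hv => (hrs (hBC hv)).1) hBm
    rw [finrank_euclideanSpace_fin] at h1 h2
    simp_rw [himg]
    refine ⟨h1, ?_, ?_⟩
    · rw [← hAB]
      have h3 := hF.isImmersionOn.integrableOn_image_iff hBm (hBC.trans hCW)
        (firstVariationIntegrand f M X)
      rw [finrank_euclideanSpace_fin] at h3
      rw [h3]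
      have h4 : ContinuousOn (fun v => (fderiv ℝ F v).normDet *
          firstVariationIntegrand f M X (F v)) W :=
        hF.isImmersionOn.continuousOn_normDet.mul
          (hF.continuousOn_firstVariationIntegrand hU hMU hf hXc)
      exact ((h4.mono hCW).integrableOn_compact (isCompact_closedBall u r)).mono_set hBC
    · have h3 := hF.isImmersionOn.integral_image hBm (hBC.trans hCW)
        (firstVariationIntegrand f M X)
      rw [finrank_euclideanSpace_fin, hAB] at h3
      rw [h3]
      refine h2.congr_deriv (setIntegral_congr_fun hBm fun v hv => ?_)
      have hvW := hCW (hBC hv)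
      have hnhds := hF.isOpen_source.mem_nhds hvW
      have hyv := ((hF.contDiffOn_comp (by norm_num) hXc).contDiffAt hnhds)
      refine Eq.trans ?_ (congrArg _ (hF.firstVariationIntegrand_eq hvW f hyv).symm)
      have e1 : (fun v => fderiv ℝ Φ (0, v) (1, 0)) =ᶠ[𝓝 v] fun v => X (F v) := by
        filter_upwards [hnhds] with w hw
        exact (hφ.deriv_eq hF hw).symm
      have e2 : φ 0 (F v) = F v := hΦ0 hvW
      simp only
      rw [hΦ0' v hvW, e1.fderiv_eq, e1.eq_of_nhds, e2]

/-- For small `t` the deformation is injective on a compact set `T`: near a point of the diagonal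
of `T × T` by the local injectivity of immersions, near any other point by continuity, and `T × T` is
compact. -/
theorem eventually_injOn (hφ : IsDeformation M U ε K φ) (hM : IsC2Submanifold d M) (hU : IsOpen U)
    (hMU : M ⊆ U) {T : Set (EuclideanSpace ℝ (Fin n))} (hT : IsCompact T) (hTM : T ⊆ M) :
    ∀ᶠ t in 𝓝 (0 : ℝ), InjOn (φ t) T := by
  have key : ∀ᶠ t in 𝓝 (0 : ℝ), ∀ p ∈ T ×ˢ T, p.1 ∈ T → p.2 ∈ T →
      φ t p.1 = φ t p.2 → p.1 = p.2 := by
    refine (hT.prod hT).eventually_forall_of_forall_eventually ?_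
    rintro ⟨x, y⟩ ⟨hx, hy⟩
    simp only at hx hy
    by_cases hxy : x = y
    · subst hxy
      obtain ⟨V, W, F, hxV, hF⟩ := hM.exists_isLocalParam (hTM hx)
      obtain ⟨u, hu, rfl⟩ := hF.exists_eq (hTM hx) hxV
      obtain ⟨s, hs, -, hsi, -⟩ := hφ.exists_hasDerivAt_nhds hF hM hU hMU
        (contDiffOn_const (c := (0 : ℝ))) hu
      obtain ⟨O, hO, hOs⟩ := mem_nhdsWithin_iff_exists_mem_nhds_inter.1 hs
      rw [nhds_prod_eq, nhds_prod_eq]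
      filter_upwards [hsi.prod_mk (prod_mem_prod hO hO)] with z hz h1 h2 h3
      exact hz.1 (hOs ⟨hz.2.1, hTM h1⟩) (hOs ⟨hz.2.2, hTM h2⟩) h3
    · have hc : ∀ z ∈ T, ContinuousWithinAt (fun p : ℝ × EuclideanSpace ℝ (Fin n) => φ p.1 p.2)
          (Ioo (-ε) ε ×ˢ M) (0, z) := fun z hz =>
        hφ.contDiffOn.continuousOn _ ⟨hφ.zero_mem, hTM hz⟩
      obtain ⟨Ox, Oy, hOx, hOy, hxO, hyO, hdisj⟩ := t2_separation hxy
      have h1 := (hc x hx).preimage_mem_nhdsWithin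
        (hOx.mem_nhds (by simpa only [hφ.at_zero x (hTM hx)] using hxO))
      have h2 := (hc y hy).preimage_mem_nhdsWithin
        (hOy.mem_nhds (by simpa only [hφ.at_zero y (hTM hy)] using hyO))
      rw [mem_nhdsWithin_iff_eventually] at h1 h2
      have t1 : Tendsto (fun z : ℝ × EuclideanSpace ℝ (Fin n) × EuclideanSpace ℝ (Fin n) =>
          (z.1, z.2.1)) (𝓝 (0, x, y)) (𝓝 (0, x)) :=
        Continuous.tendsto (by fun_prop) ((0 : ℝ), x, y)
      have t2 : Tendsto (fun z : ℝ × EuclideanSpace ℝ (Fin n) × EuclideanSpace ℝ (Fin n) =>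
          (z.1, z.2.2)) (𝓝 (0, x, y)) (𝓝 (0, y)) :=
        Continuous.tendsto (by fun_prop) ((0 : ℝ), x, y)
      have t0 : Tendsto (fun z : ℝ × EuclideanSpace ℝ (Fin n) × EuclideanSpace ℝ (Fin n) =>
          z.1) (𝓝 (0, x, y)) (𝓝 0) :=
        Continuous.tendsto (by fun_prop) ((0 : ℝ), x, y)
      filter_upwards [t1.eventually h1, t2.eventually h2,
        t0.eventually (isOpen_Ioo.mem_nhds hφ.zero_mem)] with z hz1 hz2 hz0 hzx hzy hz
      exfalso
      have m1 := hz1 ⟨hz0, hTM hzx⟩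
      have m2 := hz2 ⟨hz0, hTM hzy⟩
      simp only [mem_preimage] at m1 m2
      rw [hz] at m1
      exact hdisj.le_bot ⟨m1, m2⟩
  filter_upwards [key] with t ht x hx y hy hxy
  exact ht (x, y) ⟨hx, hy⟩ hx hy hxy

/-- The first variation formula on a compact set, obtained from the local one by adding disjoint
pieces, whose images stay disjoint for small `t`. -/
theorem hasDerivAt_setIntegral_image (hφ : IsDeformation M U ε K φ) (hM : IsC2Submanifold d M)
    (hU : IsOpen U) (hMU : M ⊆ U) {f : EuclideanSpace ℝ (Fin n) → ℝ} (hf : ContDiffOn ℝ 1 f U)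
    {T : Set (EuclideanSpace ℝ (Fin n))} (hT : IsCompact T) (hTM : T ⊆ M) :
    HasDerivAt (fun t => ∫ x in φ t '' T, f x ∂μHE[d])
      (∫ x in T, firstVariationIntegrand f M (fun x => deriv (fun t => φ t x) 0) x ∂μHE[d]) 0 := by
  have hinj := hφ.eventually_injOn hM hU hMU hT hTM
  set q := firstVariationIntegrand f M (fun x => deriv (fun t => φ t x) 0)
  let P : Set (EuclideanSpace ℝ (Fin n)) → Prop := fun s => ∃ s', s ⊆ s' ∧ MeasurableSet s' ∧
    ∀ A ⊆ s' ∩ T, MeasurableSet A →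
      (∀ᶠ t in 𝓝 (0 : ℝ), MeasurableSet (φ t '' A) ∧ IntegrableOn f (φ t '' A) μHE[d]) ∧
      IntegrableOn (q) A μHE[d] ∧
      HasDerivAt (fun t => ∫ x in φ t '' A, f x ∂μHE[d])
        (∫ x in A, q x ∂μHE[d]) 0
  have hP : P T := by
    refine hT.induction_on (p := P) ?_ ?_ ?_ ?_
    · refine ⟨∅, subset_rfl, MeasurableSet.empty, fun A hA _ => ?_⟩
      rw [empty_inter, subset_empty_iff] at hA
      subst hA
      simp [hasDerivAt_const]
    · rintro s t hst ⟨s', h1, h2⟩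
      exact ⟨s', hst.trans h1, h2⟩
    · rintro s t ⟨s', hs, hs'm, hs'⟩ ⟨t', ht, ht'm, ht'⟩
      refine ⟨s' ∪ t', union_subset_union hs ht, hs'm.union ht'm, fun A hA hAm => ?_⟩
      have hA1 : A ∩ s' ⊆ s' ∩ T := fun x hx => ⟨hx.2, (hA hx.1).2⟩
      have hA2 : A \ s' ⊆ t' ∩ T := fun x hx => ⟨(hA hx.1).1.resolve_left hx.2, (hA hx.1).2⟩
      obtain ⟨a1, a2, a3⟩ := hs' _ hA1 (hAm.inter hs'm)
      obtain ⟨b1, b2, b3⟩ := ht' _ hA2 (hAm.diff hs'm)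
      have hAu : A ∩ s' ∪ A \ s' = A := inter_union_sdiff A s'
      have hdisj : Disjoint (A ∩ s') (A \ s') := disjoint_sdiff_inter.symm
      have himg : ∀ t, φ t '' A = φ t '' (A ∩ s') ∪ φ t '' (A \ s') := fun t => by
        rw [← image_union, hAu]
      refine ⟨?_, ?_, ?_⟩
      · filter_upwards [a1, b1] with t ht1 ht2
        rw [himg]
        exact ⟨ht1.1.union ht2.1, ht1.2.union ht2.2⟩
      · rw [← hAu]; exact a2.union b2
      · have e1 : ∫ x in A, q x ∂μHE[d] =
            (∫ x in A ∩ s', q x ∂μHE[d]) + ∫ x in A \ s', q x ∂μHE[d] := by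
          conv_lhs => rw [← hAu]
          exact setIntegral_union hdisj (hAm.diff hs'm) a2 b2
        rw [e1]
        refine (a3.add b3).congr_of_eventuallyEq ?_
        filter_upwards [a1, b1, hinj] with t ht1 ht2 hti
        rw [himg]
        refine setIntegral_union ?_ ht2.1 ht1.2 ht2.2
        rw [disjoint_iff_inter_eq_empty, ← hti.image_inter (hA1.trans inter_subset_right)
          (hA2.trans inter_subset_right), hdisj.inter_eq, image_empty]
    · intro x hx
      obtain ⟨V, W, F, hxV, hF⟩ := hM.exists_isLocalParam (hTM hx)
      obtain ⟨u, hu, rfl⟩ := hF.exists_eq (hTM hx) hxV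
      obtain ⟨s, hs, hsm, -, hsd⟩ := hφ.exists_hasDerivAt_nhds hF hM hU hMU hf hu
      exact ⟨s, nhdsWithin_mono _ hTM hs, s, subset_rfl, hsm,
        fun A hA hAm => hsd A (hA.trans inter_subset_left) hAm⟩
  obtain ⟨s', hs', -, h⟩ := hP
  exact (h T (subset_inter hs' subset_rfl) hT.measurableSet).2.2

end IsDeformation

/-- A minimal submanifold is `f`-stationary when the gradient of `f` is tangent to it. -/
theorem IsC2Submanifold.isFStationary (hM : IsC2Submanifold d M) (hU : IsOpen U) (hMU : M ⊆ U)
    (hcl : ∀ K ⊆ U, IsCompact K → IsCompact (M ∩ K))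
    (hH : ∀ x ∈ M, meanCurvature M x = 0) {f : EuclideanSpace ℝ (Fin n) → ℝ}
    (hf : ContDiffOn ℝ 1 f U)
    (hfn : ∀ x ∈ M, ∀ ξ ∈ normalSubspace M x, fderiv ℝ f x ξ = 0) :
    IsFStationary f d M U := by
  intro ε K φ hφ
  have hT := hcl K hφ.subset hφ.isCompact
  have h1 := hφ.hasDerivAt_setIntegral_image hM hU hMU hf hT inter_subset_left
  rw [hM.setIntegral_firstVariationIntegrand_eq_zero hH hU hMU hf hfn
    (hφ.contDiffOn_velocity hM) hT inter_subset_left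
    (fun x hx => hφ.velocity_eq_zero ⟨hx.1, fun h => hx.2 ⟨hx.1, h⟩⟩)] at h1
  exact h1

end Stationarity

/-! ### Parametrizations of a cone -/

section ConeChart

/-- An isometric splitting of `ℝ^{m+1}` into a radial coordinate in `ℝ` and a coordinate in `ℝᵐ`. -/
def radialSplitting (m : ℕ) :
    EuclideanSpace ℝ (Fin (m + 1)) ≃ₗᵢ[ℝ] WithLp 2 (ℝ × EuclideanSpace ℝ (Fin m)) :=
  ((stdOrthonormalBasis ℝ (WithLp 2 (ℝ × EuclideanSpace ℝ (Fin m)))).reindex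
    (finCongr (by
      rw [(WithLp.linearEquiv 2 ℝ (ℝ × EuclideanSpace ℝ (Fin m))).finrank_eq]
      simp [add_comm]))).repr.symm

/-- The splitting of `ℝ^{m+1}` as a continuous linear equivalence with the product. -/
def radialEquiv (m : ℕ) : EuclideanSpace ℝ (Fin (m + 1)) ≃L[ℝ] ℝ × EuclideanSpace ℝ (Fin m) :=
  (radialSplitting m).toContinuousLinearEquiv.trans (WithLp.prodContinuousLinearEquiv 2 ℝ _ _)

theorem inner_eq_radialEquiv {m : ℕ} (y z : EuclideanSpace ℝ (Fin (m + 1))) :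
    inner ℝ y z = (radialEquiv m y).1 * (radialEquiv m z).1 +
      inner ℝ (radialEquiv m y).2 (radialEquiv m z).2 := by
  rw [← (radialSplitting m).inner_map_map, WithLp.prod_inner_apply]
  simp [radialEquiv, mul_comm]

theorem measurePreserving_radialEquiv (m : ℕ) :
    MeasurePreserving (radialEquiv m) volume (volume.prod volume) :=
  (WithLp.volume_preserving_ofLp ℝ (EuclideanSpace ℝ (Fin m))).comp
    (radialSplitting m).measurePreserving

variable {n m : ℕ} {S V : Set (EuclideanSpace ℝ (Fin n))} {W : Set (EuclideanSpace ℝ (Fin m))}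
  {F : EuclideanSpace ℝ (Fin m) → EuclideanSpace ℝ (Fin n)}

/-- The parametrization `(t, u) ↦ t F(u)` of the cone over the image of `F`. -/
def coneParam (F : EuclideanSpace ℝ (Fin m) → EuclideanSpace ℝ (Fin n))
    (y : EuclideanSpace ℝ (Fin (m + 1))) : EuclideanSpace ℝ (Fin n) :=
  (radialEquiv m y).1 • F (radialEquiv m y).2

/-- The domain `(0, ∞) × W` of `coneParam`. -/
def coneDomain (W : Set (EuclideanSpace ℝ (Fin m))) : Set (EuclideanSpace ℝ (Fin (m + 1))) :=
  radialEquiv m ⁻¹' (Ioi 0 ×ˢ W)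

/-- The cone of the points of `ℝⁿ \ {0}` whose direction `x / |x|` is in `V`. -/
def directionCone (V : Set (EuclideanSpace ℝ (Fin n))) : Set (EuclideanSpace ℝ (Fin n)) :=
  {x | x ≠ 0 ∧ ‖x‖⁻¹ • x ∈ V}

theorem isOpen_directionCone (hV : IsOpen V) : IsOpen (directionCone V) := by
  have h : ContinuousOn (fun x : EuclideanSpace ℝ (Fin n) => ‖x‖⁻¹ • x) {0}ᶜ :=
    (continuous_norm.continuousOn.inv₀ fun x hx => norm_ne_zero_iff.2 hx).smul continuousOn_id
  exact h.isOpen_inter_preimage isOpen_compl_singleton hV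

theorem isOpen_coneDomain (hW : IsOpen W) : IsOpen (coneDomain W) :=
  (isOpen_Ioi.prod hW).preimage (radialEquiv m).continuous

theorem mem_coneOver_diff (hS : S ⊆ Metric.sphere 0 1) {y : EuclideanSpace ℝ (Fin n)} :
    y ∈ coneOver S \ {0} ↔ y ≠ 0 ∧ ‖y‖⁻¹ • y ∈ S := by
  constructor
  · rintro ⟨⟨t, ht, x, hx, rfl⟩, h0⟩
    have h0' : t • x ≠ 0 := h0
    have htp : 0 < t := lt_of_le_of_ne ht fun h => h0' (by rw [← h, zero_smul])
    have hx1 : ‖x‖ = 1 := by simpa using hS hx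
    refine ⟨h0', ?_⟩
    rw [norm_smul, hx1, mul_one, Real.norm_of_nonneg ht, smul_smul, inv_mul_cancel₀ htp.ne',
      one_smul]
    exact hx
  · rintro ⟨h0, h1⟩
    refine ⟨⟨‖y‖, norm_nonneg y, _, h1, ?_⟩, h0⟩
    rw [smul_smul, mul_inv_cancel₀ (norm_ne_zero_iff.2 h0), one_smul]

theorem smul_mem_coneOver_diff (hS : S ⊆ Metric.sphere 0 1) {x : EuclideanSpace ℝ (Fin n)}
    (hx : x ∈ S) {t : ℝ} (ht : 0 < t) : t • x ∈ coneOver S \ {0} := by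
  have hx1 : ‖x‖ = 1 := by simpa using hS hx
  refine ⟨⟨t, ht.le, x, hx, rfl⟩, ?_⟩
  rw [mem_singleton_iff, smul_eq_zero, not_or]
  exact ⟨ht.ne', fun h => by simp [h] at hx1⟩

theorem isCompact_coneOver_inter (hS : S ⊆ Metric.sphere 0 1) (hSc : IsCompact S)
    {K : Set (EuclideanSpace ℝ (Fin n))} (hK : IsCompact K) (hK0 : K ⊆ {0}ᶜ) :
    IsCompact ((coneOver S \ {0}) ∩ K) := by
  have h : ContinuousOn (fun x : EuclideanSpace ℝ (Fin n) => ‖x‖⁻¹ • x) K :=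
    (continuous_norm.continuousOn.inv₀ fun x hx => norm_ne_zero_iff.2 (hK0 hx)).smul continuousOn_id
  have h2 := h.preimage_isClosed_of_isClosed hK.isClosed hSc.isClosed
  have h3 : (coneOver S \ {0}) ∩ K = K ∩ (fun x => ‖x‖⁻¹ • x) ⁻¹' S := by
    ext y
    rw [mem_inter_iff, mem_inter_iff, mem_coneOver_diff hS, mem_preimage]
    exact ⟨fun ⟨⟨_, h2⟩, h1⟩ => ⟨h1, h2⟩, fun ⟨h1, h2⟩ => ⟨⟨hK0 h1, h2⟩, h1⟩⟩
  rw [h3]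
  exact hK.of_isClosed_subset h2 inter_subset_left

theorem compl_inter_closure_coneOver (hS : S ⊆ Metric.sphere 0 1) (hSc : IsCompact S) :
    ({0}ᶜ : Set (EuclideanSpace ℝ (Fin n))) ∩
      (closure (coneOver S \ {0}) \ (coneOver S \ {0})) = ∅ := by
  rw [eq_empty_iff_forall_notMem]
  rintro y ⟨hy0, hy, hyM⟩
  refine hyM ((mem_coneOver_diff hS).2 ⟨hy0, ?_⟩)
  have h : ContinuousAt (fun x : EuclideanSpace ℝ (Fin n) => ‖x‖⁻¹ • x) y :=
    (continuous_norm.continuousAt.inv₀ (norm_ne_zero_iff.2 hy0)).smul continuousAt_id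
  exact hSc.isClosed.closure_subset (h.continuousWithinAt.mem_closure hy
    fun x hx => ((mem_coneOver_diff hS).1 hx).2)

theorem measurableSet_coneOver_diff (hS : S ⊆ Metric.sphere 0 1) (hSc : IsCompact S) :
    MeasurableSet (coneOver S \ {0}) := by
  have h : coneOver S \ {0} = {0}ᶜ ∩ (fun x : EuclideanSpace ℝ (Fin n) => ‖x‖⁻¹ • x) ⁻¹' S := by
    ext y
    exact mem_coneOver_diff hS
  rw [h]
  have h2 : Measurable (fun x : EuclideanSpace ℝ (Fin n) => ‖x‖⁻¹ • x) := by fun_prop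
  exact (measurableSet_singleton 0).compl.inter (h2 hSc.isClosed.measurableSet)

namespace IsLocalParam

theorem norm_eq_one (hF : IsLocalParam S V W F) (hS : S ⊆ Metric.sphere 0 1)
    {u : EuclideanSpace ℝ (Fin m)} (hu : u ∈ W) : ‖F u‖ = 1 := by
  simpa using hS (hF.mem hu)

theorem inner_self_fderiv (hF : IsLocalParam S V W F) (hS : S ⊆ Metric.sphere 0 1)
    {u : EuclideanSpace ℝ (Fin m)} (hu : u ∈ W) (a : EuclideanSpace ℝ (Fin m)) :
    inner ℝ (F u) (fderiv ℝ F u a) = 0 := by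
  have h1 := (hF.hasFDerivAt hu).norm_sq
  have h2 : (fun v => ‖F v‖ ^ 2) =ᶠ[𝓝 u] fun _ => 1 := by
    filter_upwards [hF.isOpen_source.mem_nhds hu] with v hv
    rw [hF.norm_eq_one hS hv, one_pow]
  have h3 := congrArg (fun A => A a) (h1.unique ((hasFDerivAt_const (1 : ℝ) u).congr_of_eventuallyEq h2))
  simpa using h3

theorem contDiffOn_coneParam (hF : IsLocalParam S V W F) :
    ContDiffOn ℝ 2 (coneParam F) (coneDomain W) := by
  have h1 : ContDiff ℝ 2 fun y => (radialEquiv m y).1 := contDiff_fst.comp (radialEquiv m).contDiff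
  have h2 : ContDiff ℝ 2 fun y => (radialEquiv m y).2 := contDiff_snd.comp (radialEquiv m).contDiff
  exact h1.contDiffOn.smul (hF.contDiffOn.comp h2.contDiffOn fun y hy => hy.2)

theorem hasFDerivAt_coneParam (hF : IsLocalParam S V W F) {y : EuclideanSpace ℝ (Fin (m + 1))}
    (hy : y ∈ coneDomain W) :
    HasFDerivAt (coneParam F) ((radialEquiv m y).1 • (fderiv ℝ F (radialEquiv m y).2 ∘L
      (ContinuousLinearMap.snd ℝ ℝ (EuclideanSpace ℝ (Fin m)) ∘L (radialEquiv m).toContinuousLinearMap)) +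
      (ContinuousLinearMap.fst ℝ ℝ (EuclideanSpace ℝ (Fin m)) ∘L (radialEquiv m).toContinuousLinearMap).smulRight
        (F (radialEquiv m y).2)) y := by
  have h1 : HasFDerivAt (fun y => (radialEquiv m y).1)
      (ContinuousLinearMap.fst ℝ ℝ (EuclideanSpace ℝ (Fin m)) ∘L (radialEquiv m).toContinuousLinearMap) y :=
    (ContinuousLinearMap.fst ℝ ℝ (EuclideanSpace ℝ (Fin m)) ∘L (radialEquiv m).toContinuousLinearMap).hasFDerivAt
  have h2 : HasFDerivAt (fun y => (radialEquiv m y).2)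
      (ContinuousLinearMap.snd ℝ ℝ (EuclideanSpace ℝ (Fin m)) ∘L (radialEquiv m).toContinuousLinearMap) y :=
    (ContinuousLinearMap.snd ℝ ℝ (EuclideanSpace ℝ (Fin m)) ∘L (radialEquiv m).toContinuousLinearMap).hasFDerivAt
  have h3 := HasFDerivAt.comp y (g := F) (f := fun y => (radialEquiv m y).2) (hF.hasFDerivAt hy.2) h2
  exact h1.smul h3

theorem fderiv_coneParam (hF : IsLocalParam S V W F) {y : EuclideanSpace ℝ (Fin (m + 1))}
    (hy : y ∈ coneDomain W) (p : EuclideanSpace ℝ (Fin (m + 1))) :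
    fderiv ℝ (coneParam F) y p = (radialEquiv m y).1 • fderiv ℝ F (radialEquiv m y).2
      (radialEquiv m p).2 + (radialEquiv m p).1 • F (radialEquiv m y).2 := by
  rw [(hF.hasFDerivAt_coneParam hy).fderiv]
  rfl

/-- The metric of the cone is `dt² + t² g`, where `g` is the metric of the link. -/
theorem inner_fderiv_coneParam (hF : IsLocalParam S V W F) (hS : S ⊆ Metric.sphere 0 1)
    {y : EuclideanSpace ℝ (Fin (m + 1))} (hy : y ∈ coneDomain W)
    (p q : EuclideanSpace ℝ (Fin (m + 1))) :
    inner ℝ (fderiv ℝ (coneParam F) y p) (fderiv ℝ (coneParam F) y q) =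
      (radialEquiv m p).1 * (radialEquiv m q).1 + (radialEquiv m y).1 ^ 2 *
        inner ℝ (fderiv ℝ F (radialEquiv m y).2 (radialEquiv m p).2)
          (fderiv ℝ F (radialEquiv m y).2 (radialEquiv m q).2) := by
  have h0 := hF.inner_self_fderiv hS hy.2
  have h1 : inner ℝ (F (radialEquiv m y).2) (F (radialEquiv m y).2) = (1 : ℝ) := by
    rw [real_inner_self_eq_norm_sq, hF.norm_eq_one hS hy.2, one_pow]
  rw [hF.fderiv_coneParam hy, hF.fderiv_coneParam hy]
  simp only [inner_add_left, inner_add_right, real_inner_smul_left, real_inner_smul_right, h0, h1,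
    real_inner_comm (F (radialEquiv m y).2) (fderiv ℝ F (radialEquiv m y).2 _)]
  ring

theorem injective_fderiv_coneParam (hF : IsLocalParam S V W F) (hS : S ⊆ Metric.sphere 0 1)
    {y : EuclideanSpace ℝ (Fin (m + 1))} (hy : y ∈ coneDomain W) :
    Function.Injective (fderiv ℝ (coneParam F) y) := by
  rw [injective_iff_map_eq_zero]
  intro p hp
  have h1 := hF.inner_fderiv_coneParam hS hy p p
  rw [hp, inner_zero_left, real_inner_self_eq_norm_sq] at h1
  have ht : 0 < (radialEquiv m y).1 := hy.1
  have h2 : (radialEquiv m p).1 = 0 := by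
    by_contra hne
    have := mul_self_pos.2 hne
    have h3 : 0 ≤ (radialEquiv m y).1 ^ 2 * ‖fderiv ℝ F (radialEquiv m y).2 (radialEquiv m p).2‖ ^ 2 := by
      positivity
    linarith
  have h4 : fderiv ℝ F (radialEquiv m y).2 (radialEquiv m p).2 = 0 := by
    rw [h2] at h1
    have h5 : (radialEquiv m y).1 ^ 2 ≠ 0 := by positivity
    have h6 : ‖fderiv ℝ F (radialEquiv m y).2 (radialEquiv m p).2‖ ^ 2 = 0 := by
      by_contra hne
      exact mul_ne_zero h5 hne (by linarith)
    simpa using h6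
  have h5 : (radialEquiv m p).2 = 0 :=
    hF.injective _ hy.2 (by rw [h4, map_zero])
  exact (radialEquiv m).injective (by rw [map_zero]; exact Prod.ext h2 h5)

/-- The cone over the image of a parametrization is parametrized by `(t, u) ↦ t F(u)`; it is a
homeomorphism to its image because `t` and `F(u)` are recovered as the norm and the direction. -/
theorem isLocalParam_coneParam (hF : IsLocalParam S V W F) (hS : S ⊆ Metric.sphere 0 1) :
    IsLocalParam (coneOver S \ {0}) (directionCone V) (coneDomain W) (coneParam F) where
  isOpen_target := isOpen_directionCone hF.isOpen_target
  isOpen_source := isOpen_coneDomain hF.isOpen_source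
  contDiffOn := hF.contDiffOn_coneParam
  injective := fun y hy => hF.injective_fderiv_coneParam hS hy
  isEmbedding := by
    have hne : ∀ y ∈ coneDomain W, coneParam F y ≠ 0 := fun y hy =>
      (smul_mem_coneOver_diff hS (hF.mem hy.2) hy.1).2
    have hcont : Continuous ((coneDomain W).domRestrict (coneParam F)) :=
      hF.contDiffOn_coneParam.continuousOn.domRestrict
    let f : coneDomain W → {x : EuclideanSpace ℝ (Fin n) // x ≠ 0} := fun y =>
      ⟨coneParam F y, hne y y.2⟩
    have hf : Continuous f := hcont.subtype_mk _
    let g : {x : EuclideanSpace ℝ (Fin n) // x ≠ 0} → ℝ × EuclideanSpace ℝ (Fin n) := fun x =>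
      (‖x.1‖, ‖x.1‖⁻¹ • x.1)
    have hg : Continuous g := by
      have hn : Continuous fun x : {x : EuclideanSpace ℝ (Fin n) // x ≠ 0} => ‖x.1‖ := by fun_prop
      exact hn.prodMk ((hn.inv₀ fun x => norm_ne_zero_iff.2 x.2).smul continuous_subtype_val)
    let s : coneDomain W → ℝ × W := fun y => ((radialEquiv m y).1, ⟨(radialEquiv m y).2, y.2.2⟩)
    have hs0 : Continuous fun y : coneDomain W => radialEquiv m y :=
      (radialEquiv m).continuous.comp continuous_subtype_val
    have hsc : Continuous s := hs0.fst.prodMk (hs0.snd.subtype_mk _)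
    have hs : IsEmbedding s := by
      refine IsEmbedding.of_comp hsc (g := Prod.map id Subtype.val)
        (continuous_id.prodMap continuous_subtype_val) ?_
      exact (radialEquiv m).toHomeomorph.isEmbedding.comp IsEmbedding.subtypeVal
    have hgf : IsEmbedding (g ∘ f) := by
      have : g ∘ f = Prod.map id (W.domRestrict F) ∘ s := by
        funext y
        have ht : 0 < (radialEquiv m y.1).1 := y.2.1
        have hn : ‖coneParam F y.1‖ = (radialEquiv m y.1).1 := by
          rw [coneParam, norm_smul, hF.norm_eq_one hS y.2.2, mul_one, Real.norm_of_nonneg ht.le]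
        refine Prod.ext hn ?_
        change ‖coneParam F y.1‖⁻¹ • coneParam F y.1 = F (radialEquiv m y.1).2
        rw [hn, coneParam, smul_smul, inv_mul_cancel₀ ht.ne', one_smul]
      rw [this]
      exact (IsEmbedding.id.prodMap hF.isEmbedding).comp hs
    exact IsEmbedding.subtypeVal.comp (IsEmbedding.of_comp hf hg hgf)
  image_eq := by
    ext x
    constructor
    · rintro ⟨y, hy, rfl⟩
      have ht : 0 < (radialEquiv m y).1 := hy.1
      have hM := smul_mem_coneOver_diff hS (hF.mem hy.2) hy.1
      refine ⟨hM, hM.2, ?_⟩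
      rw [coneParam, norm_smul, hF.norm_eq_one hS hy.2, mul_one, Real.norm_of_nonneg ht.le,
        smul_smul, inv_mul_cancel₀ ht.ne', one_smul]
      exact hF.mem_target hy.2
    · rintro ⟨hxM, hx0, hxV⟩
      obtain ⟨u, hu, hux⟩ := hF.exists_eq ((mem_coneOver_diff hS).1 hxM).2 hxV
      refine ⟨(radialEquiv m).symm (‖x‖, u), ?_, ?_⟩
      · rw [coneDomain, mem_preimage, ContinuousLinearEquiv.apply_symm_apply]
        exact ⟨norm_pos_iff.2 hx0, hu⟩
      · rw [coneParam, ContinuousLinearEquiv.apply_symm_apply]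
        simp only [hux]
        rw [smul_smul, mul_inv_cancel₀ (norm_ne_zero_iff.2 hx0), one_smul]

theorem normDet_fderiv_coneParam (hF : IsLocalParam S V W F) (hS : S ⊆ Metric.sphere 0 1)
    {y : EuclideanSpace ℝ (Fin (m + 1))} (hy : y ∈ coneDomain W) :
    (fderiv ℝ (coneParam F) y).normDet =
      (radialEquiv m y).1 ^ m * (fderiv ℝ F (radialEquiv m y).2).normDet := by
  set t := (radialEquiv m y).1 with htdef
  set L := fderiv ℝ F (radialEquiv m y).2 with hL
  have ht : 0 < t := hy.1
  have h1 := (fderiv ℝ (coneParam F) y).normDet_sq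
  have h2 := L.normDet_sq
  simp only [RCLike.ofReal_real_eq_id, id] at h1 h2
  have h3 : (ContinuousLinearMap.adjoint (fderiv ℝ (coneParam F) y) ∘L
      fderiv ℝ (coneParam F) y).toLinearMap =
      ((radialEquiv m).symm.toLinearEquiv : _ →ₗ[ℝ] _) ∘ₗ
        ((LinearMap.id : ℝ →ₗ[ℝ] ℝ).prodMap
          ((t ^ 2) • (ContinuousLinearMap.adjoint L ∘L L).toLinearMap)) ∘ₗ
        ((radialEquiv m).symm.toLinearEquiv.symm : _ →ₗ[ℝ] _) := by
    ext1 p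
    refine ext_inner_right ℝ fun q => ?_
    change inner ℝ (ContinuousLinearMap.adjoint (fderiv ℝ (coneParam F) y)
      (fderiv ℝ (coneParam F) y p)) q = inner ℝ ((radialEquiv m).symm ((radialEquiv m p).1,
        t ^ 2 • ContinuousLinearMap.adjoint L (L (radialEquiv m p).2))) q
    rw [ContinuousLinearMap.adjoint_inner_left, hF.inner_fderiv_coneParam hS hy,
      inner_eq_radialEquiv, ContinuousLinearEquiv.apply_symm_apply, real_inner_smul_left,
      ContinuousLinearMap.adjoint_inner_left]
  have h4 : (fderiv ℝ (coneParam F) y).normDet ^ 2 = (t ^ m * L.normDet) ^ 2 := by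
    rw [h1, mul_pow, h2, ContinuousLinearMap.det, h3, LinearMap.det_conj, LinearMap.det_prodMap,
      LinearMap.det_id, one_mul, LinearMap.det_smul, finrank_euclideanSpace_fin,
      ContinuousLinearMap.det]
    ring
  exact (pow_left_inj₀ (LinearMap.normDet_nonneg _)
    (mul_nonneg (by positivity) (LinearMap.normDet_nonneg _)) two_ne_zero).1 h4

end IsLocalParam

theorem IsC2Submanifold.coneOver_diff (hSm : IsC2Submanifold m S) (hS : S ⊆ Metric.sphere 0 1) :
    IsC2Submanifold (m + 1) (coneOver S \ {0}) := by
  intro p hp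
  obtain ⟨V, W, F, hV, hF⟩ := hSm.exists_isLocalParam ((mem_coneOver_diff hS).1 hp).2
  have h := hF.isLocalParam_coneParam hS
  exact ⟨_, _, _, h.isOpen_target, ⟨hp.2, hV⟩, h.isOpen_source, h.contDiffOn, h.injective,
    h.isEmbedding, h.image_eq⟩

end ConeChart

/-! ### Traces of the second fundamental forms in a parametrization -/

section Traces

variable {n d : ℕ} {M V : Set (EuclideanSpace ℝ (Fin n))} {W : Set (EuclideanSpace ℝ (Fin d))}
  {F : EuclideanSpace ℝ (Fin d) → EuclideanSpace ℝ (Fin n)} {u : EuclideanSpace ℝ (Fin d)}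

namespace IsLocalParam

variable {κ : Type*} [Fintype κ]

theorem paramHessian_starProjection (hF : IsLocalParam M V W F) (hu : u ∈ W)
    (v w : EuclideanSpace ℝ (Fin n)) :
    paramHessian F u ((tangentSubspace M (F u)).starProjection v)
      ((tangentSubspace M (F u)).starProjection w) = paramHessian F u v w := by
  rw [paramHessian_apply, paramHessian_apply, hF.pinv_starProjection hu, hF.pinv_starProjection hu]

theorem sum_paramHessian_tangentBasis (hF : IsLocalParam M V W F) (hu : u ∈ W)
    (ε : OrthonormalBasis κ ℝ (EuclideanSpace ℝ (Fin n))) :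
    ∑ i, paramHessian F u (tangentBasis M (F u) i) (tangentBasis M (F u) i) =
      ∑ a, paramHessian F u (ε a) (ε a) := by
  have h := sum_orthonormalBasis_subspace _ (tangentBasis M (F u)) ε
    (paramHessian F u).toLinearMap₁₂
  refine h.trans (Finset.sum_congr rfl fun a _ => ?_)
  exact hF.paramHessian_starProjection hu _ _

/-- The squared norm over an orthonormal basis of the tangent space is one over an orthonormal basis
`ε` of the ambient space, which does not depend on the point. -/
theorem sum_sq_paramHessian_tangentBasis (hF : IsLocalParam M V W F) (hu : u ∈ W)
    (ξ : EuclideanSpace ℝ (Fin n)) (ε : OrthonormalBasis κ ℝ (EuclideanSpace ℝ (Fin n))) :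
    ∑ i, ∑ j, (inner ℝ (paramHessian F u (tangentBasis M (F u) i) (tangentBasis M (F u) j)) ξ) ^ 2 =
      ∑ a, ∑ c, (inner ℝ (paramHessian F u (ε a) (ε c)) ξ) ^ 2 := by
  have h := sum_sq_orthonormalBasis_subspace _ (tangentBasis M (F u)) ε
    ((paramHessian F u).toLinearMap₁₂.compr₂ ((innerₗ _).flip ξ))
  simp only [LinearMap.compr₂_apply, LinearMap.flip_apply, innerₗ_apply_apply] at h
  refine h.trans (Finset.sum_congr rfl fun a _ => Finset.sum_congr rfl fun c _ => ?_)
  exact congrArg (fun z => (inner ℝ z ξ) ^ 2) (hF.paramHessian_starProjection hu _ _)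

theorem inner_meanCurvature_eq_sum (hF : IsLocalParam M V W F) (hu : u ∈ W)
    {ξ : EuclideanSpace ℝ (Fin n)} (hξ : ξ ∈ normalSubspace M (F u))
    (ε : OrthonormalBasis κ ℝ (EuclideanSpace ℝ (Fin n))) :
    inner ℝ (meanCurvature M (F u)) ξ = inner ℝ (∑ a, paramHessian F u (ε a) (ε a)) ξ := by
  rw [← hF.sum_paramHessian_tangentBasis hu ε, meanCurvature, sum_inner, sum_inner]
  exact Finset.sum_congr rfl fun i _ => hF.inner_secondForm hu (tangentBasis M (F u) i).2
    (tangentBasis M (F u) i).2 hξ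

theorem inner_sum_sphereSecondForm (hF : IsLocalParam M V W F) (hu : u ∈ W)
    {ξ : EuclideanSpace ℝ (Fin n)} (hξ : ξ ∈ sphereNormalSubspace M (F u))
    (ε : OrthonormalBasis κ ℝ (EuclideanSpace ℝ (Fin n))) :
    inner ℝ (∑ i, sphereSecondForm M (F u) (tangentBasis M (F u) i) (tangentBasis M (F u) i)) ξ =
      inner ℝ (∑ a, paramHessian F u (ε a) (ε a)) ξ := by
  rw [← hF.sum_paramHessian_tangentBasis hu ε, sum_inner, sum_inner]
  exact Finset.sum_congr rfl fun i _ => hF.inner_sphereSecondForm hu (tangentBasis M (F u) i).2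
    (tangentBasis M (F u) i).2 hξ

theorem sum_sq_inner_secondForm (hF : IsLocalParam M V W F) (hu : u ∈ W)
    {ξ : EuclideanSpace ℝ (Fin n)} (hξ : ξ ∈ normalSubspace M (F u))
    (ε : OrthonormalBasis κ ℝ (EuclideanSpace ℝ (Fin n))) :
    ∑ i, ∑ j, (inner ℝ (secondForm M (F u) (tangentBasis M (F u) i) (tangentBasis M (F u) j)) ξ) ^ 2
      = ∑ a, ∑ c, (inner ℝ (paramHessian F u (ε a) (ε c)) ξ) ^ 2 := by
  rw [← hF.sum_sq_paramHessian_tangentBasis hu ξ ε]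
  refine Finset.sum_congr rfl fun i _ => Finset.sum_congr rfl fun j _ => ?_
  rw [hF.inner_secondForm hu (tangentBasis M (F u) i).2 (tangentBasis M (F u) j).2 hξ]

theorem sum_sq_inner_sphereSecondForm (hF : IsLocalParam M V W F) (hu : u ∈ W)
    {ξ : EuclideanSpace ℝ (Fin n)} (hξ : ξ ∈ sphereNormalSubspace M (F u))
    (ε : OrthonormalBasis κ ℝ (EuclideanSpace ℝ (Fin n))) :
    ∑ i, ∑ j, (inner ℝ (sphereSecondForm M (F u) (tangentBasis M (F u) i)
      (tangentBasis M (F u) j)) ξ) ^ 2 =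
        ∑ a, ∑ c, (inner ℝ (paramHessian F u (ε a) (ε c)) ξ) ^ 2 := by
  rw [← hF.sum_sq_paramHessian_tangentBasis hu ξ ε]
  refine Finset.sum_congr rfl fun i _ => Finset.sum_congr rfl fun j _ => ?_
  rw [hF.inner_sphereSecondForm hu (tangentBasis M (F u) i).2 (tangentBasis M (F u) j).2 hξ]

theorem sum_norm_sq_derivAlong (hF : IsLocalParam M V W F) (hu : u ∈ W)
    {X : EuclideanSpace ℝ (Fin n) → EuclideanSpace ℝ (Fin n)}
    (hX : ContDiffAt ℝ 1 (fun v => X (F v)) u)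
    (ε : OrthonormalBasis κ ℝ (EuclideanSpace ℝ (Fin n))) :
    ∑ i, ‖(normalSubspace M (F u)).starProjection (derivAlong M X (F u) (tangentBasis M (F u) i))‖ ^ 2
      = ∑ a, ‖(normalSubspace M (F u)).starProjection
        (fderiv ℝ (fun v => X (F v)) u (pinv (fderiv ℝ F u) (ε a)))‖ ^ 2 := by
  have h := sum_norm_sq_orthonormalBasis_subspace _ (tangentBasis M (F u)) ε
    ((normalSubspace M (F u)).starProjection ∘L fderivWithin ℝ X M (F u)).toLinearMap
  refine h.trans (Finset.sum_congr rfl fun a _ => ?_)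
  refine congrArg (fun z => ‖(normalSubspace M (F u)).starProjection z‖ ^ 2) ?_
  rw [hF.starProjection_tangentSubspace hu]
  exact hF.derivAlong_eq hu hX _

end IsLocalParam

end Traces

/-! ### Curvature of a cone -/

section ConeCurvature

variable {n m : ℕ} {S V : Set (EuclideanSpace ℝ (Fin n))} {W : Set (EuclideanSpace ℝ (Fin m))}
  {F : EuclideanSpace ℝ (Fin m) → EuclideanSpace ℝ (Fin n)} {y : EuclideanSpace ℝ (Fin (m + 1))}

namespace IsLocalParam

theorem mem_sphereNormalSubspace_iff (hF : IsLocalParam S V W F) {u : EuclideanSpace ℝ (Fin m)}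
    (hu : u ∈ W) {ξ : EuclideanSpace ℝ (Fin n)} :
    ξ ∈ sphereNormalSubspace S (F u) ↔
      (∀ a, inner ℝ (fderiv ℝ F u a) ξ = 0) ∧ inner ℝ (F u) ξ = 0 := by
  rw [sphereNormalSubspace, ← Submodule.inf_orthogonal, Submodule.mem_inf,
    Submodule.mem_orthogonal_singleton_iff_inner_right, hF.tangentSubspace_eq hu,
    Submodule.mem_orthogonal]
  refine and_congr_left fun _ => ⟨fun h a => h _ ⟨a, rfl⟩, ?_⟩
  rintro h _ ⟨a, rfl⟩
  exact h a

theorem normalSubspace_coneParam (hF : IsLocalParam S V W F) (hS : S ⊆ Metric.sphere 0 1)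
    (hy : y ∈ coneDomain W) :
    normalSubspace (coneOver S \ {0}) (coneParam F y) =
      sphereNormalSubspace S (F (radialEquiv m y).2) := by
  ext ξ
  rw [hF.mem_sphereNormalSubspace_iff hy.2, normalSubspace,
    (hF.isLocalParam_coneParam hS).tangentSubspace_eq hy, Submodule.mem_orthogonal]
  have ht : (radialEquiv m y).1 ≠ 0 := (show 0 < (radialEquiv m y).1 from hy.1).ne'
  constructor
  · intro h
    refine ⟨fun a => ?_, ?_⟩
    · have h1 := h _ ⟨(radialEquiv m).symm (0, a), rfl⟩
      change inner ℝ (fderiv ℝ (coneParam F) y _) ξ = 0 at h1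
      rw [hF.fderiv_coneParam hy, ContinuousLinearEquiv.apply_symm_apply, zero_smul, add_zero,
        real_inner_smul_left] at h1
      exact (mul_eq_zero.1 h1).resolve_left ht
    · have h1 := h _ ⟨(radialEquiv m).symm (1, 0), rfl⟩
      change inner ℝ (fderiv ℝ (coneParam F) y _) ξ = 0 at h1
      rw [hF.fderiv_coneParam hy, ContinuousLinearEquiv.apply_symm_apply, map_zero, smul_zero,
        zero_add, one_smul] at h1
      exact h1
  · rintro ⟨h1, h2⟩ _ ⟨p, rfl⟩
    change inner ℝ (fderiv ℝ (coneParam F) y p) ξ = 0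
    rw [hF.fderiv_coneParam hy, inner_add_left, real_inner_smul_left, real_inner_smul_left, h1, h2,
      mul_zero, mul_zero, add_zero]

/-- The coordinates of the projection of `v` to the tangent space of the cone: the radial component,
and the component along the link rescaled by `t⁻¹`. -/
theorem pinv_fderiv_coneParam (hF : IsLocalParam S V W F) (hS : S ⊆ Metric.sphere 0 1)
    (hy : y ∈ coneDomain W) (v : EuclideanSpace ℝ (Fin n)) :
    pinv (fderiv ℝ (coneParam F) y) v = (radialEquiv m).symm (inner ℝ (F (radialEquiv m y).2) v,
      (radialEquiv m y).1⁻¹ • pinv (fderiv ℝ F (radialEquiv m y).2) v) := by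
  set t := (radialEquiv m y).1 with htd
  set u := (radialEquiv m y).2 with hud
  have ht : t ≠ 0 := (show 0 < t from hy.1).ne'
  set p := (radialEquiv m).symm (inner ℝ (F u) v, t⁻¹ • pinv (fderiv ℝ F u) v) with hp
  have h1 : pinv (fderiv ℝ (coneParam F) y) (v - fderiv ℝ (coneParam F) y p) = 0 := by
    refine pinv_eq_zero fun q => ?_
    have h2 : inner ℝ (fderiv ℝ F u (radialEquiv m q).2) (fderiv ℝ F u (pinv (fderiv ℝ F u) v)) =
        inner ℝ (fderiv ℝ F u (radialEquiv m q).2) v := by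
      rw [← ContinuousLinearMap.adjoint_inner_right, adjoint_comp_self_pinv (hF.injective _ hy.2),
        ContinuousLinearMap.adjoint_inner_right]
    rw [inner_sub_right, hF.inner_fderiv_coneParam hS hy, hF.fderiv_coneParam hy, ← htd, ← hud, hp,
      ContinuousLinearEquiv.apply_symm_apply, inner_add_left, real_inner_smul_left,
      real_inner_smul_left, map_smul, real_inner_smul_right, h2]
    field_simp
    ring
  rw [map_sub, pinv_apply_self (hF.injective_fderiv_coneParam hS hy), sub_eq_zero] at h1
  exact h1

theorem fderiv_fderiv_coneParam (hF : IsLocalParam S V W F) (hS : S ⊆ Metric.sphere 0 1)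
    (hy : y ∈ coneDomain W) (p q : EuclideanSpace ℝ (Fin (m + 1))) :
    fderiv ℝ (fderiv ℝ (coneParam F)) y p q =
      (radialEquiv m y).1 • fderiv ℝ (fderiv ℝ F) (radialEquiv m y).2 (radialEquiv m p).2
          (radialEquiv m q).2 +
        (radialEquiv m p).1 • fderiv ℝ F (radialEquiv m y).2 (radialEquiv m q).2 +
        (radialEquiv m q).1 • fderiv ℝ F (radialEquiv m y).2 (radialEquiv m p).2 := by
  have hG := hF.isLocalParam_coneParam hS
  set r := ContinuousLinearMap.fst ℝ ℝ (EuclideanSpace ℝ (Fin m)) ∘L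
    (radialEquiv m).toContinuousLinearMap with hr
  set s := ContinuousLinearMap.snd ℝ ℝ (EuclideanSpace ℝ (Fin m)) ∘L
    (radialEquiv m).toContinuousLinearMap with hs
  have h1 : HasFDerivAt (fun z => fderiv ℝ (coneParam F) z q)
      ((fderiv ℝ (fderiv ℝ (coneParam F)) y).flip q) y := by
    have := (((hG.contDiffAt_fderiv hy).differentiableAt (by simp)).hasFDerivAt).clm_apply
      (hasFDerivAt_const q y)
    simpa using this
  have h2 : (fun z => fderiv ℝ (coneParam F) z q) =ᶠ[𝓝 y]
      fun z => r z • fderiv ℝ F (s z) (s q) + r q • F (s z) := by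
    filter_upwards [hG.isOpen_source.mem_nhds hy] with z hz
    exact hF.fderiv_coneParam hz q
  have h3 : HasFDerivAt (fun z => fderiv ℝ F (s z)) (fderiv ℝ (fderiv ℝ F) (s y) ∘L s) y :=
    HasFDerivAt.comp y (g := fderiv ℝ F) (f := s)
      ((hF.contDiffAt_fderiv hy.2).differentiableAt (by simp)).hasFDerivAt s.hasFDerivAt
  have h4 : HasFDerivAt (fun z => F (s z)) (fderiv ℝ F (s y) ∘L s) y :=
    HasFDerivAt.comp y (g := F) (f := s) (hF.hasFDerivAt hy.2) s.hasFDerivAt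
  have h5 := (r.hasFDerivAt.smul (h3.clm_apply (hasFDerivAt_const (s q) y))).add
    (h4.const_smul (r q))
  have h6 := congrArg (fun A => A p) (h1.unique (h5.congr_of_eventuallyEq h2))
  simp only [ContinuousLinearMap.flip_apply, add_apply, _root_.smul_apply,
    ContinuousLinearMap.smulRight_apply, ContinuousLinearMap.comp_apply, zero_apply, map_zero,
    zero_add] at h6
  rw [h6]
  rfl

/-- The second fundamental form of the cone at `t x` is `t⁻¹` times that of the link at `x`; the
radial direction does not contribute. -/
theorem inner_paramHessian_coneParam (hF : IsLocalParam S V W F) (hS : S ⊆ Metric.sphere 0 1)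
    (hy : y ∈ coneDomain W) {ξ : EuclideanSpace ℝ (Fin n)}
    (hξ : ξ ∈ sphereNormalSubspace S (F (radialEquiv m y).2)) (v w : EuclideanSpace ℝ (Fin n)) :
    inner ℝ (paramHessian (coneParam F) y v w) ξ =
      (radialEquiv m y).1⁻¹ * inner ℝ (paramHessian F (radialEquiv m y).2 v w) ξ := by
  have ht : (radialEquiv m y).1 ≠ 0 := (show 0 < (radialEquiv m y).1 from hy.1).ne'
  have h0 := ((hF.mem_sphereNormalSubspace_iff hy.2).1 hξ).1
  rw [paramHessian_apply, paramHessian_apply, hF.fderiv_fderiv_coneParam hS hy,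
    hF.pinv_fderiv_coneParam hS hy, hF.pinv_fderiv_coneParam hS hy,
    ContinuousLinearEquiv.apply_symm_apply, ContinuousLinearEquiv.apply_symm_apply]
  simp only [map_smul, inner_add_left, real_inner_smul_left, h0, mul_zero, add_zero,
    _root_.smul_apply]
  field_simp

end IsLocalParam

theorem exists_coneParam_eq (hSm : IsC2Submanifold m S) {x : EuclideanSpace ℝ (Fin n)} (hx : x ∈ S)
    {t : ℝ} (ht : 0 < t) :
    ∃ (V : Set (EuclideanSpace ℝ (Fin n))) (W : Set (EuclideanSpace ℝ (Fin m)))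
      (F : EuclideanSpace ℝ (Fin m) → EuclideanSpace ℝ (Fin n))
      (y : EuclideanSpace ℝ (Fin (m + 1))), IsLocalParam S V W F ∧ y ∈ coneDomain W ∧
        (radialEquiv m y).1 = t ∧ F (radialEquiv m y).2 = x ∧ coneParam F y = t • x := by
  obtain ⟨V, W, F, hxV, hF⟩ := hSm.exists_isLocalParam hx
  obtain ⟨u, hu, rfl⟩ := hF.exists_eq hx hxV
  refine ⟨V, W, F, (radialEquiv m).symm (t, u), hF, ?_, ?_, ?_, ?_⟩
  · rw [coneDomain, mem_preimage, ContinuousLinearEquiv.apply_symm_apply]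
    exact ⟨ht, hu⟩
  all_goals simp [coneParam]

variable {x : EuclideanSpace ℝ (Fin n)} {t : ℝ}

theorem normalSubspace_coneOver (hSm : IsC2Submanifold m S) (hS : S ⊆ Metric.sphere 0 1)
    (hx : x ∈ S) (ht : 0 < t) :
    normalSubspace (coneOver S \ {0}) (t • x) = sphereNormalSubspace S x := by
  obtain ⟨V, W, F, y, hF, hy, rfl, rfl, hyx⟩ := exists_coneParam_eq hSm hx ht
  rw [← hyx, hF.normalSubspace_coneParam hS hy]

theorem mem_tangentSubspace_coneOver (hSm : IsC2Submanifold m S) (hS : S ⊆ Metric.sphere 0 1)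
    (hx : x ∈ S) (ht : 0 < t) : x ∈ tangentSubspace (coneOver S \ {0}) (t • x) := by
  obtain ⟨V, W, F, y, hF, hy, rfl, rfl, hyx⟩ := exists_coneParam_eq hSm hx ht
  have h := (hF.isLocalParam_coneParam hS).mem_tangentSubspace hy ((radialEquiv m).symm (1, 0))
  rw [hF.fderiv_coneParam hy, ContinuousLinearEquiv.apply_symm_apply, map_zero, smul_zero, zero_add,
    one_smul, hyx] at h
  exact h

/-- The cone over a minimal submanifold of the sphere is minimal. -/
theorem meanCurvature_coneOver (hSm : IsC2Submanifold m S) (hS : S ⊆ Metric.sphere 0 1)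
    (hmin : IsSphereMinimal S) {z : EuclideanSpace ℝ (Fin n)} (hz : z ∈ coneOver S \ {0}) :
    meanCurvature (coneOver S \ {0}) z = 0 := by
  obtain ⟨hz0, hx⟩ := (mem_coneOver_diff hS).1 hz
  obtain ⟨V, W, F, y, hF, hy, h1, h2, h3⟩ := exists_coneParam_eq hSm hx (norm_pos_iff.2 hz0)
  rw [smul_smul, mul_inv_cancel₀ (norm_ne_zero_iff.2 hz0), one_smul] at h3
  subst h3
  set H := meanCurvature (coneOver S \ {0}) (coneParam F y) with hH
  have hHn : H ∈ normalSubspace (coneOver S \ {0}) (coneParam F y) :=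
    Submodule.sum_mem _ fun i _ => Submodule.starProjection_apply_mem _ _
  have hHs : H ∈ sphereNormalSubspace S (F (radialEquiv m y).2) := by
    rwa [← hF.normalSubspace_coneParam hS hy]
  have ε := stdOrthonormalBasis ℝ (EuclideanSpace ℝ (Fin n))
  have h4 := (hF.isLocalParam_coneParam hS).inner_meanCurvature_eq_sum hy hHn ε
  have h5 := hF.inner_sum_sphereSecondForm hy.2 hHs ε
  rw [hmin _ (hF.mem hy.2), inner_zero_left, sum_inner] at h5
  rw [sum_inner, Finset.sum_congr rfl fun a _ => hF.inner_paramHessian_coneParam hS hy hHs _ _,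
    ← Finset.mul_sum, ← h5, mul_zero, ← hH] at h4
  exact inner_self_eq_zero.1 h4

/-- The curvature of the cone at `t x` in the direction of a normal vector is at most `t⁻² |A|²(x)`
times the square of its length. -/
theorem sum_sq_inner_secondForm_coneOver_le (hSm : IsC2Submanifold m S)
    (hS : S ⊆ Metric.sphere 0 1) (hx : x ∈ S) (ht : 0 < t) {ξ : EuclideanSpace ℝ (Fin n)}
    (hξ : ξ ∈ sphereNormalSubspace S x) :
    ∑ i, ∑ j, (inner ℝ (secondForm (coneOver S \ {0}) (t • x)
      (tangentBasis (coneOver S \ {0}) (t • x) i) (tangentBasis (coneOver S \ {0}) (t • x) j)) ξ) ^ 2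
      ≤ (t ^ 2)⁻¹ * (sphereSecondFormNormSq S x * ‖ξ‖ ^ 2) := by
  obtain ⟨V, W, F, y, hF, hy, rfl, rfl, hyx⟩ := exists_coneParam_eq hSm hx ht
  have ε := stdOrthonormalBasis ℝ (EuclideanSpace ℝ (Fin n))
  rw [← hyx, (hF.isLocalParam_coneParam hS).sum_sq_inner_secondForm hy
    (by rwa [hF.normalSubspace_coneParam hS hy]) ε]
  simp_rw [hF.inner_paramHessian_coneParam hS hy hξ, mul_pow, ← Finset.mul_sum, inv_pow]
  refine mul_le_mul_of_nonneg_left ?_ (by positivity)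
  rw [← hF.sum_sq_inner_sphereSecondForm hy.2 hξ ε, sphereSecondFormNormSq, Finset.sum_mul]
  refine Finset.sum_le_sum fun i _ => ?_
  rw [Finset.sum_mul]
  refine Finset.sum_le_sum fun j _ => ?_
  rw [← mul_pow, ← sq_abs]
  exact pow_le_pow_left₀ (abs_nonneg _) (abs_real_inner_le_norm _ _) 2

end ConeCurvature

/-! ### Radial weights -/

section RadialWeight

variable {n : ℕ} {h : ℝ → ℝ}

theorem contDiffOn_exp_norm (hh : ContDiffOn ℝ 2 h (Ioi 0)) :
    ContDiffOn ℝ 2 (fun x : EuclideanSpace ℝ (Fin n) => Real.exp (h ‖x‖)) {0}ᶜ := by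
  refine ContDiffOn.exp (hh.comp (fun x hx => ?_) fun x hx => norm_pos_iff.2 hx)
  exact (contDiffAt_norm ℝ hx).contDiffWithinAt

theorem fderiv_exp_norm (hh : ContDiffOn ℝ 2 h (Ioi 0)) {x : EuclideanSpace ℝ (Fin n)}
    (hx : x ≠ 0) :
    fderiv ℝ (fun x : EuclideanSpace ℝ (Fin n) => Real.exp (h ‖x‖)) x =
      (Real.exp (h ‖x‖) * deriv h ‖x‖ / ‖x‖) • innerSL ℝ x := by
  have hx' : 0 < ‖x‖ := norm_pos_iff.2 hx
  have h1 : HasDerivAt h (deriv h ‖x‖) ‖x‖ :=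
    ((hh.contDiffAt (Ioi_mem_nhds hx')).differentiableAt (by simp)).hasDerivAt
  have h2 : HasFDerivAt (fun x : EuclideanSpace ℝ (Fin n) => ‖x‖) (‖x‖⁻¹ • innerSL ℝ x) x := by
    have h3 : HasFDerivAt (fun x : EuclideanSpace ℝ (Fin n) => √(‖x‖ ^ 2))
        ((1 / (2 * √(‖x‖ ^ 2))) • (2 • innerSL ℝ x)) x :=
      (hasStrictFDerivAt_norm_sq x).hasFDerivAt.sqrt (by positivity)
    simp only [Real.sqrt_sq (norm_nonneg _)] at h3
    refine h3.congr_fderiv ?_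
    ext v
    simp
    field_simp
  have h4 := (h1.exp.comp_hasFDerivAt x h2).fderiv
  refine h4.trans ?_
  rw [smul_smul, div_eq_mul_inv]

theorem fderiv_exp_norm_apply_eq_zero (hh : ContDiffOn ℝ 2 h (Ioi 0))
    {x ξ : EuclideanSpace ℝ (Fin n)} (hx : x ≠ 0) (hξ : inner ℝ x ξ = 0) :
    fderiv ℝ (fun x : EuclideanSpace ℝ (Fin n) => Real.exp (h ‖x‖)) x ξ = 0 := by
  rw [fderiv_exp_norm hh hx]
  simp [hξ]

/-- In a direction orthogonal to the radius, the Hessian of a radial function `φ(|x|)` is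
`φ'(|x|) / |x|`. -/
theorem fderiv_fderiv_exp_norm (hh : ContDiffOn ℝ 2 h (Ioi 0)) {x ξ : EuclideanSpace ℝ (Fin n)}
    (hx : x ≠ 0) (hξ : inner ℝ x ξ = 0) :
    fderiv ℝ (fderiv ℝ fun x : EuclideanSpace ℝ (Fin n) => Real.exp (h ‖x‖)) x ξ ξ =
      Real.exp (h ‖x‖) * deriv h ‖x‖ / ‖x‖ * ‖ξ‖ ^ 2 := by
  have hx' : 0 < ‖x‖ := norm_pos_iff.2 hx
  have h1 : ContDiffOn ℝ 1 (deriv h) (Ioi 0) := hh.deriv_of_isOpen isOpen_Ioi (by norm_num)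
  have h2 : DifferentiableAt ℝ h ‖x‖ :=
    (hh.contDiffAt (Ioi_mem_nhds hx')).differentiableAt (by simp)
  have h3 : DifferentiableAt ℝ (deriv h) ‖x‖ :=
    (h1.contDiffAt (Ioi_mem_nhds hx')).differentiableAt (by simp)
  have h4 : DifferentiableAt ℝ (fun r => Real.exp (h r) * deriv h r / r) ‖x‖ :=
    (h2.exp.mul h3).div differentiableAt_id hx'.ne'
  have h5 : DifferentiableAt ℝ (fun x : EuclideanSpace ℝ (Fin n) =>
      Real.exp (h ‖x‖) * deriv h ‖x‖ / ‖x‖) x :=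
    DifferentiableAt.comp x (g := fun r => Real.exp (h r) * deriv h r / r)
      (f := fun x : EuclideanSpace ℝ (Fin n) => ‖x‖) h4 (differentiableAt_id.norm ℝ hx)
  have h6 : fderiv ℝ (fun x : EuclideanSpace ℝ (Fin n) => Real.exp (h ‖x‖)) =ᶠ[𝓝 x] fun x =>
      (Real.exp (h ‖x‖) * deriv h ‖x‖ / ‖x‖) • innerSL ℝ x := by
    filter_upwards [isOpen_compl_singleton.mem_nhds hx] with z hz
    exact fderiv_exp_norm hh hz
  have h7 := (h5.hasFDerivAt.smul (innerSL ℝ (E := EuclideanSpace ℝ (Fin n))).hasFDerivAt).fderiv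
  rw [h6.fderiv_eq]
  refine (congrArg (fun A => A ξ ξ) h7).trans ?_
  change Real.exp (h ‖x‖) * deriv h ‖x‖ / ‖x‖ * inner ℝ ξ ξ + _ * inner ℝ x ξ = _
  rw [hξ, mul_zero, add_zero, real_inner_self_eq_norm_sq]

end RadialWeight

/-! ### Integrability of the integrands -/

section Integrability

variable {n d : ℕ} {M V : Set (EuclideanSpace ℝ (Fin n))} {W : Set (EuclideanSpace ℝ (Fin d))}
  {F : EuclideanSpace ℝ (Fin d) → EuclideanSpace ℝ (Fin n)}
  {f : EuclideanSpace ℝ (Fin n) → ℝ} {X : EuclideanSpace ℝ (Fin n) → EuclideanSpace ℝ (Fin n)}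
  {U : Set (EuclideanSpace ℝ (Fin n))}

theorem IsC2Submanifold.continuousOn_curvatureIntegrand (hM : IsC2Submanifold d M)
    (hH : ∀ x ∈ M, meanCurvature M x = 0) (hf : ContinuousOn f M) (hX : IsNormalVariation M U X) :
    ContinuousOn (curvatureIntegrand f M X) M := by
  refine hM.continuousOn_of_isLocalParam fun V W F hF => ?_
  have ε := stdOrthonormalBasis ℝ (EuclideanSpace ℝ (Fin n))
  have hFc : ContinuousOn F W := hF.contDiffOn.continuousOn
  have hXc : ContinuousOn (fun u => X (F u)) W := hX.contDiffOn.continuousOn.comp hFc hF.mapsTo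
  have hD2 : ContinuousOn (fderiv ℝ (fderiv ℝ F)) W :=
    hF.contDiffOn_fderiv.continuousOn_fderiv_of_isOpen hF.isOpen_source le_rfl
  have hp := hF.contDiffOn_pinv.continuousOn
  have h1 : ContinuousOn (fun u => f (F u) *
      ∑ a, ∑ c, (inner ℝ (paramHessian F u (ε a) (ε c)) (X (F u))) ^ 2) W := by
    refine (hf.comp hFc hF.mapsTo).mul (continuousOn_finsetSum _ fun a _ =>
      continuousOn_finsetSum _ fun c _ => ContinuousOn.pow (ContinuousOn.inner ?_ hXc) 2)
    exact (hD2.clm_apply (hp.clm_apply continuousOn_const)).clm_apply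
      (hp.clm_apply continuousOn_const)
  refine h1.congr fun u hu => ?_
  rw [curvatureIntegrand, hH _ (hF.mem hu), inner_zero_left,
    hF.sum_sq_inner_secondForm hu (hX.normal _ (hF.mem hu)) ε]
  ring

theorem IsC2Submanifold.continuousOn_gradientIntegrand (hM : IsC2Submanifold d M) (hU : IsOpen U)
    (hMU : M ⊆ U) (hf : ContDiffOn ℝ 2 f U) (hX : IsNormalVariation M U X) :
    ContinuousOn (gradientIntegrand f M X) M := by
  refine hM.continuousOn_of_isLocalParam fun V W F hF => ?_
  have ε := stdOrthonormalBasis ℝ (EuclideanSpace ℝ (Fin n))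
  have hFc : ContinuousOn F W := hF.contDiffOn.continuousOn
  have hFU : MapsTo F W U := fun u hu => hMU (hF.mem hu)
  have hXF : ContDiffOn ℝ 1 (fun u => X (F u)) W := hF.contDiffOn_comp (by norm_num) hX.contDiffOn
  have hDX := hXF.continuousOn_fderiv_of_isOpen hF.isOpen_source le_rfl
  have hDF := hF.contDiffOn_fderiv.continuousOn
  have hp := hF.contDiffOn_pinv.continuousOn
  have hD2f : ContinuousOn (fderiv ℝ (fderiv ℝ f)) U :=
    (hf.fderiv_of_isOpen (m := 1) hU (by norm_num)).continuousOn_fderiv_of_isOpen hU le_rfl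
  have hd : ∀ a, ContinuousOn (fun u => fderiv ℝ (fun v => X (F v)) u
      (pinv (fderiv ℝ F u) (ε a))) W := fun a =>
    hDX.clm_apply (hp.clm_apply continuousOn_const)
  have h1 : ContinuousOn (fun u => f (F u) * (∑ a, ‖fderiv ℝ (fun v => X (F v)) u
      (pinv (fderiv ℝ F u) (ε a)) - fderiv ℝ F u (pinv (fderiv ℝ F u) (fderiv ℝ (fun v => X (F v)) u
      (pinv (fderiv ℝ F u) (ε a))))‖ ^ 2) +
      fderiv ℝ (fderiv ℝ f) (F u) (X (F u)) (X (F u))) W := by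
    refine ((hf.continuousOn.comp hFc hFU).mul (continuousOn_finsetSum _ fun a _ =>
      ((hd a).sub (hDF.clm_apply (hp.clm_apply (hd a)))).norm.pow 2)).add ?_
    exact ((hD2f.comp hFc hFU).clm_apply hXF.continuousOn).clm_apply hXF.continuousOn
  refine h1.congr fun u hu => ?_
  rw [gradientIntegrand, hF.sum_norm_sq_derivAlong hu
    (hXF.contDiffAt (hF.isOpen_source.mem_nhds hu)) ε]
  simp_rw [hF.starProjection_normalSubspace hu]

theorem curvatureIntegrand_eq_zero {x : EuclideanSpace ℝ (Fin n)} (hx : X x = 0) :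
    curvatureIntegrand f M X x = 0 := by
  simp [curvatureIntegrand, hx]

theorem gradientIntegrand_eq_zero {K : Set (EuclideanSpace ℝ (Fin n))} (hK : IsClosed K)
    (h0 : ∀ x ∈ M \ K, X x = 0) {x : EuclideanSpace ℝ (Fin n)} (hx : x ∈ M \ K) :
    gradientIntegrand f M X x = 0 := by
  have h1 : X =ᶠ[𝓝[M] x] fun _ => 0 := by
    filter_upwards [self_mem_nhdsWithin, mem_nhdsWithin_of_mem_nhds
      (hK.isOpen_compl.mem_nhds hx.2)] with y hy hyK
    exact h0 y ⟨hy, hyK⟩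
  have h2 : ∀ v, derivAlong M X x v = 0 := fun v => by
    rw [derivAlong, h1.fderivWithin_eq (h0 x hx)]
    simp
  simp [gradientIntegrand, h2, h0 x hx]

theorem IsC2Submanifold.integrableOn_of_compactSupport (hM : IsC2Submanifold d M)
    (hMm : MeasurableSet M) {K : Set (EuclideanSpace ℝ (Fin n))} (hK : IsCompact (M ∩ K))
    {q : EuclideanSpace ℝ (Fin n) → ℝ} (hq : ContinuousOn q M) (h0 : ∀ x ∈ M \ K, q x = 0) :
    IntegrableOn q M μHE[d] :=
  (hM.integrableOn_compact hK inter_subset_left (hq.mono inter_subset_left)).of_forall_sdiff_eq_zero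
    hMm fun x hx => h0 x ⟨hx.1, fun h => hx.2 ⟨hx.1, h⟩⟩

end Integrability

/-! ### The stability inequality along a ray -/

section Ray

theorem norm_sq_le_sum_orthonormalBasis {E Y ι : Type*} [NormedAddCommGroup E]
    [InnerProductSpace ℝ E] [SeminormedAddCommGroup Y] [NormedSpace ℝ Y] [Fintype ι]
    (e : OrthonormalBasis ι ℝ E) (ℓ : E →ₗ[ℝ] Y) (v : E) :
    ‖ℓ v‖ ^ 2 ≤ ‖v‖ ^ 2 * ∑ i, ‖ℓ (e i)‖ ^ 2 := by
  have h1 : ‖ℓ v‖ ≤ ∑ i, ‖inner ℝ (e i) v‖ * ‖ℓ (e i)‖ := by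
    conv_lhs => rw [← e.sum_repr' v, map_sum]
    refine (norm_sum_le _ _).trans (Finset.sum_le_sum fun i _ => ?_)
    rw [map_smul, norm_smul]
  refine (pow_le_pow_left₀ (norm_nonneg _) h1 2).trans ?_
  rw [← e.sum_sq_norm_inner_right v]
  exact Finset.sum_mul_sq_le_sq_mul_sq _ _ _

/-- A function on a half line that dominates the derivative of a compactly supported function has
a nonnegative integral. -/
theorem setIntegral_Ioi_nonneg_of_neg_deriv_le {q Z : ℝ → ℝ} {α β : ℝ} (hα : 0 < α) (hαβ : α ≤ β)
    (hZ : ContDiffOn ℝ 1 Z (Ioi 0)) (hZα : Z α = 0) (hZβ : Z β = 0)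
    (hq : ∀ t, 0 < t → t ∉ Icc α β → q t = 0) (hle : ∀ t ∈ Icc α β, -deriv Z t ≤ q t) :
    0 ≤ ∫ t in Ioi 0, q t := by
  have hsub : Icc α β ⊆ Ioi 0 := fun t ht => hα.trans_le ht.1
  rw [setIntegral_eq_of_subset_of_forall_sdiff_eq_zero measurableSet_Ioi hsub
    fun t ht => hq t ht.1 ht.2]
  by_cases hi : IntegrableOn q (Icc α β)
  · have hc : ContinuousOn (deriv Z) (Icc α β) :=
      (hZ.continuousOn_deriv_of_isOpen isOpen_Ioi le_rfl).mono hsub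
    have h1 : ∫ t in Icc α β, deriv Z t = 0 := by
      have hd : ∀ t ∈ uIcc α β, DifferentiableAt ℝ Z t := fun t ht =>
        (hZ.contDiffAt (Ioi_mem_nhds (hsub (uIcc_of_le hαβ ▸ ht)))).differentiableAt (by simp)
      have hi' : IntervalIntegrable (deriv Z) volume α β :=
        (hc.mono (by rw [uIcc_of_le hαβ])).intervalIntegrable
      rw [integral_Icc_eq_integral_Ioc, ← intervalIntegral.integral_of_le hαβ,
        intervalIntegral.integral_deriv_eq_sub hd hi', hZα, hZβ, sub_zero]
    calc (0 : ℝ) = ∫ t in Icc α β, -deriv Z t := by rw [integral_neg, h1, neg_zero]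
      _ ≤ _ := setIntegral_mono_on (hc.integrableOn_compact isCompact_Icc).neg hi
        measurableSet_Icc hle
  -- the integral of a function that is not integrable is `0` by convention
  · rw [integral_undef hi]

variable {n m : ℕ} {S : Set (EuclideanSpace ℝ (Fin n))} {x : EuclideanSpace ℝ (Fin n)}
  {X : EuclideanSpace ℝ (Fin n) → EuclideanSpace ℝ (Fin n)} {h : ℝ → ℝ} {b : ℝ}

theorem contDiffOn_ray (hS : S ⊆ Metric.sphere 0 1) (hx : x ∈ S)
    (hX : ContDiffOn ℝ 1 X (coneOver S \ {0})) : ContDiffOn ℝ 1 (fun t : ℝ => X (t • x)) (Ioi 0) :=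
  hX.comp (contDiff_id.smul contDiff_const).contDiffOn fun _ ht => smul_mem_coneOver_diff hS hx ht

theorem derivAlong_ray (hS : S ⊆ Metric.sphere 0 1) (hx : x ∈ S)
    (hX : ContDiffOn ℝ 1 X (coneOver S \ {0})) {t : ℝ} (ht : 0 < t) :
    derivAlong (coneOver S \ {0}) X (t • x) x = deriv (fun t : ℝ => X (t • x)) t := by
  have h1 : HasFDerivWithinAt X (fderivWithin ℝ X (coneOver S \ {0}) (t • x)) (coneOver S \ {0})
      (t • x) :=
    ((hX _ (smul_mem_coneOver_diff hS hx ht)).differentiableWithinAt (by simp)).hasFDerivWithinAt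
  have h2 : HasDerivWithinAt (fun t : ℝ => t • x) x (Ioi 0) t := by
    simpa using ((hasDerivAt_id t).smul_const x).hasDerivWithinAt (s := Ioi 0)
  have h3 := h1.comp_hasDerivWithinAt t h2 fun _ hs => smul_mem_coneOver_diff hS hx hs
  exact (h3.hasDerivAt (Ioi_mem_nhds ht)).deriv.symm

/-- The normal space of the cone is constant along a ray, so the derivative of a normal field along
the ray is normal. -/
theorem norm_sq_deriv_ray_le (hSm : IsC2Submanifold m S) (hS : S ⊆ Metric.sphere 0 1) (hx : x ∈ S)
    {U : Set (EuclideanSpace ℝ (Fin n))} (hX : IsNormalVariation (coneOver S \ {0}) U X)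
    {t : ℝ} (ht : 0 < t) :
    ‖deriv (fun t : ℝ => X (t • x)) t‖ ^ 2 ≤
      ∑ i, ‖(normalSubspace (coneOver S \ {0}) (t • x)).starProjection
        (derivAlong (coneOver S \ {0}) X (t • x) (tangentBasis (coneOver S \ {0}) (t • x) i))‖ ^ 2 := by
  have hd : HasDerivAt (fun t : ℝ => X (t • x)) (deriv (fun t : ℝ => X (t • x)) t) t :=
    (((contDiffOn_ray hS hx hX.contDiffOn).contDiffAt (Ioi_mem_nhds ht)).differentiableAt
      (by simp)).hasDerivAt
  have h1 : (sphereNormalSubspace S x).starProjection (deriv (fun t : ℝ => X (t • x)) t) =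
      deriv (fun t : ℝ => X (t • x)) t := by
    have h2 := (sphereNormalSubspace S x).starProjection.hasFDerivAt.comp_hasDerivAt t hd
    refine h2.unique (hd.congr_of_eventuallyEq ?_)
    filter_upwards [Ioi_mem_nhds ht] with s hs
    refine Submodule.starProjection_eq_self_iff.2 ?_
    rw [← normalSubspace_coneOver hSm hS hx hs]
    exact hX.normal _ (smul_mem_coneOver_diff hS hx hs)
  have h3 := norm_sq_le_sum_orthonormalBasis (tangentBasis (coneOver S \ {0}) (t • x))
    (((normalSubspace (coneOver S \ {0}) (t • x)).starProjection ∘L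
      fderivWithin ℝ X (coneOver S \ {0}) (t • x)).toLinearMap ∘ₗ
        (tangentSubspace (coneOver S \ {0}) (t • x)).subtype)
    ⟨x, mem_tangentSubspace_coneOver hSm hS hx ht⟩
  have hx1 : ‖x‖ = 1 := by simpa using hS hx
  have h4 : ‖(⟨x, mem_tangentSubspace_coneOver hSm hS hx ht⟩ :
      tangentSubspace (coneOver S \ {0}) (t • x))‖ = 1 := hx1
  rw [h4, one_pow, one_mul] at h3
  refine le_trans (le_of_eq ?_) h3
  change _ = ‖(normalSubspace (coneOver S \ {0}) (t • x)).starProjection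
    (derivAlong (coneOver S \ {0}) X (t • x) x)‖ ^ 2
  rw [derivAlong_ray hS hx hX.contDiffOn ht, normalSubspace_coneOver hSm hS hx ht, h1]

/-- The pointwise form of the inequality of Hardy type: with `c = (m - 1 + b) / 2`, completing the
square in `y' + c y / t` bounds the difference of the integrands from below by the derivative of
`-c e^h t^{m-1} |y|²`. -/
theorem hardy_pointwise {Y : Type*} [NormedAddCommGroup Y] [InnerProductSpace ℝ Y] (y y' : Y)
    {t p μ : ℝ} (ht : 0 < t) (hμ : 1 - μ < b) (hb : b ≤ t * p) :
    -((μ - 1 + b) / 2) * ((p * t + μ - 1) * (‖y‖ ^ 2 / t ^ 2) + 2 * (inner ℝ y y' / t)) ≤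
      ‖y'‖ ^ 2 + p / t * ‖y‖ ^ 2 - (t ^ 2)⁻¹ * (((μ - 1 + b) ^ 2 / 4 + b) * ‖y‖ ^ 2) := by
  set c := (μ - 1 + b) / 2 with hc
  have h1 : 0 ≤ ‖y' + (c / t) • y‖ ^ 2 := by positivity
  rw [norm_add_sq_real, norm_smul, mul_pow, real_inner_smul_right, Real.norm_eq_abs, sq_abs,
    real_inner_comm] at h1
  have h2 : 0 ≤ (1 + c) * (t * p - b) * (‖y‖ ^ 2 / t ^ 2) := by
    have : 0 < c := by rw [hc]; linarith
    have : 0 ≤ t * p - b := by linarith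
    positivity
  have h3 : p / t * ‖y‖ ^ 2 = (t * p) * (‖y‖ ^ 2 / t ^ 2) := by field_simp
  have h4 : (t ^ 2)⁻¹ * (((μ - 1 + b) ^ 2 / 4 + b) * ‖y‖ ^ 2) = (c ^ 2 + b) * (‖y‖ ^ 2 / t ^ 2) := by
    rw [hc]; field_simp; ring
  have h5 : (c / t) ^ 2 * ‖y‖ ^ 2 = c ^ 2 * (‖y‖ ^ 2 / t ^ 2) := by field_simp
  have h6 : 2 * (c / t * inner ℝ y y') = 2 * c * (inner ℝ y y' / t) := by field_simp
  rw [h5, h6] at h1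
  rw [h3, h4]
  have h7 : b = 2 * c - μ + 1 := by rw [hc]; ring
  rw [h7] at h2 ⊢
  nlinarith [h1, h2]

/-- The integral of the difference of the integrands over a ray of the cone is nonnegative. -/
theorem ray_integral_nonneg (hSm : IsC2Submanifold m S) (hS : S ⊆ Metric.sphere 0 1)
    (hmin : IsSphereMinimal S) (hh : ContDiffOn ℝ 2 h (Ioi 0))
    (hA2 : ∀ t : ℝ, 0 < t → b ≤ t * deriv h t) (hb : 1 - (m : ℝ) < b) (hx : x ∈ S)
    (hA : sphereSecondFormNormSq S x ≤ ((m : ℝ) - 1 + b) ^ 2 / 4 + b)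
    (hX : IsNormalVariation (coneOver S \ {0}) {0}ᶜ X) :
    0 ≤ ∫ t in Ioi (0 : ℝ), t ^ m *
      (gradientIntegrand (fun x => Real.exp (h ‖x‖)) (coneOver S \ {0}) X (t • x) -
        curvatureIntegrand (fun x => Real.exp (h ‖x‖)) (coneOver S \ {0}) X (t • x)) := by
  have hx1 : ‖x‖ = 1 := by simpa using hS hx
  obtain ⟨K, hK, hK0, hXK⟩ := hX.compactSupport
  obtain ⟨R, hR⟩ := hK.isBounded.exists_norm_le
  obtain ⟨r, hr, hrK⟩ := Metric.isOpen_iff.1 hK.isClosed.isOpen_compl 0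
    (fun h0 => hK0 h0 rfl)
  set α := min (r / 2) 1 with hαdef
  set β := max R 0 + 1 with hβdef
  have hα : 0 < α := lt_min (by linarith) one_pos
  have hαβ : α ≤ β := (min_le_right _ _).trans (by rw [hβdef]; linarith [le_max_right R 0])
  have hnK : ∀ t : ℝ, 0 < t → t ∉ Ioo α β → t • x ∉ K := by
    intro t ht htn hK'
    have hnt : ‖t • x‖ = t := by rw [norm_smul, hx1, mul_one, Real.norm_of_nonneg ht.le]
    refine htn ⟨?_, ?_⟩
    · by_contra hlt
      have : t • x ∈ Metric.ball (0 : EuclideanSpace ℝ (Fin n)) r := by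
        rw [mem_ball_zero_iff, hnt]
        linarith [min_le_left (r / 2) 1]
      exact hrK this hK'
    · have := hR _ hK'
      rw [hnt] at this
      linarith [le_max_left R 0]
  have hX0 : ∀ t : ℝ, 0 < t → t ∉ Ioo α β → X (t • x) = 0 := fun t ht htn =>
    hXK _ ⟨smul_mem_coneOver_diff hS hx ht, hnK t ht htn⟩
  set Y : ℝ → EuclideanSpace ℝ (Fin n) := fun t => X (t • x) with hYdef
  have hY : ContDiffOn ℝ 1 Y (Ioi 0) := contDiffOn_ray hS hx hX.contDiffOn
  set c := ((m : ℝ) - 1 + b) / 2 with hc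
  -- `Z` vanishes at `α` and `β`, and the inequality of Hardy type reads `-Z' ≤ q`
  set Z : ℝ → ℝ := fun t => c * (Real.exp (h t) * t ^ m * ‖Y t‖ ^ 2 / t) with hZdef
  have hZ : ContDiffOn ℝ 1 Z (Ioi 0) := by
    refine contDiffOn_const.mul ((((hh.of_le (by norm_num)).exp.mul
      (contDiffOn_id.pow m)).mul (hY.norm_sq ℝ)).div contDiffOn_id fun t ht => ne_of_gt ht)
  refine setIntegral_Ioi_nonneg_of_neg_deriv_le hα hαβ hZ ?_ ?_ ?_ ?_
  · simp [hZdef, hYdef, hX0 α hα (by simp)]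
  · simp [hZdef, hYdef, hX0 β (hα.trans_le hαβ) (by simp)]
  · intro t ht htn
    have htn' : t ∉ Ioo α β := fun h => htn (Ioo_subset_Icc_self h)
    rw [gradientIntegrand_eq_zero hK.isClosed hXK
      ⟨smul_mem_coneOver_diff hS hx ht, hnK t ht htn'⟩,
      curvatureIntegrand_eq_zero (hX0 t ht htn'), sub_zero, mul_zero]
  · intro t ht
    have ht0 : 0 < t := hα.trans_le ht.1
    have hM := smul_mem_coneOver_diff hS hx ht0
    have hnt : ‖t • x‖ = t := by rw [norm_smul, hx1, mul_one, Real.norm_of_nonneg ht0.le]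
    have hN : X (t • x) ∈ sphereNormalSubspace S x := by
      rw [← normalSubspace_coneOver hSm hS hx ht0]
      exact hX.normal _ hM
    have hperp : inner ℝ (t • x) (X (t • x)) = 0 := by
      rw [real_inner_smul_left]
      have h1 := (Submodule.mem_orthogonal _ _).1 hN x
        (Submodule.mem_sup_right (Submodule.mem_span_singleton_self x))
      rw [h1, mul_zero]
    have hYd : HasDerivAt Y (deriv Y t) t :=
      ((hY.contDiffAt (Ioi_mem_nhds ht0)).differentiableAt (by simp)).hasDerivAt
    have hhd : HasDerivAt h (deriv h t) t :=
      ((hh.contDiffAt (Ioi_mem_nhds ht0)).differentiableAt (by simp)).hasDerivAt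
    have hgrad := norm_sq_deriv_ray_le hSm hS hx hX ht0
    have hcurv := sum_sq_inner_secondForm_coneOver_le hSm hS hx ht0 hN
    have hcurv' := hcurv.trans (mul_le_mul_of_nonneg_left
      (mul_le_mul_of_nonneg_right hA (sq_nonneg ‖X (t • x)‖)) (by positivity))
    have hZd : deriv Z t = Real.exp (h t) * t ^ m * (c * ((deriv h t * t + m - 1) *
        (‖Y t‖ ^ 2 / t ^ 2) + 2 * (inner ℝ (Y t) (deriv Y t) / t))) := by
      have h1 := ((((hhd.exp.mul (hasDerivAt_pow m t)).mul hYd.norm_sq).div (hasDerivAt_id t)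
        ht0.ne').const_mul c).deriv
      refine h1.trans ?_
      -- for `m = 0` the exponent `m - 1` is truncated, but the coefficient vanishes
      have h2 : (m : ℝ) * t ^ (m - 1) = m * t ^ m / t := by
        rcases m with _ | m
        · simp
        · rw [Nat.add_sub_cancel, pow_succ]; field_simp
      simp only [Pi.mul_apply, id, h2]
      field_simp
      ring
    have hkey := hardy_pointwise (Y t) (deriv Y t) (p := deriv h t) (μ := m) ht0 hb (hA2 t ht0)
    rw [gradientIntegrand, curvatureIntegrand, meanCurvature_coneOver hSm hS hmin hM,
      inner_zero_left, fderiv_fderiv_exp_norm hh hM.2 hperp, hnt, hZd]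
    have hw : 0 ≤ Real.exp (h t) * t ^ m := by positivity
    have h3 := mul_le_mul_of_nonneg_left (hkey.trans (sub_le_sub (add_le_add_left hgrad _) hcurv')) hw
    refine le_trans (le_of_eq ?_) (h3.trans (le_of_eq ?_))
    · ring
    · simp only [hYdef]
      ring

end Ray

/-! ### Integration over a cone in polar coordinates -/

section PolarCoordinates

variable {n m : ℕ} {S V : Set (EuclideanSpace ℝ (Fin n))} {W : Set (EuclideanSpace ℝ (Fin m))}
  {F : EuclideanSpace ℝ (Fin m) → EuclideanSpace ℝ (Fin n)} {q : EuclideanSpace ℝ (Fin n) → ℝ}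

theorem measurableSet_directionCone {T : Set (EuclideanSpace ℝ (Fin n))} (hT : MeasurableSet T) :
    MeasurableSet (directionCone T) := by
  have h : Measurable (fun x : EuclideanSpace ℝ (Fin n) => ‖x‖⁻¹ • x) := by fun_prop
  exact (measurableSet_singleton 0).compl.inter (h hT)

/-- Polar coordinates over a parametrized piece of the link: a function on the cone has a
nonnegative integral when its integral over each ray, with density `t ^ m`, is nonnegative. -/
theorem IsLocalParam.setIntegral_directionCone_nonneg (hF : IsLocalParam S V W F)
    (hS : S ⊆ Metric.sphere 0 1) (hq : IntegrableOn q (coneOver S \ {0}) μHE[m + 1])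
    (hray : ∀ x ∈ S, 0 ≤ ∫ t in Ioi (0 : ℝ), t ^ m * q (t • x))
    {T : Set (EuclideanSpace ℝ (Fin n))} (hT : MeasurableSet T) (hTV : T ⊆ V) :
    0 ≤ ∫ x in (coneOver S \ {0}) ∩ directionCone T, q x ∂μHE[m + 1] := by
  have hG := hF.isLocalParam_coneParam hS
  set A := W ∩ F ⁻¹' T with hAdef
  have hA : MeasurableSet A := by
    have h1 : Measurable (W.domRestrict F) := hF.contDiffOn.continuousOn.domRestrict.measurable
    have h2 := hF.isOpen_source.measurableSet.subtype_image (h1 hT)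
    have h3 : Subtype.val '' (W.domRestrict F ⁻¹' T) = A := by
      ext u
      constructor
      · rintro ⟨v, hv, rfl⟩
        exact ⟨v.2, hv⟩
      · rintro ⟨hu, huT⟩
        exact ⟨⟨u, hu⟩, huT, rfl⟩
    rwa [h3] at h2
  have hAW : coneDomain A ⊆ coneDomain W := preimage_mono (prod_mono le_rfl inter_subset_left)
  have hAm : MeasurableSet (coneDomain A) :=
    (radialEquiv m).continuous.measurable (measurableSet_Ioi.prod hA)
  have himage : coneParam F '' coneDomain A = (coneOver S \ {0}) ∩ directionCone T := by
    ext x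
    constructor
    · rintro ⟨y, hy, rfl⟩
      have hx := hG.mem (hAW hy)
      have ht : 0 < (radialEquiv m y).1 := hy.1
      refine ⟨hx, hx.2, ?_⟩
      rw [coneParam, norm_smul, hF.norm_eq_one hS hy.2.1, mul_one, Real.norm_of_nonneg ht.le,
        smul_smul, inv_mul_cancel₀ ht.ne', one_smul]
      exact hy.2.2
    · rintro ⟨hx, hx0, hxT⟩
      obtain ⟨y, hy, rfl⟩ := hG.exists_eq hx ⟨hx0, hTV hxT⟩
      have ht : 0 < (radialEquiv m y).1 := hy.1
      refine ⟨y, ⟨hy.1, hy.2, ?_⟩, rfl⟩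
      rwa [coneParam, norm_smul, hF.norm_eq_one hS hy.2, mul_one, Real.norm_of_nonneg ht.le,
        smul_smul, inv_mul_cancel₀ ht.ne', one_smul] at hxT
  set ψ : ℝ × EuclideanSpace ℝ (Fin m) → ℝ := fun p =>
    p.1 ^ m * (fderiv ℝ F p.2).normDet * q (p.1 • F p.2) with hψ
  have hcongr : ∀ y ∈ coneDomain A, (fderiv ℝ (coneParam F) y).normDet * q (coneParam F y) =
      ψ (radialEquiv m y) := by
    intro y hy
    rw [hF.normDet_fderiv_coneParam hS (hAW hy)]
    rfl
  have hemb : MeasurableEmbedding (radialEquiv m) :=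
    (radialEquiv m).toHomeomorph.measurableEmbedding
  have h1 := hG.isImmersionOn.integral_image hAm hAW q
  have h2 := (hG.isImmersionOn.integrableOn_image_iff hAm hAW q)
  rw [finrank_euclideanSpace_fin, himage] at h1 h2
  have h3 := h2.1 (hq.mono_set inter_subset_left)
  rw [integrableOn_congr_fun hcongr hAm] at h3
  have h4 : IntegrableOn ψ (Ioi 0 ×ˢ A) (volume.prod volume) :=
    ((measurePreserving_radialEquiv m).integrableOn_comp_preimage hemb).1 h3
  rw [h1, setIntegral_congr_fun hAm hcongr]
  rw [coneDomain, (measurePreserving_radialEquiv m).setIntegral_preimage_emb hemb ψ]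
  rw [IntegrableOn, ← Measure.prod_restrict] at h4
  rw [← Measure.prod_restrict, integral_prod_symm ψ h4]
  -- the integral over `A` of the ray integrals, each multiplied by the Jacobian of `F`
  refine setIntegral_nonneg hA fun u hu => ?_
  have h5 : ∀ t : ℝ, ψ (t, u) = (fderiv ℝ F u).normDet * (t ^ m * q (t • F u)) := fun t => by
    rw [hψ]; ring
  simp_rw [h5]
  rw [integral_const_mul]
  exact mul_nonneg (LinearMap.normDet_nonneg _) (hray _ (hF.mem hu.1))

/-- A function on the cone has a nonnegative integral when its integral over each ray, with density
`t ^ m`, is nonnegative. Compactness of the link reduces this to finitely many parametrized pieces,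
which are made disjoint. -/
theorem integral_coneOver_nonneg (hSm : IsC2Submanifold m S) (hS : S ⊆ Metric.sphere 0 1)
    (hSc : IsCompact S) (hq : IntegrableOn q (coneOver S \ {0}) μHE[m + 1])
    (hray : ∀ x ∈ S, 0 ≤ ∫ t in Ioi (0 : ℝ), t ^ m * q (t • x)) :
    0 ≤ ∫ x in coneOver S \ {0}, q x ∂μHE[m + 1] := by
  have key : ∃ T₀ : Set (EuclideanSpace ℝ (Fin n)), S ⊆ T₀ ∧ MeasurableSet T₀ ∧
      ∀ T ⊆ T₀, MeasurableSet T →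
        0 ≤ ∫ x in (coneOver S \ {0}) ∩ directionCone T, q x ∂μHE[m + 1] := by
    refine hSc.induction_on (p := fun T' => ∃ T₀ : Set (EuclideanSpace ℝ (Fin n)),
      T' ⊆ T₀ ∧ MeasurableSet T₀ ∧ ∀ T ⊆ T₀, MeasurableSet T →
        0 ≤ ∫ x in (coneOver S \ {0}) ∩ directionCone T, q x ∂μHE[m + 1]) ?_ ?_ ?_ ?_
    · refine ⟨∅, le_rfl, MeasurableSet.empty, fun T hT _ => ?_⟩
      rw [subset_empty_iff.1 hT]
      simp [directionCone]
    · rintro s t hst ⟨T₀, h1, h2⟩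
      exact ⟨T₀, hst.trans h1, h2⟩
    · rintro s t ⟨A, hsA, hA, hA'⟩ ⟨B, htB, hB, hB'⟩
      refine ⟨A ∪ B, union_subset_union hsA htB, hA.union hB, fun T hT hTm => ?_⟩
      have h1 : (coneOver S \ {0}) ∩ directionCone T =
          ((coneOver S \ {0}) ∩ directionCone (T ∩ A)) ∪ ((coneOver S \ {0}) ∩ directionCone (T \ A)) := by
        ext x
        simp only [directionCone, mem_inter_iff, mem_union, mem_ofPred_eq, Set.mem_sdiff]
        tauto
      have h2 : Disjoint ((coneOver S \ {0}) ∩ directionCone (T ∩ A))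
          ((coneOver S \ {0}) ∩ directionCone (T \ A)) :=
        disjoint_left.2 fun x hx hx' => hx'.2.2.2 hx.2.2.2
      rw [h1, setIntegral_union h2 ((measurableSet_coneOver_diff hS hSc).inter
        (measurableSet_directionCone (hTm.diff hA))) (hq.mono_set inter_subset_left)
        (hq.mono_set inter_subset_left)]
      exact add_nonneg (hA' _ inter_subset_right (hTm.inter hA))
        (hB' _ (fun x hx => (hT hx.1).resolve_left hx.2) (hTm.diff hA))
    · intro x hx
      obtain ⟨V, W, F, hxV, hF⟩ := hSm.exists_isLocalParam hx
      exact ⟨V, mem_nhdsWithin_of_mem_nhds (hF.isOpen_target.mem_nhds hxV), V, le_rfl,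
        hF.isOpen_target.measurableSet,
        fun T hTV hT => hF.setIntegral_directionCone_nonneg hS hq hray hT hTV⟩
  obtain ⟨T₀, hST, -, hT₀⟩ := key
  have h1 := hT₀ S hST hSc.isClosed.measurableSet
  have h2 : coneOver S \ {0} ⊆ directionCone S := fun x hx => (mem_coneOver_diff hS).1 hx
  rwa [inter_eq_self_of_subset_left h2] at h1

end PolarCoordinates

end

theorem theorem1p6 (n k : ℕ) (hk : 1 ≤ k) (S : Set (EuclideanSpace ℝ (Fin n)))
    (hS_sphere : S ⊆ Metric.sphere 0 1)
    (hS_compact : IsCompact S)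
    (hS_submanifold : IsC2Submanifold (k - 1) S)
    (hS_minimal : IsSphereMinimal S)
    (hS_flat : HasGloballyFlatNormalBundle S)
    (h : ℝ → ℝ) (hh : ContDiffOn ℝ 2 h (Set.Ioi 0))
    (a b : ℝ)
    (hA1 : Filter.Tendsto (fun t => Real.exp (h t) * t ^ k) (nhdsWithin 0 (Set.Ioi 0)) (nhds a))
    (hA2 : ∀ t : ℝ, 0 < t → b ≤ t * deriv h t)
    (hb : 2 - (k : ℝ) < b)
    (hA : ∀ x ∈ S, sphereSecondFormNormSq S x ≤ ((k : ℝ) - 2 + b) ^ 2 / 4 + b) :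
    IsFStable (fun x => Real.exp (h ‖x‖)) k (coneOver S \ {0}) {0}ᶜ := by
  obtain ⟨m, rfl⟩ : ∃ m, k = m + 1 := ⟨k - 1, by omega⟩
  rw [Nat.add_sub_cancel] at hS_submanifold
  have hb' : 1 - (m : ℝ) < b := by push_cast at hb; linarith
  have hA' : ∀ x ∈ S, sphereSecondFormNormSq S x ≤ ((m : ℝ) - 1 + b) ^ 2 / 4 + b := by
    intro x hx
    refine (hA x hx).trans (le_of_eq ?_)
    push_cast
    ring
  have hM := hS_submanifold.coneOver_diff hS_sphere
  have hMU : coneOver S \ {0} ⊆ ({0}ᶜ : Set (EuclideanSpace ℝ (Fin n))) := fun x hx => hx.2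
  have hMm := measurableSet_coneOver_diff hS_sphere hS_compact
  have hcl : ∀ K ⊆ ({0}ᶜ : Set (EuclideanSpace ℝ (Fin n))), IsCompact K →
      IsCompact ((coneOver S \ {0}) ∩ K) := fun K hK0 hK =>
    isCompact_coneOver_inter hS_sphere hS_compact hK hK0
  have hH : ∀ x ∈ coneOver S \ {0}, meanCurvature (coneOver S \ {0}) x = 0 := fun x hx =>
    meanCurvature_coneOver hS_submanifold hS_sphere hS_minimal hx
  have hf : ContDiffOn ℝ 2 (fun x : EuclideanSpace ℝ (Fin n) => Real.exp (h ‖x‖)) {0}ᶜ :=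
    contDiffOn_exp_norm hh
  have hcurv : ∀ X, IsNormalVariation (coneOver S \ {0}) {0}ᶜ X →
      IntegrableOn (curvatureIntegrand (fun x => Real.exp (h ‖x‖)) (coneOver S \ {0}) X)
        (coneOver S \ {0}) μHE[m + 1] := by
    intro X hX
    obtain ⟨K, hK, hK0, hXK⟩ := hX.compactSupport
    exact hM.integrableOn_of_compactSupport hMm (hcl K hK0 hK)
      (hM.continuousOn_curvatureIntegrand hH (hf.continuousOn.mono hMU) hX)
      fun x hx => curvatureIntegrand_eq_zero (hXK x hx)
  have hgrad : ∀ X, IsNormalVariation (coneOver S \ {0}) {0}ᶜ X →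
      IntegrableOn (gradientIntegrand (fun x => Real.exp (h ‖x‖)) (coneOver S \ {0}) X)
        (coneOver S \ {0}) μHE[m + 1] := by
    intro X hX
    obtain ⟨K, hK, hK0, hXK⟩ := hX.compactSupport
    exact hM.integrableOn_of_compactSupport hMm (hcl K hK0 hK)
      (hM.continuousOn_gradientIntegrand isOpen_compl_singleton hMU hf hX)
      fun x hx => gradientIntegrand_eq_zero hK.isClosed hXK hx
  refine ⟨isOpen_compl_singleton, compl_inter_closure_coneOver hS_sphere hS_compact, hM, ?_, hcurv,
    hgrad, fun X hX => ?_⟩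
  · refine hM.isFStationary isOpen_compl_singleton hMU hcl hH (hf.of_le (by norm_num))
      fun x hx ξ hξ => ?_
    -- the gradient of the radial weight is radial, and the radial direction is tangent to the cone
    obtain ⟨hx0, hxS⟩ := (mem_coneOver_diff hS_sphere).1 hx
    refine fderiv_exp_norm_apply_eq_zero hh hx0 ?_
    have hxs : ‖x‖ • (‖x‖⁻¹ • x) = x := by
      rw [smul_smul, mul_inv_cancel₀ (norm_ne_zero_iff.2 hx0), one_smul]
    have h1 := mem_tangentSubspace_coneOver hS_submanifold hS_sphere hxS (norm_pos_iff.2 hx0)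
    rw [hxs] at h1
    have h2 := (Submodule.mem_orthogonal _ _).1 hξ _ h1
    rw [real_inner_smul_left] at h2
    exact (mul_eq_zero.1 h2).resolve_left (inv_ne_zero (norm_ne_zero_iff.2 hx0))
  · rw [← sub_nonneg, ← integral_sub (hgrad X hX) (hcurv X hX)]
    exact integral_coneOver_nonneg hS_submanifold hS_sphere hS_compact
      ((hgrad X hX).sub (hcurv X hX)) fun x hx =>
        ray_integral_nonneg hS_submanifold hS_sphere hS_minimal hh hA2 hb' hx (hA' x hx) hX
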